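/- Let $\mathbb T=\mathbb R/2\pi\mathbb Z$, identified with $(-\pi,\pi]$, let $H f(\theta)=\frac1{2\pi}\,\mathrm{P.V.}\!\int_{-\pi}^{\pi}\cot\frac{\theta-\phi}{2}\,f(\phi)\,d\phi$ be the Hilbert transform on $\mathbb T$, let $\rho(\theta)=\frac{1}{4\pi\sin^2\theta}$, and write $\rho^{1/2}(\theta)=\frac{1}{2\sqrt{\pi}\,\sin\theta}$ (the square root carrying the sign of $\sin\theta$). Let $$\mathcal H_{DW}=\Big\{\eta\in H^1(\mathbb T):\ \eta \text{ odd},\ \int_{\mathbb T}\frac{|\partial_\theta\eta|^2}{\sin^2\theta}\,d\theta<\infty\Big\},\qquad \langle\xi,\eta\rangle_\rho=\int_{-\pi}^{\pi}\rho\,\partial_\theta\xi\,\partial_\theta\eta\,d\theta,\qquad \|\eta\|_{\mathcal H_{DW}}=\langle\eta,\eta\rangle_\rho^{1/2},$$ and $\tilde e_k(\theta)=\frac{\sin (k+2)\theta}{k+2}-\frac{\sin k\theta}{k}$ for $k\ge1$. Consider the linearization of the De Gregorio equation around $-\sin2\theta$, $$\partial_t\eta+\tfrac12\sin2\theta\,\partial_\theta\eta-\cos2\theta\,\eta+\sin2\theta\,H\eta-2\cos2\theta\,v=0,\qquad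 \partial_\theta v=H\eta,\qquad \eta(0,\theta)=\eta_0(\theta),\qquad v(t,0)=0. \tag{$*$}$$ A classical odd solution of $(*)$ on $[0,T]$ is a pair $(\eta,v)$ of functions $2\pi$-periodic in $\theta$, with $\eta$ odd in $\theta$ and $C^1$ on $[0,T]\times\mathbb T$, for which the equations of $(*)$ hold at every point (the initial condition being understood for $\eta_0$ as an element of $H^1(\mathbb T)$). **Theorem 1.1.** Let $m>3$ be an integer, and let $\eta_0\in\mathcal H_{DW}$ satisfy $\rho^{1/2}\partial_\theta\eta_0\in H^m(\mathbb T)$. Then for every $T>0$ there is a classical odd solution $(\eta,v)$ of $(*)$ on $[0,T]$, it is unique among all classical odd solutions on $[0,T]$, and it satisfies $\eta\in C([0,T];\mathcal H_{DW})$ and $$\rho^{1/2}\partial_\theta\eta\in C([0,T];H^m(\mathbb T))\cap C^2([0,T];H^{m-2}(\mathbb T)).$$ Moreover, the coefficients $c_k(t)=\langle\eta(t),\tilde e_k\rangle_\rho$, $k\ge1$, belong to $C^2([0,T])$, and there is a constant $C$ (depending on $m$, $\eta_0$ and $T$) such that $$\sup_{0\le t\le T}\Big|\frac{d^j}{dt^j}c_k(t)\Big|\le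 \frac{C}{k^{\,m-j}}\qquad\text{for } j=0,1,2 \text{ and all } k\ge1.$$ -/

import Mathlib

open MeasureTheory Filter Topology Set

noncomputable section

namespace DeGregorio

/-- Lebesgue measure on one period `(-π, π]` of the torus `𝕋`. Functions on the torus are
`2π`-periodic functions on `ℝ`. -/
abbrev torusMeasure : Measure ℝ := volume.restrict (Ioc (-Real.pi) Real.pi)

/-- `g` is the `k`-th weak derivative of `f` on the torus: integration by parts holds against
every smooth `2π`-periodic test function. -/
def IsWeakDeriv (k : ℕ) (f g : ℝ → ℝ) : Prop :=
  ∀ φ : ℝ → ℝ, ContDiff ℝ ((⊤ : ℕ∞) : WithTop ℕ∞) φ → Function.Periodic φ (2 * Real.pi) →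
    ∫ θ, f θ * iteratedDeriv k φ θ ∂torusMeasure = (-1) ^ k * ∫ θ, g θ * φ θ ∂torusMeasure

theorem integrable_mul_of_continuous (f : Lp ℝ 2 torusMeasure) {ψ : ℝ → ℝ} (hψ : Continuous ψ) :
    Integrable (fun θ => f θ * ψ θ) torusMeasure := by
  have hf : Integrable (f : ℝ → ℝ) torusMeasure :=
    (Lp.memLp f).integrable (by norm_num)
  obtain ⟨C, hC⟩ := (isCompact_Icc (a := -Real.pi) (b := Real.pi)).exists_bound_of_continuousOn
    hψ.continuousOn
  refine hf.mul_bdd (c := C) hψ.aestronglyMeasurable ?_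
  filter_upwards [ae_restrict_mem measurableSet_Ioc] with θ hθ
  exact hC θ ⟨hθ.1.le, hθ.2⟩

/-- The Sobolev space `H^m(𝕋)`. An element is the tuple `(f, f', …, f^{(m)})` of a function
`f ∈ L²(𝕋)` and its weak derivatives, all in `L²(𝕋)`; the inherited norm is
`‖f‖_{H^m} = (∑_{k ≤ m} ‖f^{(k)}‖_{L²}²)^{1/2}`. -/
def Sobolev (m : ℕ) :
    Submodule ℝ (PiLp 2 (fun _ : Fin (m + 1) => Lp ℝ 2 torusMeasure)) where
  carrier := {U | ∀ k : Fin (m + 1), IsWeakDeriv k (U 0) (U k)}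
  zero_mem' := by
    intro k φ _ _
    have h : ((0 : Lp ℝ 2 torusMeasure) : ℝ → ℝ) =ᵐ[torusMeasure] 0 := Lp.coeFn_zero ..
    have h0 : ∀ ψ : ℝ → ℝ,
        ∫ θ, (0 : Lp ℝ 2 torusMeasure) θ * ψ θ ∂torusMeasure = 0 := by
      intro ψ
      rw [integral_congr_ae (g := fun _ => (0 : ℝ))]
      · simp
      · filter_upwards [h] with θ hθ
        rw [hθ, Pi.zero_apply, zero_mul]
    simp only [PiLp.zero_apply]
    rw [h0, h0, mul_zero]
  add_mem' := by
    intro U V hU hV k φ hφ hp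
    have key : ∀ (f g : Lp ℝ 2 torusMeasure) (ψ : ℝ → ℝ), Continuous ψ →
        ∫ θ, (f + g : Lp ℝ 2 torusMeasure) θ * ψ θ ∂torusMeasure =
          ∫ θ, f θ * ψ θ ∂torusMeasure + ∫ θ, g θ * ψ θ ∂torusMeasure := by
      intro f g ψ hψ
      rw [← integral_add (integrable_mul_of_continuous f hψ) (integrable_mul_of_continuous g hψ)]
      refine integral_congr_ae ?_
      filter_upwards [Lp.coeFn_add f g] with θ hθ
      rw [hθ, Pi.add_apply, add_mul]
    have hc : Continuous (iteratedDeriv k φ) :=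
      hφ.continuous_iteratedDeriv k (by exact_mod_cast le_top)
    simp only [PiLp.add_apply]
    rw [key _ _ _ hc, key _ _ _ hφ.continuous, hU k φ hφ hp, hV k φ hφ hp]
    ring
  smul_mem' := by
    intro c U hU k φ hφ hp
    have key : ∀ (f : Lp ℝ 2 torusMeasure) (ψ : ℝ → ℝ),
        ∫ θ, (c • f : Lp ℝ 2 torusMeasure) θ * ψ θ ∂torusMeasure =
          c * ∫ θ, f θ * ψ θ ∂torusMeasure := by
      intro f ψ
      rw [← integral_const_mul]
      refine integral_congr_ae ?_
      filter_upwards [Lp.coeFn_smul c f] with θ hθ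
      rw [hθ, Pi.smul_apply, smul_eq_mul, mul_assoc]
    simp only [PiLp.smul_apply]
    rw [key, key, hU k φ hφ hp]
    ring

/-- The `k`-th weak derivative of an element of `H^m(𝕋)`, for `k ≤ m`; for `k = 0` the function
itself. -/
def wderiv {m : ℕ} (U : Sobolev m) (k : Fin (m + 1)) : Lp ℝ 2 torusMeasure :=
  (U : PiLp 2 (fun _ : Fin (m + 1) => Lp ℝ 2 torusMeasure)) k

/-- The element `U` of `H^m(𝕋)` is the class of the function `f`. -/
def Represents {m : ℕ} (U : Sobolev m) (f : ℝ → ℝ) : Prop :=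
  (wderiv U 0 : ℝ → ℝ) =ᵐ[torusMeasure] f

/-- `f ∈ H^m(𝕋)`. -/
def MemSobolev (m : ℕ) (f : ℝ → ℝ) : Prop :=
  ∃ U : Sobolev m, Represents U f

/-- The weight `ρ(θ) = 1 / (4 π sin² θ)`. -/
def rho (θ : ℝ) : ℝ := 1 / (4 * Real.pi * Real.sin θ ^ 2)

/-- The square root `ρ^{1/2}(θ) = 1 / (2 √π sin θ)` of the weight, with the sign of `sin θ`;
this is the branch for which `ρ^{1/2} ∂_θ ẽ_k = - π^{-1/2} sin ((k + 1) θ)`. -/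
def rhoHalf (θ : ℝ) : ℝ := 1 / (2 * Real.sqrt Real.pi * Real.sin θ)

theorem rhoHalf_sq (θ : ℝ) : rhoHalf θ ^ 2 = rho θ := by
  unfold rhoHalf rho
  rw [div_pow, mul_pow, mul_pow, Real.sq_sqrt Real.pi_pos.le]
  norm_num

/-- The weighted space `H_DW`: odd functions in `H^1(𝕋)` with `∫ |∂_θ ξ|² / sin² θ dθ < ∞`. -/
def HDW : Set (Sobolev 1) :=
  {ξ | (∀ᵐ θ ∂torusMeasure, wderiv ξ 0 (-θ) = -wderiv ξ 0 θ) ∧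
    ∫⁻ θ, ENNReal.ofReal ((wderiv ξ 1 θ) ^ 2 / Real.sin θ ^ 2) ∂torusMeasure < ⊤}

/-- The norm `‖ξ‖_{H_DW} = (∫ ρ (∂_θ ξ)² dθ)^{1/2} = ‖ρ^{1/2} ∂_θ ξ‖_{L²}` (finite on `HDW`). -/
def hdwNorm (ξ : Sobolev 1) : ENNReal :=
  eLpNorm (fun θ => rhoHalf θ * wderiv ξ 1 θ) 2 torusMeasure

/-- `f ∈ C([0,T]; H_DW)`. -/
def ContinuousInHDW (T : ℝ) (f : ℝ → ℝ → ℝ) : Prop :=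
  ∃ E : ℝ → Sobolev 1, (∀ t ∈ Icc 0 T, E t ∈ HDW ∧ Represents (E t) (f t)) ∧
    ∀ t₀ ∈ Icc 0 T, Tendsto (fun t => hdwNorm (E t - E t₀)) (𝓝[Icc 0 T] t₀) (𝓝 0)

/-- `f ∈ C^n([0,T]; H^m(𝕋))`. -/
def ContDiffInSobolev (n m : ℕ) (T : ℝ) (f : ℝ → ℝ → ℝ) : Prop :=
  ∃ U : ℝ → Sobolev m, (∀ t ∈ Icc 0 T, Represents (U t) (f t)) ∧ ContDiffOn ℝ n U (Icc 0 T)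

/-- The Hilbert kernel integral over one period with the interval `|θ - φ| ≤ ε` removed. -/
def truncatedHilbert (f : ℝ → ℝ) (θ ε : ℝ) : ℝ :=
  1 / (2 * Real.pi) *
    ∫ φ in {φ : ℝ | ε < |θ - φ| ∧ |θ - φ| < Real.pi}, Real.cot ((θ - φ) / 2) * f φ

/-- The principal value defining the Hilbert transform of the `2π`-periodic function `f`
exists at `θ` and equals `h`. -/
def HasHilbertTransformAt (f : ℝ → ℝ) (h θ : ℝ) : Prop :=
  Tendsto (truncatedHilbert f θ) (𝓝[>] 0) (𝓝 h)

/-- The Hilbert transform `Hf(θ) = (1/2π) P.V. ∫ cot ((θ - φ)/2) f(φ) dφ` on the torus. -/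
def hilbert (f : ℝ → ℝ) (θ : ℝ) : ℝ := limUnder (𝓝[>] 0) (truncatedHilbert f θ)

/-- The linearized operator
`Lη = ½ sin 2θ ∂_θ η - cos 2θ η + sin 2θ Hη - 2 cos 2θ v`. -/
def linearizedOp (η v : ℝ → ℝ) (θ : ℝ) : ℝ :=
  1 / 2 * Real.sin (2 * θ) * deriv η θ - Real.cos (2 * θ) * η θ
    + Real.sin (2 * θ) * hilbert η θ - 2 * Real.cos (2 * θ) * v θ

/-- `(η, v)` is a classical odd solution on `[0,T]` of `η_t + Lη = 0`, `∂_θ v = Hη` with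
`η(0,·) = η₀` and gauge `v(t,0) = 0`: `η` is `C¹` on `[0,T] × 𝕋` and the equations hold at every
point (with one-sided time derivatives at `t = 0` and `t = T`). -/
structure IsClassicalOddSolution (T : ℝ) (η₀ : Sobolev 1) (η v : ℝ → ℝ → ℝ) : Prop where
  contDiffOn : ContDiffOn ℝ 1 (fun p : ℝ × ℝ => η p.1 p.2) (Icc 0 T ×ˢ univ)
  periodic : ∀ t ∈ Icc 0 T,
    Function.Periodic (η t) (2 * Real.pi) ∧ Function.Periodic (v t) (2 * Real.pi)
  odd : ∀ t ∈ Icc 0 T, ∀ θ, η t (-θ) = -η t θ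
  hasHilbert : ∀ t ∈ Icc 0 T, ∀ θ, HasHilbertTransformAt (η t) (hilbert (η t) θ) θ
  evolution : ∀ t ∈ Icc 0 T, ∀ θ,
    HasDerivWithinAt (fun s => η s θ) (-linearizedOp (η t) (v t) θ) (Icc 0 T) t
  velocity : ∀ t ∈ Icc 0 T, ∀ θ, HasDerivAt (v t) (hilbert (η t) θ) θ
  initial : Represents η₀ (η 0)
  gauge : ∀ t ∈ Icc 0 T, v t 0 = 0

/-- `ẽ_k(θ) = sin ((k+2)θ) / (k+2) - sin (kθ) / k`, `k ≥ 1`. -/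
def eTilde (k : ℕ) (θ : ℝ) : ℝ :=
  Real.sin ((k + 2) * θ) / (k + 2) - Real.sin (k * θ) / k

/-- The inner product `⟨ξ, ζ⟩_ρ = ∫ ρ ∂_θ ξ ∂_θ ζ dθ` of differentiable functions. -/
def rhoInner (ξ ζ : ℝ → ℝ) : ℝ := ∫ θ, rho θ * deriv ξ θ * deriv ζ θ ∂torusMeasure

/-- The `k`-th coefficient `t ↦ ⟨η(t), ẽ_k⟩_ρ` of `η` in the orthonormal family `(ẽ_k)`. -/
def coeff (η : ℝ → ℝ → ℝ) (k : ℕ) (t : ℝ) : ℝ := rhoInner (η t) (eTilde k)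

end DeGregorio

end

open DeGregorio

/-! Divide the derivative by the weight. Each `etaMode n`, a multiple of `ẽ_{n+1}`, satisfies `∂_θ
etaMode n = sin θ · sin ((n+2)θ)`. So if `η = ∑ w_n etaMode n`, then `ρ^{1/2} ∂_θ η = (2√π)⁻¹ ∑ w_n
sin ((n+2)θ)`. The weighted energy norm becomes a multiple of the `ℓ²` norm of `w`, `H^m` regularity
becomes square summability of `(n+2)^m w_n`, and `⟨η, ẽ_{n+1}⟩_ρ = -w_n / 2`. Since `H sin (kθ) =
-cos (kθ)` for `k ≥ 1`, the equation turns into an infinite system `w_n' = c_n w_{n+2} - c_{n-2}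
w_{n-2} + d_n w_n`, with the `w_{n-2}` term absent for `n < 2`. Here `c_n` is `coupling n`, of size
about `n / 4`, and `d_n` is the bounded `diagCoeff n`. The unbounded part is skew-symmetric
(`linearized_etaMode_zero`, `linearized_etaMode_one`, `linearized_etaMode_add_two`,
`inner_generator_etaMode`).

Existence. For `y_n = (n+2)^s w_n` the weights spoil skewness only by `c_n` times a quantity of size
`O(1/n)`, so the energy estimate survives in every weighted space (`abs_inner_cutGenerator_le`).
Cutting the coupling off at a finite mode gives bounded generators, whose exponentials obey this
estimate uniformly. Duhamel's formula, with two spare weights to absorb the growth of `c_n`, shows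
that these exponentials converge locally uniformly in time (`exists_tendstoLocallyUniformly_exp`,
`exists_evolution`). The limit solves the system after the loss of one weight. Each time derivative
costs one weight, which gives both the `C²` statement and the factor `k^{-(m-j)}`.

Initial data. The sine coefficients of `ρ^{1/2} ∂_θ η₀` define `y` at time zero, by Bessel's
inequality for the `m`-th derivative. The coefficient of `sin θ` must vanish because `∂_θ η₀` has
mean zero, and oddness makes the sine coefficients determine `η₀` (`exists_represents_etaOf`).

Uniqueness. A competing solution is only `C¹`, so the plain sine coefficients `a_k = ∫ η sin (kθ)`
are used. They satisfy another system coupling `k` to `k ± 2`, again skew up to bounded terms. The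
energy of the first `N + 1` modes obeys a Gronwall inequality with a boundary flux at the
truncation. Since `|k a_k|` is bounded for a `C¹` function, the flux is `O(1/N)`, and letting `N →
∞` gives zero (`hierarchy_eq_zero`). -/

noncomputable section

namespace DeGregorio

/-! ### Operators on `ℓ²` coupling the indices `n` and `n ± 2`. -/

section Sequences

/-- Real square-summable sequences. -/
abbrev EllTwo : Type := lp (fun _ : ℕ => ℝ) 2

theorem EllTwo.summable_sq (x : EllTwo) : Summable fun n => x n ^ 2 := by
  simpa [sq] using lp.summable_inner (𝕜 := ℝ) x x

theorem EllTwo.norm_sq_eq (x : EllTwo) : ‖x‖ ^ 2 = ∑' n, x n ^ 2 := by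
  rw [← real_inner_self_eq_norm_sq, lp.inner_eq_tsum]
  simp [sq]

theorem memEllTwo_of_summable_sq {f : ℕ → ℝ} (h : Summable fun n => f n ^ 2) :
    Memℓp (E := fun _ : ℕ => ℝ) f 2 := by
  refine memℓp_gen ?_
  simpa using h

theorem EllTwo.clm_ext {F : Type*} [NormedAddCommGroup F] [NormedSpace ℝ F]
    {S T : EllTwo →L[ℝ] F} (h : ∀ n, S (lp.single 2 n (1 : ℝ)) = T (lp.single 2 n (1 : ℝ))) :
    S = T := by
  refine lp.ext_continuousLinearMap (by norm_num) fun n => ?_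
  ext
  simpa using h n

theorem EllTwo.abs_apply_le (x : EllTwo) (n : ℕ) : |x n| ≤ ‖x‖ :=
  lp.norm_apply_le_norm (by norm_num) x n

/-- Evaluation of a sequence at an index. -/
def evalL (n : ℕ) : EllTwo →L[ℝ] ℝ :=
  LinearMap.mkContinuous
    { toFun := fun x => x n, map_add' := fun _ _ => rfl, map_smul' := fun _ _ => rfl } 1
    (fun x => (x.abs_apply_le n).trans_eq (one_mul _).symm)

@[simp] theorem evalL_apply (n : ℕ) (x : EllTwo) : evalL n x = x n := rfl

/-- A sequence is bounded. -/
def BddSeq (d : ℕ → ℝ) : Prop := ∃ C, ∀ n, |d n| ≤ C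

theorem summable_sq_mul {d : ℕ → ℝ} (hd : BddSeq d) (x : EllTwo) :
    Summable fun n => (d n * x n) ^ 2 := by
  obtain ⟨C, hC⟩ := hd
  refine Summable.of_nonneg_of_le (fun n => sq_nonneg _) (fun n => ?_)
    (x.summable_sq.mul_left (C ^ 2))
  rw [mul_pow]
  exact mul_le_mul_of_nonneg_right
    (sq_le_sq' (neg_le_of_abs_le (hC n)) (le_of_abs_le (hC n))) (sq_nonneg _)

theorem norm_le_of_abs_le {x z : EllTwo} {d : ℕ → ℝ} {C : ℝ} (hC : 0 ≤ C)
    (hd : ∀ n, |d n| ≤ C) (h : ∀ n, z n = d n * x n) : ‖z‖ ≤ C * ‖x‖ := by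
  refine abs_le_of_sq_le_sq' ?_ (by positivity) |>.2
  rw [mul_pow, EllTwo.norm_sq_eq, EllTwo.norm_sq_eq, ← tsum_mul_left]
  refine Summable.tsum_le_tsum (fun n => ?_) z.summable_sq (x.summable_sq.mul_left _)
  rw [h, mul_pow]
  exact mul_le_mul_of_nonneg_right
    (sq_le_sq' (neg_le_of_abs_le (hd n)) (le_of_abs_le (hd n))) (sq_nonneg _)

/-- Multiplication by a bounded sequence. -/
def diag (d : ℕ → ℝ) (hd : BddSeq d) : EllTwo →L[ℝ] EllTwo :=
  LinearMap.mkContinuousOfExistsBound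
    { toFun := fun x => ⟨fun n => d n * x n, memEllTwo_of_summable_sq (summable_sq_mul hd x)⟩
      map_add' := fun x y => by ext n; exact mul_add _ _ _
      map_smul' := fun c x => by ext n; exact mul_left_comm _ _ _ }
    (by
      obtain ⟨C, hC⟩ := hd
      exact ⟨C, fun x => norm_le_of_abs_le ((abs_nonneg _).trans (hC 0)) hC fun _ => rfl⟩)

@[simp] theorem diag_apply (d : ℕ → ℝ) (hd : BddSeq d) (x : EllTwo) (n : ℕ) :
    diag d hd x n = d n * x n := rfl

theorem norm_diag_le {d : ℕ → ℝ} (hd : BddSeq d) {C : ℝ} (hC : 0 ≤ C) (h : ∀ n, |d n| ≤ C) :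
    ‖diag d hd‖ ≤ C :=
  ContinuousLinearMap.opNorm_le_bound _ hC fun _ => norm_le_of_abs_le hC h fun _ => rfl

/-- Finite truncations of a sequence can be divided entrywise by `d`, and they converge to the
sequence. -/
theorem denseRange_diag {d : ℕ → ℝ} (hd : BddSeq d) (h0 : ∀ n, d n ≠ 0) :
    DenseRange (diag d hd) := by
  intro x
  refine mem_closure_of_tendsto (lp.hasSum_single (by norm_num) x) (Eventually.of_forall ?_)
  intro s
  refine ⟨∑ i ∈ s, lp.single 2 i (x i / d i), ?_⟩
  rw [map_sum]
  refine Finset.sum_congr rfl fun i _ => ?_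
  ext n
  rw [diag_apply]
  by_cases hn : n = i
  · subst hn
    simp [mul_div_cancel₀ _ (h0 n)]
  · simp [Pi.single_eq_of_ne hn]

/-- The shift `(x_n) ↦ (x_{n+2})`. -/
def shift : EllTwo →L[ℝ] EllTwo :=
  LinearMap.mkContinuous
    { toFun := fun x => ⟨fun n => x (n + 2), memEllTwo_of_summable_sq
        (x.summable_sq.comp_injective (add_left_injective 2))⟩
      map_add' := fun x y => by ext n; rfl
      map_smul' := fun c x => by ext n; rfl } 1
    (fun x => by
      rw [one_mul]
      refine abs_le_of_sq_le_sq' ?_ (by positivity) |>.2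
      rw [EllTwo.norm_sq_eq, EllTwo.norm_sq_eq, ← x.summable_sq.sum_add_tsum_nat_add 2]
      exact le_add_of_nonneg_left (Finset.sum_nonneg fun i _ => sq_nonneg _))

@[simp] theorem shift_apply (x : EllTwo) (n : ℕ) : shift x n = x (n + 2) := rfl

theorem norm_shift_le : ‖shift‖ ≤ 1 := LinearMap.mkContinuous_norm_le _ zero_le_one _

theorem inner_diag_left (d : ℕ → ℝ) (hd : BddSeq d) (x y : EllTwo) :
    inner ℝ (diag d hd x) y = inner ℝ x (diag d hd y) := by
  rw [lp.inner_eq_tsum, lp.inner_eq_tsum]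
  refine tsum_congr fun n => ?_
  simp
  ring

theorem adjoint_shift_apply_add (x : EllTwo) (n : ℕ) :
    ContinuousLinearMap.adjoint shift x (n + 2) = x n := by
  have h := lp.inner_single_left (𝕜 := ℝ) (n + 2) (1 : ℝ) (ContinuousLinearMap.adjoint shift x)
  rw [ContinuousLinearMap.adjoint_inner_right] at h
  have e : shift (lp.single 2 (n + 2) (1 : ℝ)) = lp.single 2 n (1 : ℝ) := by
    ext k
    by_cases hk : k = n
    · subst hk; simp
    · simp [Pi.single_eq_of_ne hk, Pi.single_eq_of_ne (show k + 2 ≠ n + 2 by omega)]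
  rw [e, lp.inner_single_left] at h
  simpa using h.symm

theorem adjoint_shift_apply_of_lt (x : EllTwo) {n : ℕ} (hn : n < 2) :
    ContinuousLinearMap.adjoint shift x n = 0 := by
  have h := lp.inner_single_left (𝕜 := ℝ) n (1 : ℝ) (ContinuousLinearMap.adjoint shift x)
  rw [ContinuousLinearMap.adjoint_inner_right] at h
  have e : shift (lp.single 2 n (1 : ℝ)) = 0 := by
    ext k
    simp [Pi.single_eq_of_ne (show k + 2 ≠ n by omega)]
  rw [e] at h
  simpa using h.symm

theorem norm_adjoint_shift_le : ‖ContinuousLinearMap.adjoint shift‖ ≤ 1 := by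
  simpa using norm_shift_le

/-- The operator `(x_n) ↦ (a_n x_{n+2} + b_{n-2} x_{n-2} + d_n x_n)`. -/
def tri (a b d : ℕ → ℝ) (ha : BddSeq a) (hb : BddSeq b) (hd : BddSeq d) : EllTwo →L[ℝ] EllTwo :=
  diag a ha ∘L shift + ContinuousLinearMap.adjoint shift ∘L diag b hb + diag d hd

variable {a b d a' b' d' p q : ℕ → ℝ}

theorem tri_apply_add (ha : BddSeq a) (hb : BddSeq b) (hd : BddSeq d) (x : EllTwo) (n : ℕ) :
    tri a b d ha hb hd x (n + 2) = a (n + 2) * x (n + 4) + b n * x n + d (n + 2) * x (n + 2) := by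
  simp [tri, adjoint_shift_apply_add]

theorem tri_apply_of_lt (ha : BddSeq a) (hb : BddSeq b) (hd : BddSeq d) (x : EllTwo) {n : ℕ}
    (hn : n < 2) :
    tri a b d ha hb hd x n = a n * x (n + 2) + d n * x n := by
  simp [tri, adjoint_shift_apply_of_lt _ hn]

/-- With `S` the shift, `⟨a S x, x⟩ + ⟨S* b x, x⟩ = ⟨S x, (a + b) x⟩`. Only the sum `a + b` enters,
so the individual sizes of `a` and `b`, which grow with the cutoff, do not affect the energy
estimate. -/
theorem abs_inner_tri_le (ha : BddSeq a) (hb : BddSeq b) (hd : BddSeq d) {C₁ C₂ : ℝ}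
    (h₁ : ∀ n, |a n + b n| ≤ C₁) (h₂ : ∀ n, |d n| ≤ C₂) (x : EllTwo) :
    |inner ℝ (tri a b d ha hb hd x) x| ≤ (C₁ + C₂) * ‖x‖ ^ 2 := by
  have hC₁ := (abs_nonneg _).trans (h₁ 0)
  have hC₂ := (abs_nonneg _).trans (h₂ 0)
  have e : inner ℝ (tri a b d ha hb hd x) x
      = inner ℝ (shift x) (diag (fun n => a n + b n) ⟨C₁, h₁⟩ x) + inner ℝ (diag d hd x) x := by
    have e1 : diag (fun n => a n + b n) ⟨C₁, h₁⟩ x = diag a ha x + diag b hb x := by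
      ext n; exact add_mul _ _ _
    rw [e1]
    simp only [tri, add_apply, ContinuousLinearMap.comp_apply, inner_add_left,
      inner_add_right, ContinuousLinearMap.adjoint_inner_left, inner_diag_left a]
    rw [real_inner_comm (diag b hb x) (shift x)]
  rw [e]
  have k1 : ‖shift x‖ ≤ ‖x‖ := by simpa using shift.le_of_opNorm_le norm_shift_le x
  have k2 := (diag _ ⟨C₁, h₁⟩).le_of_opNorm_le (norm_diag_le ⟨C₁, h₁⟩ hC₁ h₁) x
  have k3 := (diag _ hd).le_of_opNorm_le (norm_diag_le hd hC₂ h₂) x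
  refine (abs_add_le _ _).trans ?_
  calc _ ≤ ‖shift x‖ * ‖diag (fun n => a n + b n) ⟨C₁, h₁⟩ x‖ + ‖diag d hd x‖ * ‖x‖ :=
        add_le_add (abs_real_inner_le_norm _ _) (abs_real_inner_le_norm _ _)
    _ ≤ ‖x‖ * (C₁ * ‖x‖) + C₂ * ‖x‖ * ‖x‖ := by gcongr
    _ = _ := by ring

theorem norm_tri_le (ha : BddSeq a) (hb : BddSeq b) (hd : BddSeq d) {C₁ C₂ C₃ : ℝ}
    (h₁ : ∀ n, |a n| ≤ C₁) (h₂ : ∀ n, |b n| ≤ C₂) (h₃ : ∀ n, |d n| ≤ C₃) :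
    ‖tri a b d ha hb hd‖ ≤ C₁ + C₂ + C₃ := by
  have hC₁ := (abs_nonneg _).trans (h₁ 0)
  have hC₂ := (abs_nonneg _).trans (h₂ 0)
  have hC₃ := (abs_nonneg _).trans (h₃ 0)
  refine (norm_add₃_le).trans ?_
  have k1 : ‖diag a ha ∘L shift‖ ≤ C₁ * 1 :=
    (ContinuousLinearMap.opNorm_comp_le _ _).trans
      (mul_le_mul (norm_diag_le ha hC₁ h₁) norm_shift_le (norm_nonneg _) hC₁)
  have k2 : ‖ContinuousLinearMap.adjoint shift ∘L diag b hb‖ ≤ 1 * C₂ :=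
    (ContinuousLinearMap.opNorm_comp_le _ _).trans
      (mul_le_mul norm_adjoint_shift_le (norm_diag_le hb hC₂ h₂) (norm_nonneg _) zero_le_one)
  have k3 := norm_diag_le hd hC₃ h₃
  linarith

theorem EllTwo.ext_parity {x y : EllTwo} (h0 : ∀ n < 2, x n = y n)
    (h1 : ∀ n, x (n + 2) = y (n + 2)) : x = y := by
  ext n
  rcases lt_or_ge n 2 with h | h
  · exact h0 n h
  · obtain ⟨k, rfl⟩ := Nat.exists_eq_add_of_le' h
    exact h1 k

/-- This and the next two lemmas let commutator-type expressions be estimated by comparing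
coefficient sequences. -/
theorem tri_comp_diag (ha : BddSeq a) (hb : BddSeq b) (hd : BddSeq d) (ha' : BddSeq a')
    (hb' : BddSeq b') (hd' : BddSeq d') (hp : BddSeq p)
    (h₁ : ∀ n, a' n = a n * p (n + 2)) (h₂ : ∀ n, b' n = b n * p n)
    (h₃ : ∀ n, d' n = d n * p n) :
    tri a b d ha hb hd ∘L diag p hp = tri a' b' d' ha' hb' hd' := by
  ext1 x
  refine EllTwo.ext_parity (fun n hn => ?_) (fun n => ?_)
  · simp [tri_apply_of_lt _ _ _ _ hn, h₁, h₃, mul_assoc]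
  · simp [tri_apply_add, h₁, h₂, h₃, mul_assoc]

theorem diag_comp_tri (ha : BddSeq a) (hb : BddSeq b) (hd : BddSeq d) (ha' : BddSeq a')
    (hb' : BddSeq b') (hd' : BddSeq d') (hp : BddSeq p)
    (h₁ : ∀ n, a' n = p n * a n) (h₂ : ∀ n, b' n = p (n + 2) * b n)
    (h₃ : ∀ n, d' n = p n * d n) :
    diag p hp ∘L tri a b d ha hb hd = tri a' b' d' ha' hb' hd' := by
  ext1 x
  refine EllTwo.ext_parity (fun n hn => ?_) (fun n => ?_)
  · simp [tri_apply_of_lt _ _ _ _ hn, h₁, h₃]; ring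
  · simp [tri_apply_add, h₁, h₂, h₃]; ring

theorem tri_sub_tri (ha : BddSeq a) (hb : BddSeq b) (hd : BddSeq d) (ha' : BddSeq a')
    (hb' : BddSeq b') (hd' : BddSeq d') (h₁ : BddSeq fun n => a n - a' n)
    (h₂ : BddSeq fun n => b n - b' n) (h₃ : BddSeq fun n => d n - d' n) :
    tri a b d ha hb hd - tri a' b' d' ha' hb' hd' =
      tri (fun n => a n - a' n) (fun n => b n - b' n) (fun n => d n - d' n) h₁ h₂ h₃ := by
  ext1 x
  refine EllTwo.ext_parity (fun n hn => ?_) (fun n => ?_)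
  · simp [tri_apply_of_lt _ _ _ _ hn]; ring
  · simp [tri_apply_add]; ring

end Sequences

/-! ### Exponentials of bounded generators and their limits under a uniform energy bound. -/

section Evolution

variable {E : Type*} [NormedAddCommGroup E] [InnerProductSpace ℝ E] [CompleteSpace E]

theorem hasDerivAt_exp_smul_apply (A : E →L[ℝ] E) (x : E) (t : ℝ) :
    HasDerivAt (fun s : ℝ => NormedSpace.exp (s • A) x) (A (NormedSpace.exp (t • A) x)) t := by
  simpa using (hasDerivAt_exp_smul_const' A t).clm_apply (hasDerivAt_const t x)

/-- Energy estimate: the hypothesis on the quadratic form makes `e^{-2Ct} ‖e^{tA} x‖²`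
nonincreasing. The bound involves `C` only, never `‖A‖`, and is therefore uniform over the cutoffs.
-/
theorem norm_exp_smul_apply_le_of_nonneg {A : E →L[ℝ] E} {C : ℝ}
    (hA : ∀ x, |inner ℝ (A x) x| ≤ C * ‖x‖ ^ 2) {t : ℝ} (ht : 0 ≤ t) (x : E) :
    ‖NormedSpace.exp (t • A) x‖ ≤ Real.exp (C * t) * ‖x‖ := by
  have hd : ∀ s : ℝ, HasDerivAt
      (fun s => Real.exp (-(2 * C) * s) * ‖NormedSpace.exp (s • A) x‖ ^ 2)
      (Real.exp (-(2 * C) * s) * (-(2 * C)) * ‖NormedSpace.exp (s • A) x‖ ^ 2 +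
        Real.exp (-(2 * C) * s) *
          (2 * inner ℝ (NormedSpace.exp (s • A) x) (A (NormedSpace.exp (s • A) x)))) s := by
    intro s
    have h1 : HasDerivAt (fun s : ℝ => Real.exp (-(2 * C) * s))
        (Real.exp (-(2 * C) * s) * (-(2 * C))) s := by
      simpa using ((hasDerivAt_id s).const_mul (-(2 * C))).exp
    exact h1.mul (hasDerivAt_exp_smul_apply A x s).norm_sq
  have hanti : Antitone fun s => Real.exp (-(2 * C) * s) * ‖NormedSpace.exp (s • A) x‖ ^ 2 := by
    refine antitone_of_deriv_nonpos (fun s => (hd s).differentiableAt) fun s => ?_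
    rw [(hd s).deriv]
    have := (abs_le.1 (hA (NormedSpace.exp (s • A) x))).2
    rw [real_inner_comm] at this
    have hp := Real.exp_pos (-(2 * C) * s)
    nlinarith
  have h := hanti ht
  simp only [mul_zero, Real.exp_zero, zero_smul, NormedSpace.exp_zero, one_mul,
    one_apply_eq_self] at h
  refine abs_le_of_sq_le_sq' ?_ (by positivity) |>.2
  have e : Real.exp (C * t) ^ 2 * Real.exp (-(2 * C) * t) = 1 := by
    rw [← Real.exp_nat_mul, ← Real.exp_add]
    norm_num
    ring
  calc ‖NormedSpace.exp (t • A) x‖ ^ 2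
      = Real.exp (C * t) ^ 2 *
          (Real.exp (-(2 * C) * t) * ‖NormedSpace.exp (t • A) x‖ ^ 2) := by
        rw [← mul_assoc, e, one_mul]
    _ ≤ Real.exp (C * t) ^ 2 * ‖x‖ ^ 2 := by gcongr
    _ = _ := by ring

theorem norm_exp_smul_apply_le {A : E →L[ℝ] E} {C : ℝ}
    (hA : ∀ x, |inner ℝ (A x) x| ≤ C * ‖x‖ ^ 2) (t : ℝ) (x : E) :
    ‖NormedSpace.exp (t • A) x‖ ≤ Real.exp (C * |t|) * ‖x‖ := by
  rcases le_total 0 t with ht | ht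
  · rw [abs_of_nonneg ht]
    exact norm_exp_smul_apply_le_of_nonneg hA ht x
  · rw [abs_of_nonpos ht]
    have h := norm_exp_smul_apply_le_of_nonneg (A := -A) (C := C) (by simpa using hA)
      (neg_nonneg.2 ht) x
    simpa using h

theorem norm_exp_smul_apply_le_of_abs_le {A : E →L[ℝ] E} {C : ℝ} (hC : 0 ≤ C)
    (hA : ∀ x, |inner ℝ (A x) x| ≤ C * ‖x‖ ^ 2) {t R : ℝ} (ht : |t| ≤ R) (x : E) :
    ‖NormedSpace.exp (t • A) x‖ ≤ Real.exp (C * R) * ‖x‖ :=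
  (norm_exp_smul_apply_le hA t x).trans (by gcongr)

/-- Duhamel's formula as an estimate for an approximate intertwining `G Q ≈ P G`. -/
theorem norm_intertwine_exp_sub_le {P Q G : E →L[ℝ] E} {C : ℝ} (hC : 0 ≤ C)
    (hP : ∀ x, |inner ℝ (P x) x| ≤ C * ‖x‖ ^ 2) (hQ : ∀ x, |inner ℝ (Q x) x| ≤ C * ‖x‖ ^ 2)
    {t R : ℝ} (ht : |t| ≤ R) (z : E) :
    ‖G (NormedSpace.exp (t • Q) z) - NormedSpace.exp (t • P) (G z)‖ ≤
      R * Real.exp (C * R) ^ 2 * ‖G * Q - P * G‖ * ‖z‖ := by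
  -- The path `τ ↦ e^{(t-τ)P} G e^{τQ} z` joins the two vectors being compared, and its derivative
  -- contains only the defect `G Q - P G`.
  have hd : ∀ τ : ℝ, HasDerivAt
      (fun τ : ℝ => NormedSpace.exp ((t - τ) • P) (G (NormedSpace.exp (τ • Q) z)))
      (NormedSpace.exp ((t - τ) • P) ((G * Q - P * G) (NormedSpace.exp (τ • Q) z))) τ := by
    intro τ
    have h1 : HasDerivAt (fun τ : ℝ => NormedSpace.exp ((t - τ) • P))
        ((-1 : ℝ) • (NormedSpace.exp ((t - τ) • P) * P)) τ := by
      have h0 : HasDerivAt (fun τ : ℝ => t - τ) (-1) τ := by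
        simpa using (hasDerivAt_id τ).const_sub t
      exact (hasDerivAt_exp_smul_const P (t - τ)).scomp τ h0
    have h2 : HasDerivAt (fun τ : ℝ => G (NormedSpace.exp (τ • Q) z))
        (G (Q (NormedSpace.exp (τ • Q) z))) τ :=
      G.hasFDerivAt.comp_hasDerivAt τ (hasDerivAt_exp_smul_apply Q z τ)
    refine (h1.clm_apply h2).congr_deriv ?_
    simp only [neg_smul, one_smul, neg_apply, ContinuousLinearMap.mul_def,
      ContinuousLinearMap.comp_apply, sub_apply, map_sub]
    abel
  have hR : 0 ≤ R := (abs_nonneg t).trans ht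
  have key := (convex_uIcc 0 t).norm_image_sub_le_of_norm_hasDerivWithin_le
    (C := Real.exp (C * R) * (‖G * Q - P * G‖ * (Real.exp (C * R) * ‖z‖)))
    (fun τ _ => (hd τ).hasDerivWithinAt) (fun τ hτ => ?_) left_mem_uIcc right_mem_uIcc
  · simp only [sub_self, zero_smul, NormedSpace.exp_zero, sub_zero,
      one_apply_eq_self] at key
    refine key.trans ?_
    rw [Real.norm_eq_abs]
    calc _ ≤ Real.exp (C * R) * (‖G * Q - P * G‖ * (Real.exp (C * R) * ‖z‖)) * R := by gcongr
      _ = _ := by ring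
  · have h1 : |t - τ| ≤ R := by
      refine le_trans ?_ ht
      have := abs_sub_right_of_mem_uIcc hτ
      simpa using this
    have h2 : |τ| ≤ R := by
      refine le_trans ?_ ht
      have := abs_sub_left_of_mem_uIcc hτ
      simpa using this
    refine (norm_exp_smul_apply_le_of_abs_le hC hP h1 _).trans ?_
    gcongr
    exact (ContinuousLinearMap.le_opNorm _ _).trans
      (by gcongr; exact norm_exp_smul_apply_le_of_abs_le hC hQ h2 _)

/-- Convergence of the exponentials of bounded approximations of an unbounded generator. -/
theorem exists_tendstoLocallyUniformly_exp {A A' : ℕ → E →L[ℝ] E} {G : E →L[ℝ] E} {C : ℝ}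
    (hC : 0 ≤ C) (hA : ∀ n x, |inner ℝ (A n x) x| ≤ C * ‖x‖ ^ 2)
    (hA' : ∀ n x, |inner ℝ (A' n x) x| ≤ C * ‖x‖ ^ 2) (hG : DenseRange G)
    (hAA' : ∀ δ > 0, ∃ N, ∀ n ≥ N, ∀ k ≥ N, ‖G * A' k - A n * G‖ ≤ δ) (x₀ : E) :
    ∃ y : ℝ → E, Continuous y ∧
      TendstoLocallyUniformly (fun n t => NormedSpace.exp (t • A n) x₀) y atTop := by
  have hcauchy : ∀ R : ℝ, 0 < R → UniformCauchySeqOn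
      (fun n (t : ℝ) => NormedSpace.exp (t • A n) x₀) atTop (Icc (-R) R) := by
    intro R hR
    rw [Metric.uniformCauchySeqOn_iff]
    intro ε hε
    set M := Real.exp (C * R) with hM
    have hMpos : 0 < M := Real.exp_pos _
    -- Replace `x₀` by a vector `G z` in the dense range; the uniform bound `M` keeps the error
    -- below `ε / 4` under every exponential.
    obtain ⟨_, ⟨z, rfl⟩, hz⟩ := Metric.mem_closure_iff.1 (hG x₀) (ε / (4 * M)) (by positivity)
    rw [dist_eq_norm] at hz
    obtain ⟨N, hN⟩ := hAA' (ε / (8 * (R * M ^ 2 * (‖z‖ + 1)))) (by positivity)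
    have hstep : ∀ n ≥ N, ∀ k ≥ N, ∀ t : ℝ, |t| ≤ R →
        ‖G (NormedSpace.exp (t • A' k) z) - NormedSpace.exp (t • A n) (G z)‖ ≤ ε / 8 := by
      intro n hn k hk t ht
      refine (norm_intertwine_exp_sub_le hC (hA n) (hA' k) ht z).trans ?_
      calc _ ≤ R * M ^ 2 * (ε / (8 * (R * M ^ 2 * (‖z‖ + 1)))) * (‖z‖ + 1) := by
            gcongr
            · exact hN n hn k hk
            · linarith
        _ = ε / 8 := by field_simp
    refine ⟨N, fun n hn k hk t ht => ?_⟩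
    have ht' : |t| ≤ R := abs_le.2 ht
    have h1 := hstep n hn k hk t ht'
    have h2 := hstep k hk k hk t ht'
    have h3 : ∀ j, ‖NormedSpace.exp (t • A j) (x₀ - G z)‖ < ε / 4 := by
      intro j
      refine (norm_exp_smul_apply_le_of_abs_le hC (hA j) ht' _).trans_lt ?_
      calc M * ‖x₀ - G z‖ < M * (ε / (4 * M)) := by gcongr
        _ = ε / 4 := by field_simp
    rw [dist_eq_norm]
    -- Both `e^{tA n} G z` and `e^{tA k} G z` are compared with the same vector `G e^{tA' k} z`. The
    -- two density errors are below `ε / 4` each and the two Duhamel errors at most `ε / 8` each.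
    have e : NormedSpace.exp (t • A n) x₀ - NormedSpace.exp (t • A k) x₀ =
        (NormedSpace.exp (t • A n) (x₀ - G z) - NormedSpace.exp (t • A k) (x₀ - G z)) +
        ((G (NormedSpace.exp (t • A' k) z) - NormedSpace.exp (t • A k) (G z)) -
        (G (NormedSpace.exp (t • A' k) z) - NormedSpace.exp (t • A n) (G z))) := by
      simp only [map_sub]
      abel
    rw [e]
    refine (norm_add_le _ _).trans_lt ?_
    have h4 := norm_sub_le (NormedSpace.exp (t • A n) (x₀ - G z))
      (NormedSpace.exp (t • A k) (x₀ - G z))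
    have h5 := norm_sub_le (G (NormedSpace.exp (t • A' k) z) - NormedSpace.exp (t • A k) (G z))
      (G (NormedSpace.exp (t • A' k) z) - NormedSpace.exp (t • A n) (G z))
    linarith [h3 n, h3 k]
  have hlim : ∀ t : ℝ, ∃ y, Tendsto (fun n => NormedSpace.exp (t • A n) x₀) atTop (𝓝 y) := by
    intro t
    refine cauchySeq_tendsto_of_complete ?_
    exact (hcauchy (|t| + 1) (by positivity)).cauchySeq
      (abs_le.1 (by linarith : |t| ≤ |t| + 1))
  choose y hy using hlim
  have hunif : TendstoLocallyUniformly (fun n (t : ℝ) => NormedSpace.exp (t • A n) x₀) y atTop := by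
    rw [← tendstoLocallyUniformlyOn_univ]
    refine (tendstoLocallyUniformlyOn_iff_forall_isCompact isOpen_univ).2 fun K _ hK => ?_
    obtain ⟨R, hR, hKR⟩ := hK.isBounded.subset_closedBall_lt 0 0
    rw [Real.closedBall_eq_Icc, zero_sub, zero_add] at hKR
    exact ((hcauchy R hR).tendstoUniformlyOn_of_tendsto fun t _ => hy t).mono hKR
  refine ⟨y, hunif.continuous (Frequently.of_forall fun n => ?_), hunif⟩
  exact continuous_iff_continuousAt.2 fun t =>
    (hasDerivAt_exp_smul_apply (A n) x₀ t).continuousAt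

end Evolution

/-! ### The mode system in weighted sequence spaces, its cutoffs, and its solution. -/

section Generator

/-- The frequency `n + 2` of the `n`-th mode `sin ((n + 2) θ)`. -/
def freq (n : ℕ) : ℝ := n + 2

theorem two_le_freq (n : ℕ) : 2 ≤ freq n := by simp [freq]

theorem freq_pos (n : ℕ) : 0 < freq n := by linarith [two_le_freq n]

theorem freq_add_two (n : ℕ) : freq (n + 2) = freq n + 2 := by
  simp [freq]

/-- The symbol `1 + 2 / k - 4 / k²` of the nonlocal zeroth-order terms. -/
def nonlocalSymbol (x : ℝ) : ℝ := 1 + 2 / x - 4 / x ^ 2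

theorem abs_nonlocalSymbol_le {x : ℝ} (hx : 1 ≤ x) : |nonlocalSymbol x| ≤ 2 := by
  have e : nonlocalSymbol x = 1 + 2 * x⁻¹ - 4 * x⁻¹ ^ 2 := by
    unfold nonlocalSymbol; field_simp
  have h0 : 0 ≤ x⁻¹ := by positivity
  have h1 : x⁻¹ ≤ 1 := inv_le_one_of_one_le₀ hx
  rw [e, abs_le]
  constructor <;> nlinarith

/-- The coupling of the modes `n` and `n + 2`. -/
def coupling (n : ℕ) : ℝ := (n + 3) / 4 - nonlocalSymbol (n + 3) / 2

/-- The diagonal coefficient of the mode `n`. -/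
def diagCoeff (n : ℕ) : ℝ := -1 / 2 + (nonlocalSymbol (n + 3) - nonlocalSymbol (n + 1)) / 2

theorem abs_coupling_le (n : ℕ) : |coupling n| ≤ freq n := by
  have h := abs_le.1 (abs_nonlocalSymbol_le (x := (n : ℝ) + 3) (by linarith [n.cast_nonneg (α := ℝ)]))
  have hn := n.cast_nonneg (α := ℝ)
  unfold coupling freq
  rw [abs_le]
  constructor <;> linarith [h.1, h.2]

theorem abs_diagCoeff_le (n : ℕ) : |diagCoeff n| ≤ 5 / 2 := by
  have hn := n.cast_nonneg (α := ℝ)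
  have h := abs_le.1 (abs_nonlocalSymbol_le (x := (n : ℝ) + 3) (by linarith))
  have h' := abs_le.1 (abs_nonlocalSymbol_le (x := (n : ℝ) + 1) (by linarith))
  unfold diagCoeff
  rw [abs_le]
  constructor <;> linarith [h.1, h.2, h'.1, h'.2]

theorem bddSeq_diagCoeff : BddSeq diagCoeff := ⟨_, abs_diagCoeff_le⟩

/-- The ratio of consecutive coupled frequencies. -/
def ratio (n : ℕ) : ℝ := freq (n + 2) / freq n

theorem one_le_ratio (n : ℕ) : 1 ≤ ratio n := by
  rw [ratio, one_le_div (freq_pos n), freq_add_two]; linarith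

theorem ratio_sub_one (n : ℕ) : ratio n - 1 = 2 / freq n := by
  have := freq_pos n
  rw [ratio, freq_add_two]; field_simp; ring

theorem ratio_le_two (n : ℕ) : ratio n ≤ 2 := by
  have : 2 / freq n ≤ 1 := (div_le_one (freq_pos n)).2 (two_le_freq n)
  linarith [ratio_sub_one n]

theorem ratio_pos (n : ℕ) : 0 < ratio n := by linarith [one_le_ratio n]

theorem freq_add_two_eq (n : ℕ) : freq (n + 2) = ratio n * freq n := by
  rw [ratio, div_mul_cancel₀ _ (freq_pos n).ne']

theorem pow_sub_one_le {q : ℝ} (h1 : 1 ≤ q) (h2 : q ≤ 2) (s : ℕ) :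
    q ^ s - 1 ≤ (q - 1) * 2 ^ s := by
  induction s with
  | zero => simp; linarith
  | succ s ih =>
    have h3 : q ^ s ≤ 2 ^ s := by gcongr
    calc q ^ (s + 1) - 1 = (q - 1) * q ^ s + (q ^ s - 1) := by ring
      _ ≤ (q - 1) * 2 ^ s + (q - 1) * 2 ^ s := by gcongr
      _ = _ := by ring

/-- Since `ratio n = 1 + 2 / freq n`, both its `s`-th power and the inverse of that power are within
`O(1 / freq n)` of one. This decay compensates the linear growth of the coupling when a weight is
introduced. -/
theorem abs_inv_pow_sub_pow_ratio_le (n s : ℕ) :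
    |(ratio n)⁻¹ ^ s - ratio n ^ s| ≤ 4 * 2 ^ s / freq n := by
  have h1 := one_le_ratio n
  have h2 : 1 ≤ ratio n ^ s := one_le_pow₀ h1
  have h3 := pow_sub_one_le h1 (ratio_le_two n) s
  rw [ratio_sub_one] at h3
  have h4 : (ratio n)⁻¹ ^ s ≤ 1 := by
    rw [inv_pow]; exact inv_le_one_of_one_le₀ h2
  have h5 : 1 - (ratio n)⁻¹ ^ s ≤ ratio n ^ s - 1 := by
    rw [inv_pow]
    have : ratio n ^ s * (ratio n ^ s)⁻¹ = 1 := mul_inv_cancel₀ (by positivity)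
    have h6 : 0 ≤ (ratio n ^ s)⁻¹ := by positivity
    nlinarith [mul_nonneg (sub_nonneg.2 h2) (sub_nonneg.2 (inv_le_one_of_one_le₀ h2))]
  rw [abs_of_nonpos (by linarith)]
  calc _ ≤ 2 * (2 / freq n * 2 ^ s) := by linarith
    _ = _ := by ring

/-- The coupling, cut off at the mode `N`. -/
def cutCoupling (N n : ℕ) : ℝ := if n < N then coupling n else 0

theorem abs_cutCoupling_le (N n : ℕ) : |cutCoupling N n| ≤ freq n := by
  unfold cutCoupling
  split_ifs
  · exact abs_coupling_le n
  · simpa using (freq_pos n).le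

theorem abs_cutCoupling_le' (N n : ℕ) : |cutCoupling N n| ≤ freq N := by
  unfold cutCoupling
  split_ifs with h
  · refine (abs_coupling_le n).trans ?_
    unfold freq
    have : (n : ℝ) ≤ N := by exact_mod_cast h.le
    linarith
  · simpa using (freq_pos N).le

theorem inv_ratio_pow_le_one (n s : ℕ) : (ratio n)⁻¹ ^ s ≤ 1 := by
  rw [inv_pow]; exact inv_le_one_of_one_le₀ (one_le_pow₀ (one_le_ratio n))

theorem abs_mul_inv_ratio_pow_le (c : ℝ) (n s : ℕ) : |c * (ratio n)⁻¹ ^ s| ≤ |c| := by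
  have := ratio_pos n
  rw [abs_mul, abs_of_nonneg (show 0 ≤ (ratio n)⁻¹ ^ s by positivity)]
  exact mul_le_of_le_one_right (abs_nonneg _) (inv_ratio_pow_le_one n s)

theorem abs_mul_ratio_pow_le (c : ℝ) (n s : ℕ) : |c * ratio n ^ s| ≤ |c| * 2 ^ s := by
  have := ratio_pos n
  rw [abs_mul, abs_of_nonneg (show 0 ≤ ratio n ^ s by positivity)]
  have := ratio_le_two n
  gcongr

theorem bddSeq_upper (N s : ℕ) : BddSeq fun n => cutCoupling N n * (ratio n)⁻¹ ^ s :=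
  ⟨freq N, fun n => (abs_mul_inv_ratio_pow_le _ n s).trans (abs_cutCoupling_le' N n)⟩

theorem bddSeq_lower (N s : ℕ) : BddSeq fun n => -cutCoupling N n * ratio n ^ s :=
  ⟨freq N * 2 ^ s, fun n => (abs_mul_ratio_pow_le _ n s).trans (by
    rw [abs_neg]
    exact mul_le_mul_of_nonneg_right (abs_cutCoupling_le' N n) (by positivity))⟩

/-- The cut-off generator acting on sequences `(freq n)^s w_n`, `w_n` the Fourier coefficients. -/
def cutGenerator (N s : ℕ) : EllTwo →L[ℝ] EllTwo :=
  tri (fun n => cutCoupling N n * (ratio n)⁻¹ ^ s) (fun n => -cutCoupling N n * ratio n ^ s)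
    diagCoeff (bddSeq_upper N s) (bddSeq_lower N s) bddSeq_diagCoeff

/-- The upper and lower coefficients add up to `cutCoupling N n * ((ratio n)⁻¹ ^ s - ratio n ^ s)`:
growth `freq n` against decay `1 / freq n`. The bound is independent of `N`; the summand `5 / 2`
comes from the diagonal. -/
theorem abs_inner_cutGenerator_le (N s : ℕ) (x : EllTwo) :
    |inner ℝ (cutGenerator N s x) x| ≤ (4 * 2 ^ s + 5 / 2) * ‖x‖ ^ 2 := by
  refine abs_inner_tri_le _ _ _ (fun n => ?_) abs_diagCoeff_le x
  have e : cutCoupling N n * (ratio n)⁻¹ ^ s + -cutCoupling N n * ratio n ^ s =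
      cutCoupling N n * ((ratio n)⁻¹ ^ s - ratio n ^ s) := by ring
  rw [e, abs_mul]
  calc _ ≤ freq n * (4 * 2 ^ s / freq n) := by
        gcongr
        · exact (freq_pos n).le
        · exact abs_cutCoupling_le N n
        · exact abs_inv_pow_sub_pow_ratio_le n s
    _ = _ := mul_div_cancel₀ _ (freq_pos n).ne'

theorem inv_freq_pow_le_one (j n : ℕ) : (freq n)⁻¹ ^ j ≤ 1 := by
  have := freq_pos n
  refine pow_le_one₀ (by positivity) (inv_le_one_of_one_le₀ (by linarith [two_le_freq n]))

theorem bddSeq_inv_freq_pow (j : ℕ) : BddSeq fun n => (freq n)⁻¹ ^ j :=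
  ⟨1, fun n => by
    have := freq_pos n
    rw [abs_of_nonneg (by positivity)]
    exact inv_freq_pow_le_one j n⟩

/-- Division by the `j`-th power of the frequency. -/
def lower (j : ℕ) : EllTwo →L[ℝ] EllTwo := diag (fun n => (freq n)⁻¹ ^ j) (bddSeq_inv_freq_pow j)

@[simp] theorem lower_apply (j : ℕ) (x : EllTwo) (n : ℕ) : lower j x n = (freq n)⁻¹ ^ j * x n :=
  rfl

theorem lower_lower (i j : ℕ) (x : EllTwo) : lower i (lower j x) = lower (i + j) x := by
  ext n; simp [pow_add, mul_assoc]

/-- Passing from weight `s + 2` to weight `s` conjugates one generator into the other, so the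
diagonals cancel and only the difference of the two cutoffs remains. It lives on modes `n ≥ N` and
is at most `freq n · (freq n)⁻²` before the ratio factors. A single power in `lower` would leave it
bounded but not small. -/
theorem norm_lower_cutGenerator_sub_le {N s i k : ℕ} (hi : N ≤ i) (hk : N ≤ k) :
    ‖lower 2 * cutGenerator k (s + 2) - cutGenerator i s * lower 2‖ ≤ (1 + 2 ^ s) / freq N := by
  have b0 : BddSeq fun n => (freq n)⁻¹ ^ 2 * diagCoeff n :=
    ⟨5 / 2, fun n => by
      have := freq_pos n
      rw [abs_mul, abs_of_nonneg (show 0 ≤ (freq n)⁻¹ ^ 2 by positivity), ← one_mul (5 / 2 : ℝ)]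
      exact mul_le_mul (inv_freq_pow_le_one 2 n) (abs_diagCoeff_le n) (abs_nonneg _) zero_le_one⟩
  have hfreq : ∀ n, N ≤ n → freq N ≤ freq n := fun n hn => by
    unfold freq
    have : (N : ℝ) ≤ n := by exact_mod_cast hn
    linarith
  have hinv : ∀ n, 0 ≤ (freq n)⁻¹ := fun n => inv_nonneg.2 (freq_pos n).le
  have hcut : ∀ n, |(cutCoupling k n - cutCoupling i n) * (freq n)⁻¹ ^ 2| ≤ 1 / freq N := by
    intro n
    rcases lt_or_ge n N with hn | hn
    · simp [cutCoupling, hn.trans_le hi, hn.trans_le hk, (freq_pos N).le]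
    · have h1 : |cutCoupling k n - cutCoupling i n| ≤ freq n := by
        have := abs_coupling_le n
        unfold cutCoupling
        split_ifs <;> simp [this, (freq_pos n).le]
      rw [abs_mul, abs_of_nonneg (pow_nonneg (hinv n) 2)]
      calc _ ≤ freq n * (freq n)⁻¹ ^ 2 := by
            gcongr
        _ = 1 / freq n := by have := freq_pos n; field_simp
        _ ≤ 1 / freq N := one_div_le_one_div_of_le (freq_pos N) (hfreq n hn)
  have e1 : ∀ l n, cutCoupling l n * (ratio n)⁻¹ ^ s * (freq (n + 2))⁻¹ ^ 2
      = cutCoupling l n * (freq n)⁻¹ ^ 2 * (ratio n)⁻¹ ^ (s + 2) := by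
    intro l n
    rw [freq_add_two_eq, mul_inv, mul_pow]; ring
  have e2 : ∀ l n, (freq (n + 2))⁻¹ ^ 2 * (-cutCoupling l n * ratio n ^ (s + 2))
      = -cutCoupling l n * ratio n ^ s * (freq n)⁻¹ ^ 2 := by
    intro l n
    have := ratio_pos n
    rw [freq_add_two_eq, mul_inv, mul_pow]
    field_simp
    ring
  have ba : ∀ l, BddSeq fun n => cutCoupling l n * (freq n)⁻¹ ^ 2 * (ratio n)⁻¹ ^ (s + 2) :=
    fun l => ⟨freq l, fun n => (abs_mul_inv_ratio_pow_le _ n _).trans (by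
      rw [abs_mul, abs_of_nonneg (pow_nonneg (hinv n) 2)]
      exact (mul_le_of_le_one_right (abs_nonneg _) (inv_freq_pow_le_one 2 n)).trans
        (abs_cutCoupling_le' l n))⟩
  have bb : ∀ l, BddSeq fun n => -cutCoupling l n * ratio n ^ s * (freq n)⁻¹ ^ 2 := by
    intro l
    obtain ⟨C, hC⟩ := bddSeq_lower l s
    refine ⟨C, fun n => ?_⟩
    rw [abs_mul, abs_of_nonneg (pow_nonneg (hinv n) 2)]
    exact (mul_le_of_le_one_right (abs_nonneg _) (inv_freq_pow_le_one 2 n)).trans (hC n)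
  have da : ∀ n, |cutCoupling k n * (freq n)⁻¹ ^ 2 * (ratio n)⁻¹ ^ (s + 2)
      - cutCoupling i n * (freq n)⁻¹ ^ 2 * (ratio n)⁻¹ ^ (s + 2)| ≤ 1 / freq N := by
    intro n
    rw [← sub_mul, ← sub_mul]
    exact (abs_mul_inv_ratio_pow_le _ n _).trans (hcut n)
  have db : ∀ n, |-cutCoupling k n * ratio n ^ s * (freq n)⁻¹ ^ 2
      - -cutCoupling i n * ratio n ^ s * (freq n)⁻¹ ^ 2| ≤ 2 ^ s / freq N := by
    intro n
    have : -cutCoupling k n * ratio n ^ s * (freq n)⁻¹ ^ 2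
      - -cutCoupling i n * ratio n ^ s * (freq n)⁻¹ ^ 2
      = -((cutCoupling k n - cutCoupling i n) * (freq n)⁻¹ ^ 2) * ratio n ^ s := by ring
    rw [this]
    refine (abs_mul_ratio_pow_le _ n _).trans ?_
    rw [abs_neg]
    calc _ ≤ 1 / freq N * 2 ^ s := by gcongr; exact hcut n
      _ = _ := by ring
  have dd : ∀ n, |(freq n)⁻¹ ^ 2 * diagCoeff n - (freq n)⁻¹ ^ 2 * diagCoeff n| ≤ 0 := by simp
  have t1 : lower 2 * cutGenerator k (s + 2) = tri _ _ _ (ba k) (bb k) b0 :=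
    diag_comp_tri _ _ _ _ _ _ _ (fun n => by ring) (fun n => (e2 k n).symm) (fun n => rfl)
  have t2 : cutGenerator i s * lower 2 = tri _ _ _ (ba i) (bb i) b0 :=
    tri_comp_diag _ _ _ _ _ _ _ (fun n => (e1 i n).symm) (fun n => rfl) (fun n => by ring)
  rw [t1, t2, tri_sub_tri _ _ _ _ _ _ ⟨_, da⟩ ⟨_, db⟩ ⟨_, dd⟩]
  refine (norm_tri_le _ _ _ da db dd).trans (le_of_eq ?_)
  ring

/-- The upper coefficient of the smoothed generator. -/
theorem abs_coupling_mul_inv_freq_le (n : ℕ) : |coupling n * (freq n)⁻¹| ≤ 1 := by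
  have := freq_pos n
  rw [abs_mul, abs_of_pos (inv_pos.2 this), ← div_eq_mul_inv, div_le_one this]
  exact abs_coupling_le n

theorem bddSeq_smoothUpper (s : ℕ) :
    BddSeq fun n => coupling n * (freq n)⁻¹ * (ratio n)⁻¹ ^ s :=
  ⟨1, fun n => (abs_mul_inv_ratio_pow_le _ n s).trans (abs_coupling_mul_inv_freq_le n)⟩

theorem bddSeq_smoothLower (s : ℕ) :
    BddSeq fun n => -coupling n * ratio n ^ s * (freq (n + 2))⁻¹ :=
  ⟨2 ^ s, fun n => by
    have e : -coupling n * ratio n ^ s * (freq (n + 2))⁻¹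
        = -(coupling n * (freq n)⁻¹ * (ratio n)⁻¹ ^ 1) * ratio n ^ s := by
      rw [freq_add_two_eq, mul_inv]; ring
    beta_reduce
    rw [e]
    refine (abs_mul_ratio_pow_le _ n _).trans ?_
    rw [abs_neg]
    exact mul_le_of_le_one_left (by positivity)
      ((abs_mul_inv_ratio_pow_le _ n 1).trans (abs_coupling_mul_inv_freq_le n))⟩

theorem bddSeq_smoothDiag : BddSeq fun n => (freq n)⁻¹ * diagCoeff n :=
  ⟨5 / 2, fun n => by
    have := freq_pos n
    have h := inv_freq_pow_le_one 1 n
    rw [pow_one] at h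
    rw [abs_mul, abs_of_pos (inv_pos.2 this), ← one_mul (5 / 2 : ℝ)]
    exact mul_le_mul h (abs_diagCoeff_le n) (abs_nonneg _) zero_le_one⟩

/-- The generator, as a bounded operator from the weight `s` to the weight `s - 1`. -/
def generator (s : ℕ) : EllTwo →L[ℝ] EllTwo :=
  tri (fun n => coupling n * (freq n)⁻¹ * (ratio n)⁻¹ ^ s)
    (fun n => -coupling n * ratio n ^ s * (freq (n + 2))⁻¹)
    (fun n => (freq n)⁻¹ * diagCoeff n)
    (bddSeq_smoothUpper s) (bddSeq_smoothLower s) bddSeq_smoothDiag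

/-- The same operator on Fourier coefficients is written in two neighbouring weights, and dividing
by the frequency is the change of weight. -/
theorem lower_generator (s : ℕ) (x : EllTwo) :
    lower 1 (generator (s + 1) x) = generator s (lower 1 x) := by
  refine EllTwo.ext_parity (fun n hn => ?_) (fun n => ?_)
  · simp only [lower_apply, generator, tri_apply_of_lt _ _ _ _ hn, pow_one]
    rw [freq_add_two_eq, mul_inv]; ring
  · have := ratio_pos n
    have h2 := freq_add_two_eq (n + 2)
    simp only [show n + 2 + 2 = n + 4 from rfl] at h2
    simp only [lower_apply, generator, tri_apply_add, pow_one]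
    rw [h2, mul_inv, pow_succ (ratio n)]
    have h3 : (freq n)⁻¹ = ratio n * (freq (n + 2))⁻¹ := by
      rw [freq_add_two_eq, mul_inv, ← mul_assoc, mul_inv_cancel₀ this.ne', one_mul]
    rw [h3]
    ring

/-- Coordinate `n` involves only the couplings `n` and `n - 2`, neither of which is affected by a
cutoff at `N > n`. -/
theorem lower_cutGenerator_apply {N s n : ℕ} (hn : n < N) (x : EllTwo) :
    lower 1 (cutGenerator N s x) n = generator s x n := by
  rcases lt_or_ge n 2 with h | h
  · simp only [lower_apply, generator, cutGenerator, tri_apply_of_lt _ _ _ _ h, pow_one,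
      cutCoupling, if_pos hn]
    ring
  · obtain ⟨k, rfl⟩ := Nat.exists_eq_add_of_le' h
    simp only [lower_apply, generator, cutGenerator, tri_apply_add, pow_one,
      cutCoupling, if_pos hn, if_pos (show k < N by omega)]
    ring

/-- Coordinatewise derivatives with a norm-continuous candidate `g` identify `f` as `f 0 + ∫ g`,
which is differentiable in norm. -/
theorem EllTwo.hasDerivAt_of_apply {f g : ℝ → EllTwo} (hg : Continuous g)
    (h : ∀ n t, HasDerivAt (fun t => f t n) (g t n) t) (t : ℝ) : HasDerivAt f (g t) t := by
  have e : f = fun t => f 0 + ∫ τ in (0 : ℝ)..t, g τ := by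
    funext t
    ext n
    have hi := (evalL n).intervalIntegral_comp_comm (μ := volume)
      (hg.intervalIntegrable 0 t)
    have hf := intervalIntegral.integral_eq_sub_of_hasDerivAt (a := 0) (b := t)
      (fun τ _ => h n τ) (((evalL n).continuous.comp hg).intervalIntegrable 0 t)
    have hn : f t n - f 0 n = evalL n (∫ τ in (0 : ℝ)..t, g τ) := hf.symm.trans hi
    exact sub_eq_iff_eq_add'.1 hn
  rw [e]
  exact (intervalIntegral.integral_hasDerivAt_right (hg.intervalIntegrable 0 t)
    (hg.stronglyMeasurableAtFilter _ _) hg.continuousAt).const_add _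

/-- Well-posedness of the evolution in the weighted sequence spaces. -/
theorem exists_evolution (s : ℕ) (y₀ : EllTwo) :
    ∃ y : ℝ → EllTwo, Continuous y ∧ y 0 = y₀ ∧
      ∀ t, HasDerivAt (fun t => lower 1 (y t)) (generator s (y t)) t := by
  have hCs : (4 * 2 ^ s + 5 / 2 : ℝ) ≤ 4 * 2 ^ (s + 2) + 5 / 2 := by
    have : (2 : ℝ) ^ s ≤ 2 ^ (s + 2) := pow_le_pow_right₀ (by norm_num) (by omega)
    linarith
  -- The intertwining map divides by the squared frequency, so the auxiliary generators act in
  -- weight `s + 2`; the larger of the two energy constants serves for both families.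
  obtain ⟨y, hy, hlim⟩ := exists_tendstoLocallyUniformly_exp
    (A := fun N => cutGenerator N s) (A' := fun N => cutGenerator N (s + 2)) (G := lower 2)
    (C := 4 * 2 ^ (s + 2) + 5 / 2) (by positivity)
    (fun N x => (abs_inner_cutGenerator_le N s x).trans (by gcongr))
    (fun N x => abs_inner_cutGenerator_le N (s + 2) x)
    (denseRange_diag _ fun n => pow_ne_zero _ (inv_ne_zero (freq_pos n).ne'))
    (fun δ hδ => by
      obtain ⟨N, hN⟩ := exists_nat_gt ((1 + 2 ^ s) / δ)
      refine ⟨N, fun i hi k hk => (norm_lower_cutGenerator_sub_le hi hk).trans ?_⟩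
      rw [div_le_iff₀ (freq_pos N)]
      rw [div_lt_iff₀ hδ] at hN
      unfold freq
      nlinarith) y₀
  refine ⟨y, hy, ?_, EllTwo.hasDerivAt_of_apply ((generator s).continuous.comp hy) ?_⟩
  · have := hlim.tendstoLocallyUniformlyOn (s := univ) |>.tendsto_at (mem_univ 0)
    simp only [zero_smul, NormedSpace.exp_zero, one_apply_eq_self] at this
    exact tendsto_nhds_unique this tendsto_const_nhds
  · intro n t
    have hev : TendstoLocallyUniformly
        (fun N t => evalL n (generator s (NormedSpace.exp (t • cutGenerator N s) y₀)))
        (fun t => evalL n (generator s (y t))) atTop :=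
      (((evalL n) ∘L (generator s)).uniformContinuous).comp_tendstoLocallyUniformly hlim
    refine hasDerivAt_of_tendstoLocallyUniformlyOn (l := atTop) isOpen_univ
      hev.tendstoLocallyUniformlyOn ?_
      (f := fun N t => evalL n (lower 1 (NormedSpace.exp (t • cutGenerator N s) y₀)))
      (fun t _ => ?_) (mem_univ t)
    -- For `N > n` the truncated evolution satisfies the exact equation in coordinate `n`, so the
    -- derivatives converge locally uniformly to the right limit.
    · filter_upwards [eventually_gt_atTop n] with N hN t _
      have h := ((evalL n) ∘L (lower 1)).hasFDerivAt.comp_hasDerivAt t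
        (hasDerivAt_exp_smul_apply (cutGenerator N s) y₀ t)
      exact h.congr_deriv (lower_cutGenerator_apply hN _)
    · have := hlim.tendstoLocallyUniformlyOn (s := univ) |>.tendsto_at (mem_univ t)
      exact (((evalL n) ∘L (lower 1)).continuous.tendsto _).comp this

end Generator

/-! ### The principal value Hilbert transform of Lipschitz functions and its Fourier multiplier. -/

section Hilbert

open scoped NNReal

variable {E : Type*} [NormedAddCommGroup E] [NormedSpace ℝ E]

/-- The symmetrized integrand of the Hilbert transform. -/
def hilbertIntegrand (f : ℝ → E) (θ s : ℝ) : E := Real.cot (s / 2) • (f (θ - s) - f (θ + s))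

/-- The Hilbert transform of a Lipschitz function, as an absolutely convergent integral. -/
def hilbertIntegral (f : ℝ → E) (θ : ℝ) : E :=
  (1 / (2 * Real.pi)) • ∫ s in (0 : ℝ)..Real.pi, hilbertIntegrand f θ s

theorem measurable_cot_half : Measurable fun s : ℝ => Real.cot (s / 2) := by
  simp only [Real.cot_eq_cos_div_sin]
  fun_prop

/-- From `x < tan x` on `(0, π/2)`. This is what makes the symmetrized integrand of a Lipschitz
function bounded, so that the principal value is an ordinary integral. -/
theorem abs_cot_half_mul_le {s : ℝ} (hs : s ∈ Ioc 0 Real.pi) : |Real.cot (s / 2)| * s ≤ 2 := by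
  rcases hs.2.eq_or_lt with h | h
  · subst h
    simp [Real.cot_eq_cos_div_sin]
  · have h1 : s / 2 < Real.tan (s / 2) := Real.lt_tan (by linarith [hs.1]) (by linarith)
    have h0 : 0 < s / 2 := by linarith [hs.1]
    have h2 : Real.cot (s / 2) = (Real.tan (s / 2))⁻¹ := (Real.tan_inv_eq_cot _).symm
    have h3 : (Real.tan (s / 2))⁻¹ ≤ (s / 2)⁻¹ := inv_anti₀ h0 h1.le
    rw [h2, abs_of_pos (inv_pos.2 (h0.trans h1))]
    calc _ ≤ (s / 2)⁻¹ * s := by gcongr; exact hs.1.le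
      _ = 2 := by have := hs.1; field_simp

theorem norm_hilbertIntegrand_le {f : ℝ → E} {K : ℝ≥0} (hf : LipschitzWith K f) (θ : ℝ) {s : ℝ}
    (hs : s ∈ Ioc 0 Real.pi) : ‖hilbertIntegrand f θ s‖ ≤ 4 * K := by
  have h := hf.dist_le_mul (θ - s) (θ + s)
  rw [dist_eq_norm, Real.dist_eq, show θ - s - (θ + s) = -(2 * s) by ring, abs_neg,
    abs_of_pos (by linarith [hs.1])] at h
  rw [hilbertIntegrand, norm_smul, Real.norm_eq_abs]
  calc _ ≤ |Real.cot (s / 2)| * (K * (2 * s)) := by gcongr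
    _ = 2 * K * (|Real.cot (s / 2)| * s) := by ring
    _ ≤ 2 * K * 2 := by gcongr; exact abs_cot_half_mul_le hs
    _ = _ := by ring

theorem intervalIntegrable_hilbertIntegrand {f : ℝ → E} {K : ℝ≥0} (hf : LipschitzWith K f)
    (θ : ℝ) : IntervalIntegrable (hilbertIntegrand f θ) volume 0 Real.pi := by
  rw [intervalIntegrable_iff_integrableOn_Ioc_of_le Real.pi_pos.le]
  refine Measure.integrableOn_of_bounded (M := 4 * K) (by simp) ?_ ?_
  · refine (measurable_cot_half.stronglyMeasurable.smul
      (Continuous.stronglyMeasurable ?_)).aestronglyMeasurable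
    have := hf.continuous
    fun_prop
  · filter_upwards [ae_restrict_mem measurableSet_Ioc] with s hs
    exact norm_hilbertIntegrand_le hf θ hs

theorem continuousOn_cot_half : ContinuousOn (fun s : ℝ => Real.cot (s / 2)) (Ioc 0 Real.pi) := by
  simp only [Real.cot_eq_cos_div_sin]
  refine ContinuousOn.div (by fun_prop) (by fun_prop) fun s hs => ?_
  exact (Real.sin_pos_of_pos_of_lt_pi (by linarith [hs.1])
    (by linarith [hs.1, hs.2, Real.pi_pos])).ne'

theorem cot_neg_half (s : ℝ) : Real.cot (-s / 2) = -Real.cot (s / 2) := by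
  rw [neg_div, Real.cot_eq_cos_div_sin, Real.cot_eq_cos_div_sin, Real.cos_neg, Real.sin_neg, div_neg]

/-- Substitute `φ = θ - s` and fold the half `s < 0` onto `s > 0`, using that the cotangent is odd.
-/
theorem truncatedHilbert_eq {f : ℝ → ℝ} (hf : Continuous f) (θ : ℝ) {ε : ℝ} (h0 : 0 < ε)
    (hε : ε < Real.pi) :
    truncatedHilbert f θ ε =
      1 / (2 * Real.pi) * ∫ s in ε..Real.pi, hilbertIntegrand f θ s := by
  unfold truncatedHilbert
  congr 1
  have hmeas : MeasurableSet {φ : ℝ | ε < |θ - φ| ∧ |θ - φ| < Real.pi} := by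
    have h : Measurable fun φ : ℝ => |θ - φ| := by fun_prop
    exact (measurableSet_lt measurable_const h).inter (measurableSet_lt h measurable_const)
  rw [← integral_indicator hmeas, ← integral_sub_left_eq_self _ volume θ]
  have e : (fun s => indicator {φ : ℝ | ε < |θ - φ| ∧ |θ - φ| < Real.pi}
      (fun φ => Real.cot ((θ - φ) / 2) * f φ) (θ - s)) =
      indicator (Ioo ε Real.pi ∪ Ioo (-Real.pi) (-ε)) (fun s => Real.cot (s / 2) * f (θ - s)) := by
    funext s
    have hmem : (θ - s ∈ {φ : ℝ | ε < |θ - φ| ∧ |θ - φ| < Real.pi}) ↔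
        s ∈ Ioo ε Real.pi ∪ Ioo (-Real.pi) (-ε) := by
      simp only [mem_ofPred_eq, sub_sub_cancel, mem_union, mem_Ioo]
      rcases le_total 0 s with h | h
      · rw [abs_of_nonneg h]
        constructor
        · exact fun h => Or.inl h
        · rintro (h | h)
          · exact h
          · linarith
      · rw [abs_of_nonpos h]
        constructor
        · exact fun h => Or.inr ⟨by linarith, by linarith⟩
        · rintro (h | h)
          · linarith [h.1]
          · exact ⟨by linarith, by linarith⟩
    by_cases hs : s ∈ Ioo ε Real.pi ∪ Ioo (-Real.pi) (-ε)
    · rw [indicator_of_mem hs, indicator_of_mem (hmem.2 hs), sub_sub_cancel]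
    · rw [indicator_of_notMem hs, indicator_of_notMem (mt hmem.1 hs)]
  have hc1 : ∀ g : ℝ → ℝ, Continuous g →
      IntervalIntegrable (fun s => Real.cot (s / 2) * g s) volume ε Real.pi := by
    intro g hg
    refine ContinuousOn.intervalIntegrable ?_
    rw [uIcc_of_le hε.le]
    exact (continuousOn_cot_half.mono fun s hs => ⟨h0.trans_le hs.1, hs.2⟩).mul hg.continuousOn
  have hc2 : IntervalIntegrable (fun s => Real.cot (s / 2) * f (θ - s)) volume (-Real.pi) (-ε) := by
    have h : IntervalIntegrable (fun s => -(Real.cot (s / 2) * f (θ + s))) volume ε Real.pi :=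
      (hc1 (fun s => f (θ + s)) (by fun_prop)).neg
    refine (((IntervalIntegrable.iff_comp_neg (by finiteness)).1 h).congr fun s _ => ?_).symm
    simp [cot_neg_half, sub_eq_add_neg]
  have hi1 : IntegrableOn (fun s => Real.cot (s / 2) * f (θ - s)) (Ioo ε Real.pi) :=
    ((intervalIntegrable_iff_integrableOn_Ioo_of_le hε.le).1 (hc1 (fun s => f (θ - s)) (by fun_prop)))
  have hi2 : IntegrableOn (fun s => Real.cot (s / 2) * f (θ - s)) (Ioo (-Real.pi) (-ε)) :=
    ((intervalIntegrable_iff_integrableOn_Ioo_of_le (by linarith)).1 hc2)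
  rw [e, integral_indicator (measurableSet_Ioo.union measurableSet_Ioo),
    setIntegral_union (by
      rw [Set.disjoint_left]
      intro s h1 h2
      linarith [h1.1, h2.2]) measurableSet_Ioo hi1 hi2,
    ← integral_Ioc_eq_integral_Ioo, ← integral_Ioc_eq_integral_Ioo,
    ← intervalIntegral.integral_of_le hε.le, ← intervalIntegral.integral_of_le (by linarith),
    ← intervalIntegral.integral_comp_neg, ← intervalIntegral.integral_add
      (hc1 (fun s => f (θ - s)) (by fun_prop)) ?_]
  · refine intervalIntegral.integral_congr fun s _ => ?_
    simp only [hilbertIntegrand, cot_neg_half, smul_eq_mul, sub_neg_eq_add]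
    ring
  · refine (hc1 (fun s => -f (θ + s)) (by fun_prop)).congr fun s _ => ?_
    simp [cot_neg_half]

theorem hasHilbertTransformAt {f : ℝ → ℝ} {K : ℝ≥0} (hf : LipschitzWith K f) (θ : ℝ) :
    HasHilbertTransformAt f (hilbertIntegral f θ) θ := by
  have hint := intervalIntegrable_hilbertIntegrand hf θ
  have hcont := intervalIntegral.continuousOn_primitive_interval_left
    ((intervalIntegrable_iff' (by simp)).1 hint)
  have h0 := hcont 0 left_mem_uIcc
  have h1 : Tendsto (fun ε => ∫ s in ε..Real.pi, hilbertIntegrand f θ s) (𝓝[>] 0)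
      (𝓝 (∫ s in (0 : ℝ)..Real.pi, hilbertIntegrand f θ s)) := by
    refine Tendsto.mono_left h0 ?_
    rw [uIcc_of_le Real.pi_pos.le]
    rw [← nhdsWithin_Ioc_eq_nhdsGT Real.pi_pos]
    exact nhdsWithin_mono _ Ioc_subset_Icc_self
  refine (h1.const_mul (1 / (2 * Real.pi))).congr' ?_
  filter_upwards [Ioo_mem_nhdsGT Real.pi_pos] with ε hε
  exact (truncatedHilbert_eq hf.continuous θ hε.1 hε.2).symm

theorem hilbert_eq {f : ℝ → ℝ} {h θ : ℝ} (hh : HasHilbertTransformAt f h θ) : hilbert f θ = h :=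
  hh.limUnder_eq

/-- Vector values matter here: the transform of a whole `ℓ²`-valued series is computed one
coordinate at a time and then paired with an arbitrary sequence. -/
theorem hilbertIntegral_clm {F : Type*} [NormedAddCommGroup F] [NormedSpace ℝ F] [CompleteSpace E]
    [CompleteSpace F] {f : ℝ → E} {K : ℝ≥0} (hf : LipschitzWith K f) (L : E →L[ℝ] F) (θ : ℝ) :
    hilbertIntegral (fun φ => L (f φ)) θ = L (hilbertIntegral f θ) := by
  unfold hilbertIntegral
  rw [map_smul, ← L.intervalIntegral_comp_comm (intervalIntegrable_hilbertIntegrand hf θ)]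
  congr 1
  refine intervalIntegral.integral_congr fun s _ => ?_
  simp [hilbertIntegrand]

theorem lipschitzWith_of_abs_deriv_le {f f' : ℝ → E} {C : ℝ≥0}
    (hf : ∀ x, HasDerivAt f (f' x) x) (hC : ∀ x, ‖f' x‖ ≤ C) : LipschitzWith C f :=
  lipschitzWith_of_nnnorm_deriv_le (fun x => (hf x).differentiableAt) fun x => by
    rw [(hf x).deriv]; exact hC x

theorem hasDerivAt_sin_mul (a θ : ℝ) :
    HasDerivAt (fun θ => Real.sin (a * θ)) (a * Real.cos (a * θ)) θ := by
  simpa [mul_comm] using ((hasDerivAt_id θ).const_mul a).sin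

theorem hasDerivAt_cos_mul (a θ : ℝ) :
    HasDerivAt (fun θ => Real.cos (a * θ)) (-(a * Real.sin (a * θ))) θ := by
  simpa [mul_comm] using ((hasDerivAt_id θ).const_mul a).cos

theorem lipschitzWith_sin_mul (a : ℝ) : LipschitzWith ‖a‖₊ fun θ => Real.sin (a * θ) := by
  refine lipschitzWith_of_abs_deriv_le (hasDerivAt_sin_mul a) fun x => ?_
  rw [norm_mul]
  exact mul_le_of_le_one_right (norm_nonneg _) (Real.abs_cos_le_one _)

theorem intervalIntegrable_cot_mul_sin (a : ℝ) :
    IntervalIntegrable (fun s => Real.cot (s / 2) * Real.sin (a * s)) volume 0 Real.pi := by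
  have h := (intervalIntegrable_hilbertIntegrand (lipschitzWith_sin_mul a) 0).const_mul (-1 / 2)
  refine h.congr fun s _ => ?_
  simp [hilbertIntegrand]
  ring

theorem integral_cos_natCast_mul (k : ℕ) (hk : k ≠ 0) :
    ∫ s in (0 : ℝ)..Real.pi, Real.cos (k * s) = 0 := by
  have hk' : (k : ℝ) ≠ 0 := by exact_mod_cast hk
  rw [intervalIntegral.integral_comp_mul_left (fun s => Real.cos s) hk']
  simp [Real.sin_nat_mul_pi]

/-- Telescoping in `k`: `cot (s/2) (sin ((k+1)s) - sin (ks)) = cos ((k+1)s) + cos (ks)`. On `[0, π]`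
the cosines integrate to zero, except the constant one at `k = 0`, which contributes `π`. -/
theorem integral_cot_mul_sin_natCast (k : ℕ) :
    ∫ s in (0 : ℝ)..Real.pi, Real.cot (s / 2) * Real.sin ((k + 1 : ℕ) * s) = Real.pi := by
  have hstep : ∀ k : ℕ, (∫ s in (0 : ℝ)..Real.pi, Real.cot (s / 2) * Real.sin ((k + 1 : ℕ) * s)) -
      (∫ s in (0 : ℝ)..Real.pi, Real.cot (s / 2) * Real.sin (k * s)) =
      (∫ s in (0 : ℝ)..Real.pi, Real.cos ((k + 1 : ℕ) * s)) +
      ∫ s in (0 : ℝ)..Real.pi, Real.cos (k * s) := by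
    intro k
    rw [← intervalIntegral.integral_sub (intervalIntegrable_cot_mul_sin _)
      (intervalIntegrable_cot_mul_sin _), ← intervalIntegral.integral_add
      (Continuous.intervalIntegrable (by fun_prop) _ _)
      (Continuous.intervalIntegrable (by fun_prop) _ _),
      intervalIntegral.integral_of_le Real.pi_pos.le, intervalIntegral.integral_of_le Real.pi_pos.le]
    refine setIntegral_congr_fun measurableSet_Ioc fun s hs => ?_
    have hsin : Real.sin (s / 2) ≠ 0 := (Real.sin_pos_of_pos_of_lt_pi (by linarith [hs.1])
      (by linarith [hs.1, hs.2, Real.pi_pos])).ne'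
    have e1 : ((k + 1 : ℕ) : ℝ) * s = (k + 1 / 2) * s + s / 2 := by push_cast; ring
    have e2 : (k : ℝ) * s = (k + 1 / 2) * s - s / 2 := by ring
    simp only [e1, e2, Real.sin_add, Real.sin_sub, Real.cos_add, Real.cos_sub,
      Real.cot_eq_cos_div_sin]
    field_simp
    ring
  induction k with
  | zero =>
    have h := hstep 0
    rw [integral_cos_natCast_mul _ (by norm_num)] at h
    simpa using h
  | succ k ih =>
    have h := hstep (k + 1)
    rw [integral_cos_natCast_mul _ (by omega), integral_cos_natCast_mul _ (by omega), ih] at h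
    linarith

theorem integral_cot_mul_sin_intCast (j : ℤ) :
    ∫ s in (0 : ℝ)..Real.pi, Real.cot (s / 2) * Real.sin (j * s) = j.sign * Real.pi := by
  rcases lt_trichotomy j 0 with h | h | h
  · obtain ⟨k, rfl⟩ : ∃ k : ℕ, j = -((k + 1 : ℕ) : ℤ) := ⟨(-j).toNat - 1, by omega⟩
    have := integral_cot_mul_sin_natCast k
    rw [Int.sign_eq_neg_one_of_neg h]
    simp only [Int.cast_neg, Int.cast_natCast, neg_mul, Real.sin_neg, mul_neg,
      intervalIntegral.integral_neg, this, Int.cast_one, one_mul]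
  · subst h; simp
  · obtain ⟨k, rfl⟩ : ∃ k : ℕ, j = ((k + 1 : ℕ) : ℤ) := ⟨j.toNat - 1, by omega⟩
    have := integral_cot_mul_sin_natCast k
    rw [Int.sign_eq_one_of_pos h]
    simp only [Int.cast_natCast, this, Int.cast_one, one_mul]

/-- After Fubini, periodicity moves the translations by `±s` onto the cosine, and `cos (j(θ+s)) -
cos (j(θ-s)) = -2 sin (js) sin (jθ)`. The remaining `s`-integral is the known value `sign j · π`.
Only the Lipschitz property of `f` is needed, which is what a `C¹` competitor in the uniqueness
proof provides. -/
theorem hilbertIntegral_mul_cos_integral {f : ℝ → ℝ} {K : ℝ≥0} (hf : LipschitzWith K f)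
    (hp : Function.Periodic f (2 * Real.pi)) (j : ℤ) :
    ∫ θ in -Real.pi..Real.pi, hilbertIntegral f θ * Real.cos (j * θ) =
      -(j.sign * ∫ θ in -Real.pi..Real.pi, f θ * Real.sin (j * θ)) := by
  have hfc := hf.continuous
  have hpi : -Real.pi ≤ Real.pi := by linarith [Real.pi_pos]
  have e1 : ∀ θ, hilbertIntegral f θ * Real.cos (j * θ) =
      1 / (2 * Real.pi) * ∫ s in (0 : ℝ)..Real.pi, hilbertIntegrand f θ s * Real.cos (j * θ) := by
    intro θ
    rw [intervalIntegral.integral_mul_const, hilbertIntegral, smul_eq_mul, mul_assoc]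
  simp only [e1, intervalIntegral.integral_const_mul]
  have hint : IntegrableOn (Function.uncurry fun θ s => hilbertIntegrand f θ s * Real.cos (j * θ))
      (uIoc (-Real.pi) Real.pi ×ˢ uIoc 0 Real.pi) := by
    rw [uIoc_of_le hpi, uIoc_of_le Real.pi_pos.le]
    refine Measure.integrableOn_of_bounded (M := 4 * K) ?_ ?_ ?_
    · rw [Measure.volume_eq_prod, Measure.prod_prod]
      exact (ENNReal.mul_lt_top (by simp) (by simp)).ne
    · refine Measurable.aestronglyMeasurable ?_
      have h1 : Measurable fun p : ℝ × ℝ => Real.cot (p.2 / 2) :=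
        measurable_cot_half.comp measurable_snd
      have h2 : Measurable fun p : ℝ × ℝ =>
          (f (p.1 - p.2) - f (p.1 + p.2)) * Real.cos (j * p.1) :=
        Continuous.measurable (by fun_prop)
      have e : (Function.uncurry fun θ s => hilbertIntegrand f θ s * Real.cos (j * θ)) =
          (fun p : ℝ × ℝ => Real.cot (p.2 / 2)) * fun p =>
            (f (p.1 - p.2) - f (p.1 + p.2)) * Real.cos (j * p.1) :=
        funext fun p => mul_assoc _ _ _
      rw [e]
      exact h1.mul h2
    · filter_upwards [ae_restrict_mem (measurableSet_Ioc.prod measurableSet_Ioc)] with p hp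
      rw [Function.uncurry, norm_mul]
      exact (mul_le_of_le_one_right (norm_nonneg _) (Real.abs_cos_le_one _)).trans
        (norm_hilbertIntegrand_le hf p.1 hp.2)
  rw [intervalIntegral_intervalIntegral_swap hint]
  have e2 : ∀ s, ∫ θ in -Real.pi..Real.pi, hilbertIntegrand f θ s * Real.cos (j * θ) =
      (-2 * ∫ θ in -Real.pi..Real.pi, f θ * Real.sin (j * θ)) *
        (Real.cot (s / 2) * Real.sin (j * s)) := by
    intro s
    have hper : ∀ c : ℝ, ∫ θ in -Real.pi..Real.pi, f (θ + c) * Real.cos (j * θ) =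
        ∫ θ in -Real.pi..Real.pi, f θ * Real.cos (j * (θ - c)) := by
      intro c
      have hg : Function.Periodic (fun θ => f θ * Real.cos (j * (θ - c))) (2 * Real.pi) := by
        intro θ
        simp only [hp θ]
        rw [show (j : ℝ) * (θ + 2 * Real.pi - c) = j * (θ - c) + j * (2 * Real.pi) by ring,
          Real.cos_add_int_mul_two_pi]
      have h := hg.intervalIntegral_add_eq (-Real.pi + c) (-Real.pi)
      rw [show -Real.pi + c + 2 * Real.pi = Real.pi + c by ring,
        show -Real.pi + 2 * Real.pi = Real.pi by ring] at h
      rw [← h, ← intervalIntegral.integral_comp_add_right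
        (fun θ => f θ * Real.cos (j * (θ - c)))]
      simp
    have h1 := hper (-s)
    have h2 := hper s
    have hI : ∀ g h : ℝ → ℝ, Continuous g → Continuous h →
        IntervalIntegrable (fun θ => g θ * h θ) volume (-Real.pi) Real.pi :=
      fun g h hg hh => (hg.mul hh).intervalIntegrable _ _
    calc _ = Real.cot (s / 2) * ((∫ θ in -Real.pi..Real.pi, f (θ + -s) * Real.cos (j * θ)) -
          ∫ θ in -Real.pi..Real.pi, f (θ + s) * Real.cos (j * θ)) := by
          rw [← intervalIntegral.integral_sub (hI _ _ (by fun_prop) (by fun_prop))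
            (hI _ _ (by fun_prop) (by fun_prop)), ← intervalIntegral.integral_const_mul]
          refine intervalIntegral.integral_congr fun θ _ => ?_
          simp only [hilbertIntegrand, smul_eq_mul, sub_eq_add_neg]
          ring
      _ = Real.cot (s / 2) * ∫ θ in -Real.pi..Real.pi,
          (-2 * Real.sin (j * s)) * (f θ * Real.sin (j * θ)) := by
          rw [h1, h2, ← intervalIntegral.integral_sub (hI _ _ (by fun_prop) (by fun_prop))
            (hI _ _ (by fun_prop) (by fun_prop))]
          congr 1
          refine intervalIntegral.integral_congr fun θ _ => ?_
          simp only [mul_sub, sub_neg_eq_add, mul_add, Real.cos_add, Real.cos_sub]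
          ring
      _ = _ := by
          rw [intervalIntegral.integral_const_mul]
          ring
  simp only [e2, intervalIntegral.integral_const_mul, integral_cot_mul_sin_intCast]
  have := Real.pi_ne_zero
  field_simp

end Hilbert

/-! ### Sine series in `L²` and completeness of the trigonometric system. -/

section Fourier

theorem neg_pi_lt_pi : -Real.pi < Real.pi := by linarith [Real.pi_pos]

theorem integral_torusMeasure (f : ℝ → ℝ) :
    ∫ θ, f θ ∂torusMeasure = ∫ θ in -Real.pi..Real.pi, f θ :=
  (intervalIntegral.integral_of_le neg_pi_lt_pi.le).symm

theorem memLp_of_continuous {ψ : ℝ → ℝ} (hψ : Continuous ψ) : MemLp ψ 2 torusMeasure := by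
  obtain ⟨C, hC⟩ := (isCompact_Icc (a := -Real.pi) (b := Real.pi)).exists_bound_of_continuousOn
    hψ.continuousOn
  refine MemLp.of_bound hψ.aestronglyMeasurable C ?_
  filter_upwards [ae_restrict_mem measurableSet_Ioc] with θ hθ
  exact hC θ ⟨hθ.1.le, hθ.2⟩

/-- A square-integrable function whose Fourier coefficients vanish is zero. -/
theorem ae_eq_zero_of_integral_cos_sin {f : ℝ → ℝ} (hf : MemLp f 2 torusMeasure)
    (hc : ∀ j : ℤ, ∫ θ, f θ * Real.cos (j * θ) ∂torusMeasure = 0)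
    (hs : ∀ j : ℤ, ∫ θ, f θ * Real.sin (j * θ) ∂torusMeasure = 0) :
    f =ᵐ[torusMeasure] 0 := by
  have hf' : MemLp (fun θ => (f θ : ℂ)) 2 (volume.restrict (Ioc (-Real.pi) Real.pi)) := hf.ofReal
  have hint : Integrable f torusMeasure := hf.integrable (by norm_num)
  have hcoef : ∀ j : ℤ, fourierCoeffOn neg_pi_lt_pi (fun θ => (f θ : ℂ)) j = 0 := by
    intro j
    rw [fourierCoeffOn_eq_integral, intervalIntegral.integral_of_le neg_pi_lt_pi.le]
    have e : ∀ θ : ℝ, fourier (-j) (θ : AddCircle (Real.pi - -Real.pi)) • (f θ : ℂ) =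
        ((f θ * Real.cos (j * θ) : ℝ) : ℂ) + ((f θ * Real.sin (j * θ) : ℝ) : ℂ) *
          (-Complex.I) := by
      intro θ
      rw [fourier_coe_apply, smul_eq_mul]
      -- The circle has length `π - (-π)`, so the character `fourier (-j)` is `exp (-ijθ)`;
      -- splitting it into cosine and sine reduces to the hypotheses, and Parseval concludes.
      have : 2 * (Real.pi : ℂ) * Complex.I * ((-j : ℤ) : ℂ) * θ /
          ((Real.pi - -Real.pi : ℝ) : ℂ) = ((-(j * θ) : ℝ) : ℂ) * Complex.I := by
        have := Complex.ofReal_ne_zero.2 Real.pi_ne_zero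
        push_cast
        field_simp
        ring
      rw [this, Complex.exp_mul_I, ← Complex.ofReal_cos, ← Complex.ofReal_sin, Real.cos_neg,
        Real.sin_neg]
      push_cast
      ring
    simp only [e]
    have hbdd : ∀ g : ℝ → ℝ, Continuous g → (∀ θ, |g θ| ≤ 1) →
        Integrable (fun θ => ((f θ * g θ : ℝ) : ℂ)) torusMeasure := by
      intro g hg hb
      exact (hint.mul_bdd (c := 1) hg.aestronglyMeasurable (Eventually.of_forall hb)).ofReal
    have h1 := hbdd (fun θ => Real.cos (j * θ)) (by fun_prop) fun θ => Real.abs_cos_le_one _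
    have h2 := hbdd (fun θ => Real.sin (j * θ)) (by fun_prop) fun θ => Real.abs_sin_le_one _
    rw [integral_add h1 (h2.mul_const _),
      integral_mul_const, integral_complex_ofReal, integral_complex_ofReal, hc, hs]
    simp
  have h := hasSum_sq_fourierCoeffOn neg_pi_lt_pi hf'
  simp only [hcoef, norm_zero, ne_eq, OfNat.ofNat_ne_zero, not_false_eq_true, zero_pow] at h
  have h0 : ∫ θ, f θ ^ 2 ∂torusMeasure = 0 := by
    have h1 := h.unique hasSum_zero
    rw [smul_eq_mul, mul_eq_zero] at h1
    rcases h1 with h1 | h1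
    · exact absurd h1 (inv_ne_zero (by linarith [Real.pi_pos]))
    · rw [intervalIntegral.integral_of_le neg_pi_lt_pi.le] at h1
      simpa using h1
  rw [integral_eq_zero_iff_of_nonneg (fun θ => sq_nonneg _) hf.integrable_sq] at h0
  filter_upwards [h0] with θ hθ
  exact pow_eq_zero_iff (two_ne_zero) |>.1 hθ

/-- Integration against a continuous function, as a functional on `L²`. -/
def pairing (ψ : ℝ → ℝ) (hψ : Continuous ψ) : Lp ℝ 2 torusMeasure →L[ℝ] ℝ :=
  innerSL ℝ ((memLp_of_continuous hψ).toLp ψ)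

theorem pairing_apply (ψ : ℝ → ℝ) (hψ : Continuous ψ) (f : Lp ℝ 2 torusMeasure) :
    pairing ψ hψ f = ∫ θ, f θ * ψ θ ∂torusMeasure := by
  rw [pairing, innerSL_apply_apply, L2.inner_def]
  refine integral_congr_ae ?_
  filter_upwards [(memLp_of_continuous hψ).coeFn_toLp] with θ hθ
  rw [hθ]
  simp

/-- The mode `sin ((n + 2) θ + c)`. -/
def mode (c : ℝ) (n : ℕ) : BoundedContinuousFunction ℝ ℝ :=
  BoundedContinuousFunction.ofNormedAddCommGroup (fun θ => Real.sin (freq n * θ + c))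
    (by fun_prop) 1 (fun _ => Real.abs_sin_le_one _)

@[simp] theorem mode_apply (c : ℝ) (n : ℕ) (θ : ℝ) : mode c n θ = Real.sin (freq n * θ + c) := rfl

theorem norm_mode_le (c : ℝ) (n : ℕ) : ‖mode c n‖ ≤ 1 :=
  BoundedContinuousFunction.norm_ofNormedAddCommGroup_le _ zero_le_one _

/-- The mode `sin ((n + 2) θ + c)` in `L²`. -/
def modeLp (c : ℝ) (n : ℕ) : Lp ℝ 2 torusMeasure :=
  BoundedContinuousFunction.toLp 2 torusMeasure ℝ (mode c n)

theorem coeFn_modeLp (c : ℝ) (n : ℕ) :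
    modeLp c n =ᵐ[torusMeasure] fun θ => Real.sin (freq n * θ + c) :=
  BoundedContinuousFunction.coeFn_toLp 2 torusMeasure ℝ (mode c n)

theorem integral_cos_intCast_mul_add {k : ℤ} (hk : k ≠ 0) (c : ℝ) :
    ∫ θ in -Real.pi..Real.pi, Real.cos (k * θ + c) = 0 := by
  have hk' : (k : ℝ) ≠ 0 := by exact_mod_cast hk
  rw [intervalIntegral.integral_comp_mul_add (fun s => Real.cos s) hk']
  have e : (k : ℝ) * Real.pi + c = (k * -Real.pi + c) + k * (2 * Real.pi) := by ring
  rw [integral_cos, e, Real.sin_add_int_mul_two_pi]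
  simp

theorem integral_sin_mul_sin (c : ℝ) (n l : ℕ) :
    ∫ θ in -Real.pi..Real.pi, Real.sin (freq n * θ + c) * Real.sin (freq l * θ + c) =
      if n = l then Real.pi else 0 := by
  have e : ∀ θ, Real.sin (freq n * θ + c) * Real.sin (freq l * θ + c) =
      1 / 2 * (Real.cos (((n - l : ℤ) : ℝ) * θ + 0) -
        Real.cos (((n + l + 4 : ℤ) : ℝ) * θ + 2 * c)) := by
    intro θ
    have e1 : ((n - l : ℤ) : ℝ) * θ + 0 = (freq n * θ + c) - (freq l * θ + c) := by
      unfold freq; push_cast; ring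
    have e2 : ((n + l + 4 : ℤ) : ℝ) * θ + 2 * c = (freq n * θ + c) + (freq l * θ + c) := by
      unfold freq; push_cast; ring
    rw [e1, e2, Real.cos_sub (freq n * θ + c), Real.cos_add (freq n * θ + c)]
    ring
  have h4 := integral_cos_intCast_mul_add (k := n + l + 4) (by omega) (2 * c)
  simp only [e]
  rw [intervalIntegral.integral_const_mul, intervalIntegral.integral_sub
    (Continuous.intervalIntegrable (by fun_prop) _ _)
    (Continuous.intervalIntegrable (by fun_prop) _ _), h4]
  split_ifs with h
  · subst h
    simp
    ring
  · rw [integral_cos_intCast_mul_add (by omega)]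
    simp

theorem inner_modeLp (c : ℝ) (n : ℕ) (f : Lp ℝ 2 torusMeasure) :
    inner ℝ (modeLp c n) f = ∫ θ, f θ * Real.sin (freq n * θ + c) ∂torusMeasure := by
  rw [L2.inner_def]
  refine integral_congr_ae ?_
  filter_upwards [coeFn_modeLp c n] with θ hθ
  rw [hθ]
  simp

theorem inner_modeLp_modeLp (c : ℝ) (n l : ℕ) :
    inner ℝ (modeLp c n) (modeLp c l) = if n = l then Real.pi else 0 := by
  rw [inner_modeLp, ← integral_sin_mul_sin c, ← integral_torusMeasure]
  refine integral_congr_ae ?_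
  filter_upwards [coeFn_modeLp c l] with θ hθ
  rw [hθ, mul_comm]

theorem orthonormal_modeLp (c : ℝ) :
    Orthonormal ℝ fun n => (Real.sqrt Real.pi)⁻¹ • modeLp c n := by
  rw [orthonormal_iff_ite]
  intro n l
  rw [inner_smul_left, inner_smul_right, inner_modeLp_modeLp]
  have h : Real.sqrt Real.pi * Real.sqrt Real.pi = Real.pi := Real.mul_self_sqrt Real.pi_pos.le
  have h0 : Real.sqrt Real.pi ≠ 0 := by have := Real.pi_pos; positivity
  split_ifs
  · simp only [conj_trivial]
    field_simp
    rw [sq, h]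
  · simp

/-- The map taking a sequence `y` to the series `∑ y_n sin ((n + 2) θ + c)` in `L²`. -/
def sineSeries (c : ℝ) : EllTwo →L[ℝ] Lp ℝ 2 torusMeasure :=
  Real.sqrt Real.pi • (orthonormal_modeLp c).orthogonalFamily.linearIsometry.toContinuousLinearMap

theorem hasSum_sineSeries (c : ℝ) (y : EllTwo) :
    HasSum (fun n => y n • modeLp c n) (sineSeries c y) := by
  have h := ((orthonormal_modeLp c).orthogonalFamily.hasSum_linearIsometry y).const_smul
    (Real.sqrt Real.pi)
  have h0 : Real.sqrt Real.pi ≠ 0 := by have := Real.pi_pos; positivity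
  convert! h using 2 with n
  simp only [LinearIsometry.toSpanSingleton_apply, smul_smul]
  congr 1
  field_simp

theorem sineSeries_single (c : ℝ) (n : ℕ) :
    sineSeries c (lp.single 2 n (1 : ℝ)) = modeLp c n := by
  refine (hasSum_sineSeries c _).unique ?_
  convert! hasSum_ite_eq n (modeLp c n) using 2 with k
  by_cases h : k = n
  · subst h; simp
  · simp [h]

theorem inner_modeLp_sineSeries (c : ℝ) (n : ℕ) (y : EllTwo) :
    inner ℝ (modeLp c n) (sineSeries c y) = Real.pi * y n := by
  have h : (innerSL ℝ (modeLp c n)) ∘L (sineSeries c) = Real.pi • evalL n := by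
    refine EllTwo.clm_ext fun l => ?_
    rw [ContinuousLinearMap.comp_apply, sineSeries_single, innerSL_apply_apply,
      inner_modeLp_modeLp]
    by_cases h : n = l
    · subst h; simp
    · simp [h]
  exact congrArg (fun L => L y) h

theorem summable_inv_freq_sq : Summable fun n => (freq n)⁻¹ ^ 2 := by
  have h := (summable_nat_add_iff 2).2 (Real.summable_nat_pow_inv.2 one_lt_two)
  refine h.congr fun n => ?_
  simp [freq]

theorem summable_inv_freq_sq_mul (x : EllTwo) : Summable fun n => |(freq n)⁻¹ ^ 2 * x n| := by
  refine Summable.of_nonneg_of_le (fun n => abs_nonneg _) (fun n => ?_)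
    (summable_inv_freq_sq.mul_right ‖x‖)
  have := freq_pos n
  rw [abs_mul, abs_of_pos (by positivity)]
  gcongr
  exact x.abs_apply_le n

/-- With the factor `(freq n)⁻²` the series converges uniformly, and its bounded continuous sum is
mapped to the `L²` sum. -/
theorem sineSeries_ae_eq (c : ℝ) (x : EllTwo) :
    sineSeries c (lower 2 x) =ᵐ[torusMeasure]
      fun θ => ∑' n, (freq n)⁻¹ ^ 2 * x n * Real.sin (freq n * θ + c) := by
  have hsum : Summable fun n => ((freq n)⁻¹ ^ 2 * x n) • mode c n := by
    refine Summable.of_norm_bounded (summable_inv_freq_sq_mul x) fun n => ?_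
    rw [norm_smul]
    exact mul_le_of_le_one_right (norm_nonneg _) (norm_mode_le c n)
  have h1 := hsum.hasSum.mapL (BoundedContinuousFunction.toLp 2 torusMeasure ℝ)
  simp only [map_smul] at h1
  have h2 := (hasSum_sineSeries c (lower 2 x)).unique h1
  rw [h2]
  filter_upwards [BoundedContinuousFunction.coeFn_toLp 2 torusMeasure ℝ
    (∑' n, ((freq n)⁻¹ ^ 2 * x n) • mode c n)] with θ hθ
  rw [hθ]
  have h3 := hsum.hasSum.mapL (BoundedContinuousFunction.evalCLM ℝ θ)
  exact h3.tsum_eq.symm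

end Fourier

/-! ### Elements of `H^m` built from sequences. -/

section SobolevSeries

theorem integral_sin_mul_deriv (n : ℕ) (c : ℝ) {φ : ℝ → ℝ} (hφ : ContDiff ℝ 1 φ)
    (hp : Function.Periodic φ (2 * Real.pi)) :
    ∫ θ in -Real.pi..Real.pi, Real.sin (freq n * θ + c) * deriv φ θ =
      -freq n * ∫ θ in -Real.pi..Real.pi, Real.sin (freq n * θ + (c + Real.pi / 2)) * φ θ := by
  have hd : ∀ θ, HasDerivAt (fun θ => Real.sin (freq n * θ + c))
      (freq n * Real.sin (freq n * θ + (c + Real.pi / 2))) θ := by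
    intro θ
    rw [← add_assoc, Real.sin_add_pi_div_two]
    simpa [mul_comm] using (((hasDerivAt_id θ).const_mul (freq n)).add_const c).sin
  rw [intervalIntegral.integral_mul_deriv_eq_deriv_mul (fun θ _ => hd θ)
    (fun θ _ => (hφ.differentiable (by norm_num) θ).hasDerivAt)
    (Continuous.intervalIntegrable (by fun_prop) _ _)
    ((hφ.continuous_deriv le_rfl).intervalIntegrable _ _)]
  have e1 : φ Real.pi = φ (-Real.pi) := by
    rw [← hp (-Real.pi)]; congr 1; ring
  have e2 : Real.sin (freq n * Real.pi + c) = Real.sin (freq n * -Real.pi + c) := by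
    have : freq n * Real.pi + c = (freq n * -Real.pi + c) + (n + 2 : ℕ) * (2 * Real.pi) := by
      unfold freq; push_cast; ring
    rw [this, Real.sin_add_nat_mul_two_pi]
  rw [e1, e2, sub_self, zero_sub, ← intervalIntegral.integral_neg,
    ← intervalIntegral.integral_const_mul]
  refine intervalIntegral.integral_congr fun θ _ => ?_
  ring

theorem periodic_deriv {φ : ℝ → ℝ} {T : ℝ} (hp : Function.Periodic φ T) :
    Function.Periodic (deriv φ) T := by
  intro θ
  rw [← deriv_comp_add_const, funext hp]

theorem integral_sin_mul_iteratedDeriv (n k : ℕ) (c : ℝ) {φ : ℝ → ℝ}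
    (hφ : ContDiff ℝ ((⊤ : ℕ∞) : WithTop ℕ∞) φ) (hp : Function.Periodic φ (2 * Real.pi)) :
    ∫ θ in -Real.pi..Real.pi, Real.sin (freq n * θ + c) * iteratedDeriv k φ θ =
      (-freq n) ^ k *
        ∫ θ in -Real.pi..Real.pi, Real.sin (freq n * θ + (c + k * (Real.pi / 2))) * φ θ := by
  induction k generalizing φ with
  | zero => simp
  | succ k ih =>
    have hφ' : ContDiff ℝ ((⊤ : ℕ∞) : WithTop ℕ∞) (deriv φ) := by
      simpa using (contDiff_infty_iff_deriv.1 hφ).2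
    rw [iteratedDeriv_succ', ih hφ' (periodic_deriv hp),
      integral_sin_mul_deriv n _ (hφ.of_le (by exact_mod_cast le_top)) hp]
    push_cast
    rw [show c + ((k : ℝ) + 1) * (Real.pi / 2) = c + k * (Real.pi / 2) + Real.pi / 2 by ring]
    ring

/-- The tuple of derivatives of the function with Fourier coefficients `(freq n)^(-m) y_n`. -/
def sobolevTuple (m : ℕ) : EllTwo →L[ℝ] PiLp 2 (fun _ : Fin (m + 1) => Lp ℝ 2 torusMeasure) :=
  (PiLp.continuousLinearEquiv 2 ℝ (fun _ : Fin (m + 1) => Lp ℝ 2 torusMeasure)).symm.toContinuousLinearMap ∘L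
    ContinuousLinearMap.pi fun k : Fin (m + 1) =>
      sineSeries ((k : ℕ) * (Real.pi / 2)) ∘L lower (m - k)

theorem sobolevTuple_apply (m : ℕ) (y : EllTwo) (k : Fin (m + 1)) :
    sobolevTuple m y k = sineSeries ((k : ℕ) * (Real.pi / 2)) (lower (m - k) y) := rfl

theorem lower_single (j n : ℕ) :
    lower j (lp.single 2 n (1 : ℝ)) = (freq n)⁻¹ ^ j • lp.single 2 n (1 : ℝ) := by
  ext k
  by_cases h : k = n
  · subst h; simp
  · simp [Pi.single_eq_of_ne h]

theorem pairing_modeLp (ψ : ℝ → ℝ) (hψ : Continuous ψ) (c : ℝ) (n : ℕ) :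
    pairing ψ hψ (modeLp c n) = ∫ θ in -Real.pi..Real.pi, Real.sin (freq n * θ + c) * ψ θ := by
  rw [pairing_apply, ← integral_torusMeasure]
  refine integral_congr_ae ?_
  filter_upwards [coeFn_modeLp c n] with θ hθ
  rw [hθ]

/-- Each derivative of a sine multiplies by the frequency and advances the phase by `π/2`. Both
sides are bounded functionals of `y`, so integration by parts is needed only for single modes. -/
theorem sobolevTuple_mem (m : ℕ) (y : EllTwo) : sobolevTuple m y ∈ Sobolev m := by
  intro k φ hφ hp
  have hc : Continuous (iteratedDeriv k φ) :=
    hφ.continuous_iteratedDeriv k (by exact_mod_cast le_top)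
  rw [← pairing_apply _ hc, ← pairing_apply _ hφ.continuous, sobolevTuple_apply,
    sobolevTuple_apply]
  have key : pairing _ hc ∘L sineSeries (((0 : Fin (m + 1)) : ℕ) * (Real.pi / 2)) ∘L
      lower (m - (0 : Fin (m + 1))) = (-1 : ℝ) ^ (k : ℕ) • (pairing _ hφ.continuous ∘L
      sineSeries ((k : ℕ) * (Real.pi / 2)) ∘L lower (m - k)) := by
    refine EllTwo.clm_ext fun n => ?_
    simp only [ContinuousLinearMap.comp_apply, smul_apply, lower_single,
      map_smul, sineSeries_single, pairing_modeLp, smul_eq_mul]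
    rw [integral_sin_mul_iteratedDeriv n k _ hφ hp]
    have hk : (k : ℕ) ≤ m := by omega
    have hf : (freq n)⁻¹ ^ (m - ((0 : Fin (m + 1)) : ℕ)) * (-freq n) ^ (k : ℕ) =
        (-1) ^ (k : ℕ) * (freq n)⁻¹ ^ (m - k) := by
      have h0 := (freq_pos n).ne'
      rw [Fin.val_zero, Nat.sub_zero, neg_pow]
      have e : (freq n)⁻¹ ^ m = (freq n)⁻¹ ^ (m - k : ℕ) * (freq n)⁻¹ ^ (k : ℕ) := by
        rw [← pow_add, Nat.sub_add_cancel hk]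
      rw [e]
      have : (freq n)⁻¹ ^ (k : ℕ) * freq n ^ (k : ℕ) = 1 := by
        rw [← mul_pow, inv_mul_cancel₀ h0, one_pow]
      linear_combination (-1) ^ (k : ℕ) * (freq n)⁻¹ ^ (m - k) * this
    rw [← mul_assoc, hf, Fin.val_zero, Nat.cast_zero, zero_mul, zero_add, mul_assoc]
  exact congrArg (fun L => L y) key

/-- The element of `H^m` with Fourier coefficients `(freq n)^(-m) y_n`. -/
def sobolevSeries (m : ℕ) : EllTwo →L[ℝ] Sobolev m :=
  (sobolevTuple m).codRestrict (Sobolev m) (sobolevTuple_mem m)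

theorem wderiv_sobolevSeries (m : ℕ) (y : EllTwo) (k : Fin (m + 1)) :
    wderiv (sobolevSeries m y) k = sineSeries ((k : ℕ) * (Real.pi / 2)) (lower (m - k) y) := rfl

theorem wderiv_sobolevSeries_zero (m : ℕ) (y : EllTwo) :
    wderiv (sobolevSeries m y) 0 = sineSeries 0 (lower m y) := by
  rw [wderiv_sobolevSeries]
  simp

end SobolevSeries

/-! ### Mode families as `ℓ²`-valued functions of the angle; pairing them with a sequence gives the
profiles. -/

section VectorSeries

/-- The sequence `(freq n)⁻² g_n(θ)` in `ℓ²`. -/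
def vecSeries (g : ℕ → ℝ → ℝ) (θ : ℝ) : EllTwo :=
  ∑' n, ((freq n)⁻¹ ^ 2 * g n θ) • lp.single 2 n (1 : ℝ)

variable {g g' : ℕ → ℝ → ℝ}

theorem norm_smul_single_le (hg : ∀ n θ, |g n θ| ≤ 1) (n : ℕ) (θ : ℝ) :
    ‖(((freq n)⁻¹ ^ 2 * g n θ) • lp.single 2 n (1 : ℝ) : EllTwo)‖ ≤ (freq n)⁻¹ ^ 2 := by
  have := freq_pos n
  rw [norm_smul, lp.norm_single (by norm_num), norm_mul, Real.norm_eq_abs, Real.norm_eq_abs,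
    abs_of_pos (by positivity : 0 < (freq n)⁻¹ ^ 2), norm_one, mul_one]
  exact mul_le_of_le_one_right (by positivity) (hg n θ)

theorem summable_vecSeries (hg : ∀ n θ, |g n θ| ≤ 1) (θ : ℝ) :
    Summable fun n => (((freq n)⁻¹ ^ 2 * g n θ) • lp.single 2 n (1 : ℝ) : EllTwo) :=
  Summable.of_norm_bounded summable_inv_freq_sq fun n => norm_smul_single_le hg n θ

theorem norm_vecSeries_le (hg : ∀ n θ, |g n θ| ≤ 1) (θ : ℝ) :
    ‖vecSeries g θ‖ ≤ ∑' n, (freq n)⁻¹ ^ 2 :=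
  tsum_of_norm_bounded summable_inv_freq_sq.hasSum fun n => norm_smul_single_le hg n θ

theorem hasSum_inner_vecSeries (hg : ∀ n θ, |g n θ| ≤ 1) (x : EllTwo) (θ : ℝ) :
    HasSum (fun n => (freq n)⁻¹ ^ 2 * x n * g n θ) (inner ℝ x (vecSeries g θ)) := by
  have h := (summable_vecSeries hg θ).hasSum.mapL (innerSL ℝ x)
  convert! h using 2 with n
  simp only [innerSL_apply_apply, inner_smul_right, lp.inner_single_right]
  simp
  ring

theorem vecSeries_apply (hg : ∀ n θ, |g n θ| ≤ 1) (n : ℕ) (θ : ℝ) :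
    vecSeries g θ n = (freq n)⁻¹ ^ 2 * g n θ := by
  have h := (summable_vecSeries hg θ).hasSum.mapL (evalL n)
  refine h.unique ?_
  convert! hasSum_ite_eq n ((freq n)⁻¹ ^ 2 * g n θ) using 2 with k
  by_cases hk : k = n
  · subst hk; simp
  · simp [hk]

theorem inner_single_vecSeries (hg : ∀ n θ, |g n θ| ≤ 1) (n : ℕ) (θ : ℝ) :
    inner ℝ (lp.single 2 n (1 : ℝ)) (vecSeries g θ) = (freq n)⁻¹ ^ 2 * g n θ := by
  rw [lp.inner_single_left, vecSeries_apply hg]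
  simp

theorem hasDerivAt_vecSeries (hg : ∀ n θ, |g n θ| ≤ 1) (hg' : ∀ n θ, |g' n θ| ≤ 1)
    (hd : ∀ n θ, HasDerivAt (g n) (g' n θ) θ) (θ : ℝ) :
    HasDerivAt (vecSeries g) (vecSeries g' θ) θ :=
  hasDerivAt_tsum summable_inv_freq_sq
    (fun n θ => ((hd n θ).const_mul _).smul_const _)
    (fun n θ => norm_smul_single_le hg' n θ) (summable_vecSeries hg 0) θ

theorem continuous_vecSeries (hg : ∀ n θ, |g n θ| ≤ 1) (hc : ∀ n, Continuous (g n)) :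
    Continuous (vecSeries g) :=
  continuous_tsum (fun n => (continuous_const.mul (hc n)).smul continuous_const)
    summable_inv_freq_sq fun n θ => norm_smul_single_le hg n θ

end VectorSeries

/-! ### Action of the linearized operator on the modes. -/

section Modes

/-- The profile of `η` associated with the mode `n`; equal to `-ẽ_{n+1} / 2`. -/
def etaMode (n : ℕ) (θ : ℝ) : ℝ :=
  (Real.sin ((n + 1) * θ) / (n + 1) - Real.sin ((n + 3) * θ) / (n + 3)) / 2

/-- The derivative of `etaMode`. -/
def etaModeDeriv (n : ℕ) (θ : ℝ) : ℝ := (Real.cos ((n + 1) * θ) - Real.cos ((n + 3) * θ)) / 2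

/-- The Hilbert transform of `etaMode`. -/
def hilbertMode (n : ℕ) (θ : ℝ) : ℝ :=
  (-Real.cos ((n + 1) * θ) / (n + 1) + Real.cos ((n + 3) * θ) / (n + 3)) / 2

/-- The velocity associated with `etaMode`. -/
def velocityMode (n : ℕ) (θ : ℝ) : ℝ :=
  (-Real.sin ((n + 1) * θ) / (n + 1) ^ 2 + Real.sin ((n + 3) * θ) / (n + 3) ^ 2) / 2

/-- The mode of the weighted derivative `∂_θ η / sin θ`. -/
def sineMode (n : ℕ) (θ : ℝ) : ℝ := Real.sin (freq n * θ)

theorem abs_div_le_one {a b : ℝ} (ha : |a| ≤ 1) (hb : 1 ≤ b) : |a / b| ≤ 1 := by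
  rw [abs_div, abs_of_pos (by linarith : 0 < b)]
  exact div_le_one_of_le₀ (ha.trans hb) (by linarith)

theorem abs_half_sub_le_one {a b : ℝ} (ha : |a| ≤ 1) (hb : |b| ≤ 1) : |(a - b) / 2| ≤ 1 := by
  rw [abs_le] at *
  constructor <;> linarith [ha.1, ha.2, hb.1, hb.2]

theorem abs_half_add_le_one {a b : ℝ} (ha : |a| ≤ 1) (hb : |b| ≤ 1) : |(a + b) / 2| ≤ 1 := by
  rw [abs_le] at *
  constructor <;> linarith [ha.1, ha.2, hb.1, hb.2]

theorem abs_etaMode_le (n : ℕ) (θ : ℝ) : |etaMode n θ| ≤ 1 := by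
  have hn := n.cast_nonneg (α := ℝ)
  exact abs_half_sub_le_one (abs_div_le_one (Real.abs_sin_le_one _) (by linarith))
    (abs_div_le_one (Real.abs_sin_le_one _) (by linarith))

theorem abs_etaModeDeriv_le (n : ℕ) (θ : ℝ) : |etaModeDeriv n θ| ≤ 1 :=
  abs_half_sub_le_one (Real.abs_cos_le_one _) (Real.abs_cos_le_one _)

theorem abs_hilbertMode_le (n : ℕ) (θ : ℝ) : |hilbertMode n θ| ≤ 1 := by
  have hn := n.cast_nonneg (α := ℝ)
  refine abs_half_add_le_one (abs_div_le_one ?_ (by linarith))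
    (abs_div_le_one (Real.abs_cos_le_one _) (by linarith))
  rw [abs_neg]; exact Real.abs_cos_le_one _

theorem abs_velocityMode_le (n : ℕ) (θ : ℝ) : |velocityMode n θ| ≤ 1 := by
  have hn := n.cast_nonneg (α := ℝ)
  refine abs_half_add_le_one (abs_div_le_one ?_ (one_le_pow₀ (by linarith)))
    (abs_div_le_one (Real.abs_sin_le_one _) (one_le_pow₀ (by linarith)))
  rw [abs_neg]; exact Real.abs_sin_le_one _

theorem abs_sineMode_le (n : ℕ) (θ : ℝ) : |sineMode n θ| ≤ 1 := Real.abs_sin_le_one _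

theorem hasDerivAt_etaMode (n : ℕ) (θ : ℝ) : HasDerivAt (etaMode n) (etaModeDeriv n θ) θ := by
  have h1 : (n : ℝ) + 1 ≠ 0 := by positivity
  have h3 : (n : ℝ) + 3 ≠ 0 := by positivity
  refine ((((hasDerivAt_sin_mul ((n : ℝ) + 1) θ).div_const ((n : ℝ) + 1)).sub
    ((hasDerivAt_sin_mul ((n : ℝ) + 3) θ).div_const ((n : ℝ) + 3))).div_const 2).congr_deriv ?_
  unfold etaModeDeriv
  field_simp

theorem hasDerivAt_velocityMode (n : ℕ) (θ : ℝ) :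
    HasDerivAt (velocityMode n) (hilbertMode n θ) θ := by
  have h1 : (n : ℝ) + 1 ≠ 0 := by positivity
  have h3 : (n : ℝ) + 3 ≠ 0 := by positivity
  refine ((((hasDerivAt_sin_mul ((n : ℝ) + 1) θ).neg.div_const (((n : ℝ) + 1) ^ 2)).add
    ((hasDerivAt_sin_mul ((n : ℝ) + 3) θ).div_const (((n : ℝ) + 3) ^ 2))).div_const 2).congr_deriv ?_
  unfold hilbertMode
  field_simp

/-- Dividing by the weight's `sin θ` turns the profiles into plain sines, which are orthogonal in
`L²`. -/
theorem etaModeDeriv_eq (n : ℕ) (θ : ℝ) : etaModeDeriv n θ = Real.sin θ * sineMode n θ := by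
  unfold etaModeDeriv sineMode freq
  rw [show ((n : ℝ) + 1) * θ = (n + 2) * θ - θ by ring,
    show ((n : ℝ) + 3) * θ = (n + 2) * θ + θ by ring, Real.cos_sub, Real.cos_add]
  ring

theorem hilbertIntegral_etaMode (n : ℕ) (θ : ℝ) :
    hilbertIntegral (etaMode n) θ = hilbertMode n θ := by
  have e : ∀ s, hilbertIntegrand (etaMode n) θ s =
      -(Real.cos ((n + 1) * θ) / (n + 1)) * (Real.cot (s / 2) * Real.sin ((n + 1 : ℤ) * s)) +
      (Real.cos ((n + 3) * θ) / (n + 3)) * (Real.cot (s / 2) * Real.sin ((n + 3 : ℤ) * s)) := by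
    intro s
    simp only [hilbertIntegrand, etaMode, mul_sub ((n : ℝ) + 1), mul_sub ((n : ℝ) + 3),
      mul_add ((n : ℝ) + 1) θ, mul_add ((n : ℝ) + 3) θ, Real.sin_sub, Real.sin_add, smul_eq_mul]
    push_cast
    ring
  rw [hilbertIntegral]
  simp only [e]
  rw [intervalIntegral.integral_add ((intervalIntegrable_cot_mul_sin _).const_mul _)
    ((intervalIntegrable_cot_mul_sin _).const_mul _), intervalIntegral.integral_const_mul,
    intervalIntegral.integral_const_mul]
  have h1 := integral_cot_mul_sin_intCast (n + 1)
  have h3 := integral_cot_mul_sin_intCast (n + 3)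
  rw [Int.sign_eq_one_of_pos (by omega)] at h1 h3
  push_cast at h1 h3 ⊢
  rw [h1, h3, smul_eq_mul, hilbertMode]
  have := Real.pi_ne_zero
  field_simp

/-- The linearized operator on `sin (a θ)`, `a > 0`. -/
theorem linearized_sin (a θ : ℝ) (ha : a ≠ 0) :
    1 / 2 * Real.sin (2 * θ) * (a * Real.cos (a * θ)) - Real.cos (2 * θ) * Real.sin (a * θ)
      + Real.sin (2 * θ) * (-Real.cos (a * θ)) - 2 * Real.cos (2 * θ) * (-Real.sin (a * θ) / a)
    = (a - 2) / (4 * a) *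
      ((a - 2) * Real.sin ((a + 2) * θ) - (a + 2) * Real.sin ((a - 2) * θ)) := by
  rw [add_mul a 2 θ, sub_mul a 2 θ, Real.sin_add, Real.sin_sub]
  field_simp
  ring

theorem linearized_etaMode (n : ℕ) (θ : ℝ) :
    1 / 2 * Real.sin (2 * θ) * etaModeDeriv n θ - Real.cos (2 * θ) * etaMode n θ
      + Real.sin (2 * θ) * hilbertMode n θ - 2 * Real.cos (2 * θ) * velocityMode n θ
    = ((n - 1) / (4 * (n + 1) ^ 2) *
        ((n - 1) * Real.sin ((n + 3) * θ) - (n + 3) * Real.sin ((n - 1) * θ))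
      - (n + 1) / (4 * (n + 3) ^ 2) *
        ((n + 1) * Real.sin ((n + 5) * θ) - (n + 5) * Real.sin ((n + 1) * θ))) / 2 := by
  have h1 : (n : ℝ) + 1 ≠ 0 := by positivity
  have h3 : (n : ℝ) + 3 ≠ 0 := by positivity
  have k1 := linearized_sin ((n : ℝ) + 1) θ h1
  have k3 := linearized_sin ((n : ℝ) + 3) θ h3
  rw [show (n : ℝ) + 1 - 2 = n - 1 by ring, show (n : ℝ) + 1 + 2 = n + 3 by ring] at k1
  rw [show (n : ℝ) + 3 - 2 = n + 1 by ring, show (n : ℝ) + 3 + 2 = n + 5 by ring] at k3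
  have e : 1 / 2 * Real.sin (2 * θ) * etaModeDeriv n θ - Real.cos (2 * θ) * etaMode n θ
      + Real.sin (2 * θ) * hilbertMode n θ - 2 * Real.cos (2 * θ) * velocityMode n θ =
    (1 / ((n : ℝ) + 1) * (1 / 2 * Real.sin (2 * θ) * (((n : ℝ) + 1) * Real.cos (((n : ℝ) + 1) * θ))
      - Real.cos (2 * θ) * Real.sin (((n : ℝ) + 1) * θ)
      + Real.sin (2 * θ) * (-Real.cos (((n : ℝ) + 1) * θ))
      - 2 * Real.cos (2 * θ) * (-Real.sin (((n : ℝ) + 1) * θ) / ((n : ℝ) + 1)))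
    - 1 / ((n : ℝ) + 3) * (1 / 2 * Real.sin (2 * θ) * (((n : ℝ) + 3) * Real.cos (((n : ℝ) + 3) * θ))
      - Real.cos (2 * θ) * Real.sin (((n : ℝ) + 3) * θ)
      + Real.sin (2 * θ) * (-Real.cos (((n : ℝ) + 3) * θ))
      - 2 * Real.cos (2 * θ) * (-Real.sin (((n : ℝ) + 3) * θ) / ((n : ℝ) + 3)))) / 2 := by
    unfold etaModeDeriv etaMode hilbertMode velocityMode
    field_simp
    ring
  rw [e, k1, k3]
  field_simp

/-- At the bottom, the term `sin ((n-1)θ)` becomes `-sin θ`, so it folds back onto a mode already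
present instead of creating a lower one. For `n = 1` below it is zero. Hence the family of modes is
closed under the operator. -/
theorem linearized_etaMode_zero (θ : ℝ) :
    1 / 2 * Real.sin (2 * θ) * etaModeDeriv 0 θ - Real.cos (2 * θ) * etaMode 0 θ
      + Real.sin (2 * θ) * hilbertMode 0 θ - 2 * Real.cos (2 * θ) * velocityMode 0 θ
    = coupling 0 * etaMode 2 θ - diagCoeff 0 * etaMode 0 θ := by
  rw [linearized_etaMode]
  simp only [coupling, diagCoeff, nonlocalSymbol, etaMode]
  push_cast
  rw [show ((0 : ℝ) - 1) * θ = -((0 + 1) * θ) by ring, Real.sin_neg]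
  norm_num
  ring

theorem linearized_etaMode_one (θ : ℝ) :
    1 / 2 * Real.sin (2 * θ) * etaModeDeriv 1 θ - Real.cos (2 * θ) * etaMode 1 θ
      + Real.sin (2 * θ) * hilbertMode 1 θ - 2 * Real.cos (2 * θ) * velocityMode 1 θ
    = coupling 1 * etaMode 3 θ - diagCoeff 1 * etaMode 1 θ := by
  rw [linearized_etaMode]
  simp only [coupling, diagCoeff, nonlocalSymbol, etaMode]
  norm_num
  ring

/-- The coefficients towards `k` and from `k` upwards are the same `coupling` with opposite signs:
this is the skew-symmetry on which the energy estimate rests. -/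
theorem linearized_etaMode_add_two (k : ℕ) (θ : ℝ) :
    1 / 2 * Real.sin (2 * θ) * etaModeDeriv (k + 2) θ - Real.cos (2 * θ) * etaMode (k + 2) θ
      + Real.sin (2 * θ) * hilbertMode (k + 2) θ - 2 * Real.cos (2 * θ) * velocityMode (k + 2) θ
    = -coupling k * etaMode k θ + coupling (k + 2) * etaMode (k + 4) θ
      - diagCoeff (k + 2) * etaMode (k + 2) θ := by
  rw [linearized_etaMode]
  simp only [coupling, diagCoeff, nonlocalSymbol, etaMode]
  push_cast
  have h1 : (k : ℝ) + 1 ≠ 0 := by positivity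
  have h3 : (k : ℝ) + 3 ≠ 0 := by positivity
  have h5 : (k : ℝ) + 5 ≠ 0 := by positivity
  have h7 : (k : ℝ) + 7 ≠ 0 := by positivity
  rw [show (k : ℝ) + 2 - 1 = k + 1 by ring, show (k : ℝ) + 2 + 1 = k + 3 by ring,
    show (k : ℝ) + 2 + 3 = k + 5 by ring, show (k : ℝ) + 2 + 5 = k + 7 by ring,
    show (k : ℝ) + 4 + 1 = k + 5 by ring, show (k : ℝ) + 4 + 3 = k + 7 by ring]
  generalize Real.sin (((k : ℝ) + 1) * θ) = s1
  generalize Real.sin (((k : ℝ) + 3) * θ) = s3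
  generalize Real.sin (((k : ℝ) + 5) * θ) = s5
  generalize Real.sin (((k : ℝ) + 7) * θ) = s7
  field_simp
  ring

end Modes

/-! ### Profiles, Hilbert transforms and velocities attached to a sequence; the series solves the
equation. -/

section Profiles

/-- The profile `∑ (freq n)⁻² x_n etaMode n`. -/
def etaOf (x : EllTwo) (θ : ℝ) : ℝ := inner ℝ x (vecSeries etaMode θ)

/-- The weighted derivative `∑ (freq n)⁻² x_n sin (freq n θ)`. -/
def sineOf (x : EllTwo) (θ : ℝ) : ℝ := inner ℝ x (vecSeries sineMode θ)

/-- The Hilbert transform of `etaOf x`. -/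
def hilbertOf (x : EllTwo) (θ : ℝ) : ℝ := inner ℝ x (vecSeries hilbertMode θ)

/-- The velocity of `etaOf x`. -/
def velocityOf (x : EllTwo) (θ : ℝ) : ℝ := inner ℝ x (vecSeries velocityMode θ)

theorem hasDerivAt_vecSeries_etaMode (θ : ℝ) :
    HasDerivAt (vecSeries etaMode) (vecSeries etaModeDeriv θ) θ :=
  hasDerivAt_vecSeries abs_etaMode_le abs_etaModeDeriv_le hasDerivAt_etaMode θ

theorem vecSeries_etaModeDeriv (θ : ℝ) :
    vecSeries etaModeDeriv θ = Real.sin θ • vecSeries sineMode θ := by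
  ext n
  rw [vecSeries_apply abs_etaModeDeriv_le, etaModeDeriv_eq]
  simp only [lp.coeFn_smul, Pi.smul_apply, vecSeries_apply abs_sineMode_le, smul_eq_mul]
  ring

theorem hasDerivAt_inner_const (x : EllTwo) {f : ℝ → EllTwo} {f' : EllTwo} {θ : ℝ}
    (hf : HasDerivAt f f' θ) : HasDerivAt (fun θ => inner ℝ x (f θ)) (inner ℝ x f') θ :=
  (innerSL ℝ x).hasFDerivAt.comp_hasDerivAt θ hf

theorem hasDerivAt_etaOf (x : EllTwo) (θ : ℝ) :
    HasDerivAt (etaOf x) (Real.sin θ * sineOf x θ) θ := by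
  have h := hasDerivAt_inner_const x (hasDerivAt_vecSeries_etaMode θ)
  rwa [vecSeries_etaModeDeriv, inner_smul_right] at h

theorem hasDerivAt_velocityOf (x : EllTwo) (θ : ℝ) :
    HasDerivAt (velocityOf x) (hilbertOf x θ) θ :=
  hasDerivAt_inner_const x
    (hasDerivAt_vecSeries abs_velocityMode_le abs_hilbertMode_le hasDerivAt_velocityMode θ)

theorem continuous_vecSeries_sineMode : Continuous (vecSeries sineMode) :=
  continuous_vecSeries abs_sineMode_le fun n => by unfold sineMode; fun_prop

theorem continuous_sineOf (x : EllTwo) : Continuous (sineOf x) :=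
  (innerSL ℝ x).continuous.comp continuous_vecSeries_sineMode

theorem contDiff_vecSeries_etaMode : ContDiff ℝ 1 (vecSeries etaMode) := by
  rw [contDiff_one_iff_deriv]
  refine ⟨fun θ => (hasDerivAt_vecSeries_etaMode θ).differentiableAt, ?_⟩
  have : deriv (vecSeries etaMode) = fun θ => Real.sin θ • vecSeries sineMode θ := by
    funext θ
    rw [(hasDerivAt_vecSeries_etaMode θ).deriv, vecSeries_etaModeDeriv]
  rw [this]
  exact Real.continuous_sin.smul continuous_vecSeries_sineMode

theorem exists_lipschitzWith_vecSeries_etaMode : ∃ K, LipschitzWith K (vecSeries etaMode) :=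
  ⟨⟨∑' n, (freq n)⁻¹ ^ 2, (norm_nonneg _).trans (norm_vecSeries_le abs_etaMode_le 0)⟩,
    lipschitzWith_of_abs_deriv_le hasDerivAt_vecSeries_etaMode
      (norm_vecSeries_le abs_etaModeDeriv_le)⟩

/-- The `ℓ²`-valued function `vecSeries etaMode` is Lipschitz, so its transform exists and is read
off coordinatewise; pairing with `x` commutes with the integral. No summation has to be exchanged
with a principal value. -/
theorem hilbertIntegral_etaOf (x : EllTwo) (θ : ℝ) :
    hilbertIntegral (etaOf x) θ = hilbertOf x θ := by
  obtain ⟨K, hK⟩ := exists_lipschitzWith_vecSeries_etaMode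
  have h : hilbertIntegral (vecSeries etaMode) θ = vecSeries hilbertMode θ := by
    ext n
    rw [vecSeries_apply abs_hilbertMode_le, ← hilbertIntegral_etaMode]
    refine (hilbertIntegral_clm hK (evalL n) θ).symm.trans ?_
    simp only [evalL_apply, vecSeries_apply abs_etaMode_le, hilbertIntegral, hilbertIntegrand,
      smul_eq_mul, ← mul_sub]
    rw [mul_left_comm, ← intervalIntegral.integral_const_mul ((freq n)⁻¹ ^ 2)]
    congr 1
    refine intervalIntegral.integral_congr fun s _ => ?_
    ring
  exact (hilbertIntegral_clm hK (innerSL ℝ x) θ).trans (by rw [h]; rfl)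

theorem hasHilbertTransformAt_etaOf (x : EllTwo) (θ : ℝ) :
    HasHilbertTransformAt (etaOf x) (hilbertOf x θ) θ := by
  obtain ⟨K, hK⟩ := exists_lipschitzWith_vecSeries_etaMode
  rw [← hilbertIntegral_etaOf]
  exact hasHilbertTransformAt ((innerSL ℝ x).lipschitz.comp hK) θ

theorem hilbert_etaOf (x : EllTwo) (θ : ℝ) : hilbert (etaOf x) θ = hilbertOf x θ :=
  hilbert_eq (hasHilbertTransformAt_etaOf x θ)

theorem vecSeries_neg {g : ℕ → ℝ → ℝ} (h : ∀ n θ, g n (-θ) = -g n θ) (θ : ℝ) :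
    vecSeries g (-θ) = -vecSeries g θ := by
  simp only [vecSeries, h, mul_neg, neg_smul, tsum_neg]

theorem vecSeries_periodic {g : ℕ → ℝ → ℝ} {T : ℝ} (h : ∀ n, Function.Periodic (g n) T) :
    Function.Periodic (vecSeries g) T := by
  intro θ
  simp only [vecSeries, h _ θ]

theorem sin_periodic_natCast (k : ℕ) :
    Function.Periodic (fun θ => Real.sin (k * θ)) (2 * Real.pi) := by
  intro θ
  simp only [mul_add, Real.sin_add_nat_mul_two_pi]

theorem etaMode_periodic (n : ℕ) : Function.Periodic (etaMode n) (2 * Real.pi) := by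
  intro θ
  have h1 := sin_periodic_natCast (n + 1) θ
  have h3 := sin_periodic_natCast (n + 3) θ
  push_cast at h1 h3
  simp only [etaMode, h1, h3]

theorem velocityMode_periodic (n : ℕ) : Function.Periodic (velocityMode n) (2 * Real.pi) := by
  intro θ
  have h1 := sin_periodic_natCast (n + 1) θ
  have h3 := sin_periodic_natCast (n + 3) θ
  push_cast at h1 h3
  simp only [velocityMode, h1, h3]

theorem etaOf_neg (x : EllTwo) (θ : ℝ) : etaOf x (-θ) = -etaOf x θ := by
  rw [etaOf, vecSeries_neg (fun n θ => ?_), inner_neg_right, etaOf]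
  simp only [etaMode, mul_neg, Real.sin_neg]
  ring

theorem etaOf_periodic (x : EllTwo) : Function.Periodic (etaOf x) (2 * Real.pi) :=
  (vecSeries_periodic etaMode_periodic).comp (fun v => inner ℝ x v)

theorem velocityOf_periodic (x : EllTwo) : Function.Periodic (velocityOf x) (2 * Real.pi) :=
  (vecSeries_periodic velocityMode_periodic).comp (fun v => inner ℝ x v)

theorem velocityOf_zero (x : EllTwo) : velocityOf x 0 = 0 := by
  simp [velocityOf, vecSeries, velocityMode]

theorem tri_single_add_two {a b d : ℕ → ℝ} (ha : BddSeq a) (hb : BddSeq b) (hd : BddSeq d)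
    (k : ℕ) : tri a b d ha hb hd (lp.single 2 (k + 2) (1 : ℝ)) =
      a k • lp.single 2 k (1 : ℝ) + b (k + 2) • lp.single 2 (k + 4) (1 : ℝ)
        + d (k + 2) • lp.single 2 (k + 2) (1 : ℝ) := by
  refine EllTwo.ext_parity (fun n hn => ?_) (fun n => ?_)
  · rw [tri_apply_of_lt _ _ _ _ hn]
    simp only [lp.single_apply, lp.coeFn_add, Pi.add_apply, lp.coeFn_smul, Pi.smul_apply,
      Pi.single_apply, smul_eq_mul]
    by_cases h : n = k
    · subst h
      rw [if_neg (by omega : ¬ n = n + 4)]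
      simp
    · rw [if_neg (by omega : ¬ n = k + 4), if_neg (by omega : ¬ n + 2 = k + 2), if_neg h]
      by_cases h2 : n = k + 2
      · simp [h2]
      · simp [h2]
  · rw [tri_apply_add]
    simp only [lp.single_apply, lp.coeFn_add, Pi.add_apply, lp.coeFn_smul, Pi.smul_apply,
      Pi.single_apply, smul_eq_mul]
    have e1 : (n + 4 = k + 2) ↔ (n + 2 = k) := by omega
    have e2 : (n = k + 2) ↔ (n + 2 = k + 4) := by omega
    simp only [e1, e2]
    split_ifs <;> simp_all

theorem tri_single_of_lt {a b d : ℕ → ℝ} (ha : BddSeq a) (hb : BddSeq b) (hd : BddSeq d)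
    {k : ℕ} (hk : k < 2) : tri a b d ha hb hd (lp.single 2 k (1 : ℝ)) =
      b k • lp.single 2 (k + 2) (1 : ℝ) + d k • lp.single 2 k (1 : ℝ) := by
  refine EllTwo.ext_parity (fun n hn => ?_) (fun n => ?_)
  · rw [tri_apply_of_lt _ _ _ _ hn]
    simp only [lp.single_apply, lp.coeFn_add, Pi.add_apply, lp.coeFn_smul, Pi.smul_apply,
      Pi.single_apply, smul_eq_mul]
    rw [if_neg (by omega : ¬ n + 2 = k), if_neg (by omega : ¬ n = k + 2)]
    by_cases h : n = k
    · simp [h]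
    · simp [h]
  · rw [tri_apply_add]
    simp only [lp.single_apply, lp.coeFn_add, Pi.add_apply, lp.coeFn_smul, Pi.smul_apply,
      Pi.single_apply, smul_eq_mul]
    rw [if_neg (by omega : ¬ n + 4 = k), if_neg (by omega : ¬ n + 2 = k)]
    by_cases h : n = k
    · simp [h]
    · simp [h]

/-- This translates the sequence equation into the partial differential equation. Both sides are
bounded linear in `z`, so it suffices to test unit sequences, where the mode identities apply.
Weight `3` appears because profiles carry `(freq n)⁻²` and the generator costs one further power. -/
theorem inner_generator_etaMode (z : EllTwo) (θ : ℝ) :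
    inner ℝ (generator 3 z) (vecSeries etaMode θ) =
      -(1 / 2 * Real.sin (2 * θ) * inner ℝ (lower 1 z) (vecSeries etaModeDeriv θ)
        - Real.cos (2 * θ) * etaOf (lower 1 z) θ
        + Real.sin (2 * θ) * hilbertOf (lower 1 z) θ
        - 2 * Real.cos (2 * θ) * velocityOf (lower 1 z) θ) := by
  let P : (ℕ → ℝ → ℝ) → EllTwo →L[ℝ] ℝ := fun g => innerSL ℝ (vecSeries g θ)
  have hP : ∀ g x, inner ℝ x (vecSeries g θ) = P g x := fun g x => real_inner_comm _ _
  have hPs : ∀ g : ℕ → ℝ → ℝ, (∀ n θ, |g n θ| ≤ 1) → ∀ n,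
      P g (lp.single 2 n (1 : ℝ)) = (freq n)⁻¹ ^ 2 * g n θ := by
    intro g hg n
    rw [← hP, inner_single_vecSeries hg]
  have key : P etaMode ∘L generator 3 =
      -((1 / 2 * Real.sin (2 * θ)) • P etaModeDeriv - Real.cos (2 * θ) • P etaMode
        + Real.sin (2 * θ) • P hilbertMode
        - (2 * Real.cos (2 * θ)) • P velocityMode) ∘L lower 1 := by
    refine EllTwo.clm_ext fun n => ?_
    simp only [ContinuousLinearMap.comp_apply, neg_apply, add_apply,
      sub_apply, smul_apply, lower_single, map_smul,
      hPs _ abs_etaMode_le, hPs _ abs_etaModeDeriv_le, hPs _ abs_hilbertMode_le,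
      hPs _ abs_velocityMode_le, smul_eq_mul]
    have hrhs : ∀ n, -((freq n)⁻¹ ^ 1 * (1 / 2 * Real.sin (2 * θ) * ((freq n)⁻¹ ^ 2 * etaModeDeriv n θ)
        - Real.cos (2 * θ) * ((freq n)⁻¹ ^ 2 * etaMode n θ)
        + Real.sin (2 * θ) * ((freq n)⁻¹ ^ 2 * hilbertMode n θ)
        - 2 * Real.cos (2 * θ) * ((freq n)⁻¹ ^ 2 * velocityMode n θ))) =
        -(freq n)⁻¹ ^ 3 * (1 / 2 * Real.sin (2 * θ) * etaModeDeriv n θ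
          - Real.cos (2 * θ) * etaMode n θ + Real.sin (2 * θ) * hilbertMode n θ
          - 2 * Real.cos (2 * θ) * velocityMode n θ) := fun n => by ring
    have hb : ∀ n, -coupling n * ratio n ^ 3 * (freq (n + 2))⁻¹ * ((freq (n + 2))⁻¹ ^ 2 *
        etaMode (n + 2) θ) = -(freq n)⁻¹ ^ 3 * (coupling n * etaMode (n + 2) θ) := by
      intro n
      have := ratio_pos n
      have := freq_pos n
      rw [freq_add_two_eq]
      field_simp
    have ha : ∀ n, coupling n * (freq n)⁻¹ * (ratio n)⁻¹ ^ 3 * ((freq n)⁻¹ ^ 2 * etaMode n θ) =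
        (freq (n + 2))⁻¹ ^ 3 * (coupling n * etaMode n θ) := by
      intro n
      rw [freq_add_two_eq, mul_inv]
      ring
    refine Eq.trans ?_ (hrhs n).symm
    rcases lt_or_ge n 2 with hn | hn
    · rw [generator, tri_single_of_lt _ _ _ hn]
      simp only [map_add, map_smul, hPs _ abs_etaMode_le, smul_eq_mul]
      rw [hb]
      interval_cases n
      · rw [linearized_etaMode_zero]; ring
      · rw [linearized_etaMode_one]; ring
    · obtain ⟨k, rfl⟩ := Nat.exists_eq_add_of_le' hn
      rw [generator, tri_single_add_two]
      simp only [map_add, map_smul, hPs _ abs_etaMode_le, smul_eq_mul]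
      have hb' := hb (k + 2)
      simp only [show k + 2 + 2 = k + 4 from rfl] at hb'
      rw [ha, hb', linearized_etaMode_add_two]
      ring
  simp only [etaOf, hilbertOf, velocityOf, hP]
  refine (congrArg (fun L => L z) key).trans ?_
  simp

theorem inner_generator_eq (z : EllTwo) (θ : ℝ) :
    inner ℝ (generator 3 z) (vecSeries etaMode θ) =
      -linearizedOp (etaOf (lower 1 z)) (velocityOf (lower 1 z)) θ := by
  rw [inner_generator_etaMode, linearizedOp, (hasDerivAt_etaOf _ θ).deriv, hilbert_etaOf,
    vecSeries_etaModeDeriv, inner_smul_right, sineOf]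

/-- The series solution is a classical odd solution. -/
theorem isClassicalOddSolution_etaOf {T : ℝ} {η₀ : Sobolev 1} {z : ℝ → EllTwo}
    (hz : Continuous z) (hd : ∀ t, HasDerivAt (fun t => lower 1 (z t)) (generator 3 (z t)) t)
    (h0 : Represents η₀ (etaOf (lower 1 (z 0)))) :
    IsClassicalOddSolution T η₀ (fun t => etaOf (lower 1 (z t)))
      (fun t => velocityOf (lower 1 (z t))) where
  contDiffOn := by
    have hx : ContDiff ℝ 1 fun t => lower 1 (z t) := by
      rw [contDiff_one_iff_deriv]
      refine ⟨fun t => (hd t).differentiableAt, ?_⟩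
      rw [show deriv (fun t => lower 1 (z t)) = fun t => generator 3 (z t) from
        funext fun t => (hd t).deriv]
      exact (generator 3).continuous.comp hz
    -- The solution is an inner product of a `C¹` function of `t` with a `C¹` function of `θ`, so
    -- joint regularity is immediate.
    exact ((hx.comp contDiff_fst).inner ℝ (contDiff_vecSeries_etaMode.comp contDiff_snd)).contDiffOn
  periodic t _ := ⟨etaOf_periodic _, velocityOf_periodic _⟩
  odd t _ θ := etaOf_neg _ θ
  hasHilbert t _ θ := by
    rw [hilbert_etaOf]
    exact hasHilbertTransformAt_etaOf _ θ
  evolution t _ θ := by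
    rw [← inner_generator_eq]
    have h := (hd t).inner ℝ (hasDerivAt_const t (vecSeries etaMode θ))
    simp only [inner_zero_right, zero_add] at h
    exact h.hasDerivWithinAt
  velocity t _ θ := by
    rw [hilbert_etaOf]
    exact hasDerivAt_velocityOf _ θ
  initial := h0
  gauge t _ := velocityOf_zero _

end Profiles

/-! ### Sobolev regularity, the weighted norm and the coefficients of the profiles. -/

section Regularity

theorem sineSeries_ae_eq_sineOf (x : EllTwo) :
    sineSeries 0 (lower 2 x) =ᵐ[torusMeasure] sineOf x := by
  filter_upwards [sineSeries_ae_eq 0 x] with θ hθ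
  rw [hθ, sineOf, ← (hasSum_inner_vecSeries abs_sineMode_le x θ).tsum_eq]
  simp [sineMode]

theorem ae_sin_ne_zero : ∀ᵐ θ ∂torusMeasure, Real.sin θ ≠ 0 := by
  refine ae_restrict_of_ae ?_
  have : {θ : ℝ | ¬ Real.sin θ ≠ 0} = range fun n : ℤ => (n : ℝ) * Real.pi := by
    ext θ
    simp [Real.sin_eq_zero_iff]
  rw [ae_iff, this]
  exact (countable_range _).measure_zero _

theorem ae_comp_neg {p : ℝ → Prop} (h : ∀ᵐ θ ∂torusMeasure, p θ) :
    ∀ᵐ θ ∂torusMeasure, p (-θ) := by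
  rw [torusMeasure, ← restrict_Ioo_eq_restrict_Ioc, ae_restrict_iff' measurableSet_Ioo] at h ⊢
  have h' := (Measure.measurePreserving_neg (volume : Measure ℝ)).quasiMeasurePreserving.ae h
  filter_upwards [h'] with θ hθ hmem
  exact hθ ⟨by linarith [hmem.2], by linarith [hmem.1]⟩

theorem two_sqrt_pi_ne_zero : 2 * Real.sqrt Real.pi ≠ 0 := by
  have := Real.pi_pos
  positivity

theorem rhoHalf_mul_deriv_etaOf (x : EllTwo) :
    (fun θ => rhoHalf θ * deriv (etaOf x) θ) =ᵐ[torusMeasure]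
      fun θ => (2 * Real.sqrt Real.pi)⁻¹ * sineOf x θ := by
  filter_upwards [ae_sin_ne_zero] with θ hθ
  have := two_sqrt_pi_ne_zero
  rw [(hasDerivAt_etaOf x θ).deriv, rhoHalf]
  field_simp

theorem represents_sobolevSeries {m : ℕ} (hm : 2 ≤ m) (y : EllTwo) :
    Represents ((2 * Real.sqrt Real.pi)⁻¹ • sobolevSeries m y)
      (fun θ => rhoHalf θ * deriv (etaOf (lower (m - 2) y)) θ) := by
  have e : wderiv ((2 * Real.sqrt Real.pi)⁻¹ • sobolevSeries m y) 0 =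
      (2 * Real.sqrt Real.pi)⁻¹ • sineSeries 0 (lower 2 (lower (m - 2) y)) := by
    rw [lower_lower, show 2 + (m - 2) = m by omega, ← wderiv_sobolevSeries_zero]
    rfl
  rw [Represents, e]
  filter_upwards [Lp.coeFn_smul (2 * Real.sqrt Real.pi)⁻¹ (sineSeries 0 (lower 2 (lower (m - 2) y))),
    sineSeries_ae_eq_sineOf (lower (m - 2) y), rhoHalf_mul_deriv_etaOf (lower (m - 2) y)]
    with θ h1 h2 h3
  rw [h1, h3, Pi.smul_apply, h2, smul_eq_mul]

theorem integral_mul_deriv_periodic {f f' φ : ℝ → ℝ} (hf : ∀ θ, HasDerivAt f (f' θ) θ)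
    (hf' : Continuous f') (hfp : Function.Periodic f (2 * Real.pi)) (hφ : ContDiff ℝ 1 φ)
    (hp : Function.Periodic φ (2 * Real.pi)) :
    ∫ θ in -Real.pi..Real.pi, f θ * deriv φ θ = -∫ θ in -Real.pi..Real.pi, f' θ * φ θ := by
  rw [intervalIntegral.integral_mul_deriv_eq_deriv_mul (fun θ _ => hf θ)
    (fun θ _ => (hφ.differentiable (by norm_num) θ).hasDerivAt)
    (hf'.intervalIntegrable _ _) ((hφ.continuous_deriv le_rfl).intervalIntegrable _ _)]
  have e1 : φ Real.pi = φ (-Real.pi) := by rw [← hp (-Real.pi)]; congr 1; ring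
  have e2 : f Real.pi = f (-Real.pi) := by rw [← hfp (-Real.pi)]; congr 1; ring
  rw [e1, e2, sub_self, zero_sub]

theorem continuous_etaOf (x : EllTwo) : Continuous (etaOf x) :=
  continuous_iff_continuousAt.2 fun θ => (hasDerivAt_etaOf x θ).continuousAt

theorem continuous_sin_mul_sineOf (x : EllTwo) : Continuous fun θ => Real.sin θ * sineOf x θ :=
  Real.continuous_sin.mul (continuous_sineOf x)

/-- The profile `etaOf x` as an element of `H¹`. -/
def etaSobolev (x : EllTwo) : Sobolev 1 :=
  ⟨WithLp.toLp 2 ![(memLp_of_continuous (continuous_etaOf x)).toLp _,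
    (memLp_of_continuous (continuous_sin_mul_sineOf x)).toLp _], by
    intro k φ hφ hp
    fin_cases k
    · simp
    · simp only [Fin.mk_one, Fin.isValue, Matrix.cons_val_zero,
        Matrix.cons_val_one, iteratedDeriv_one, pow_one, neg_one_mul]
      have h := integral_mul_deriv_periodic (hasDerivAt_etaOf x) (continuous_sin_mul_sineOf x)
        (etaOf_periodic x) (hφ.of_le (by exact_mod_cast le_top)) hp
      rw [← integral_torusMeasure, ← integral_torusMeasure] at h
      refine (integral_congr_ae ?_).trans (h.trans (congrArg Neg.neg (integral_congr_ae ?_)))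
      · filter_upwards [(memLp_of_continuous (continuous_etaOf x)).coeFn_toLp] with θ hθ
        rw [hθ]
      · filter_upwards [(memLp_of_continuous (continuous_sin_mul_sineOf x)).coeFn_toLp] with θ hθ
        rw [hθ]⟩

theorem represents_etaSobolev (x : EllTwo) : Represents (etaSobolev x) (etaOf x) :=
  (memLp_of_continuous (continuous_etaOf x)).coeFn_toLp

theorem wderiv_etaSobolev_one (x : EllTwo) :
    wderiv (etaSobolev x) 1 =ᵐ[torusMeasure] fun θ => Real.sin θ * sineOf x θ :=
  (memLp_of_continuous (continuous_sin_mul_sineOf x)).coeFn_toLp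

theorem etaSobolev_mem_HDW (x : EllTwo) : etaSobolev x ∈ HDW := by
  refine ⟨?_, ?_⟩
  · have h := represents_etaSobolev x
    filter_upwards [h, ae_comp_neg h] with θ h1 h2
    rw [h1, h2, etaOf_neg]
  · have hsq : Integrable (fun θ => sineOf x θ ^ 2) torusMeasure :=
      (memLp_of_continuous (continuous_sineOf x)).integrable_sq
    refine lt_of_le_of_lt (le_of_eq (lintegral_congr_ae ?_)) hsq.lintegral_lt_top
    filter_upwards [wderiv_etaSobolev_one x, ae_sin_ne_zero] with θ h1 h2
    rw [h1]
    congr 1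
    field_simp

/-- Almost everywhere `ρ^{1/2}` cancels the factor `sin θ` in the derivative. The weighted norm is
thus the `L²` norm of a sine series, and continuity in time follows from continuity in `ℓ²`. -/
theorem hdwNorm_etaSobolev_sub (x x' : EllTwo) :
    hdwNorm (etaSobolev x - etaSobolev x') =
      ENNReal.ofReal ‖(2 * Real.sqrt Real.pi)⁻¹ • sineSeries 0 (lower 2 (x - x'))‖ := by
  rw [hdwNorm, Lp.norm_def, ENNReal.ofReal_toReal (Lp.eLpNorm_ne_top _)]
  refine eLpNorm_congr_ae ?_
  have e : wderiv (etaSobolev x - etaSobolev x') 1 =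
      wderiv (etaSobolev x) 1 - wderiv (etaSobolev x') 1 := rfl
  rw [e]
  filter_upwards [Lp.coeFn_sub (wderiv (etaSobolev x) 1) (wderiv (etaSobolev x') 1),
    wderiv_etaSobolev_one x, wderiv_etaSobolev_one x', ae_sin_ne_zero,
    Lp.coeFn_smul (2 * Real.sqrt Real.pi)⁻¹ (sineSeries 0 (lower 2 (x - x'))),
    sineSeries_ae_eq_sineOf (x - x')] with θ h1 h2 h3 h4 h5 h6
  rw [h1, h5, Pi.sub_apply, Pi.smul_apply, h2, h3, h6, rhoHalf, smul_eq_mul, sineOf, sineOf, sineOf,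
    inner_sub_left]
  have := two_sqrt_pi_ne_zero
  field_simp

theorem continuousInHDW_etaOf {T : ℝ} {x : ℝ → EllTwo} (hx : Continuous x) :
    ContinuousInHDW T fun t => etaOf (x t) := by
  refine ⟨fun t => etaSobolev (x t), fun t _ => ⟨etaSobolev_mem_HDW _, represents_etaSobolev _⟩,
    fun t₀ _ => ?_⟩
  simp only [hdwNorm_etaSobolev_sub]
  have hc : Continuous fun t => ENNReal.ofReal
      ‖(2 * Real.sqrt Real.pi)⁻¹ • sineSeries 0 (lower 2 (x t - x t₀))‖ :=
    ENNReal.continuous_ofReal.comp (by fun_prop)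
  have h := hc.tendsto t₀
  simp only [sub_self, map_zero, smul_zero, norm_zero, ENNReal.ofReal_zero] at h
  exact h.mono_left nhdsWithin_le_nhds

theorem integral_sineOf_mul_sin (x : EllTwo) (n : ℕ) :
    ∫ θ, sineOf x θ * Real.sin (freq n * θ) ∂torusMeasure = Real.pi * ((freq n)⁻¹ ^ 2 * x n) := by
  have h := inner_modeLp_sineSeries 0 n (lower 2 x)
  rw [inner_modeLp] at h
  rw [lower_apply] at h
  rw [← h]
  refine integral_congr_ae ?_
  filter_upwards [sineSeries_ae_eq_sineOf x] with θ hθ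
  rw [hθ, add_zero]

theorem hasDerivAt_eTilde (n : ℕ) (θ : ℝ) :
    HasDerivAt (eTilde (n + 1)) (-2 * (Real.sin θ * Real.sin (freq n * θ))) θ := by
  have h := (hasDerivAt_etaMode n θ).const_mul (-2)
  rw [etaModeDeriv_eq, sineMode] at h
  convert! h using 1
  funext φ
  simp only [eTilde, etaMode]
  push_cast
  rw [show (n : ℝ) + 1 + 2 = n + 3 by ring]
  ring

/-- The two factors `sin θ` cancel `sin² θ` in the weight, leaving `-1/(2π)` times the sine
coefficient, and that coefficient contributes `π`. -/
theorem coeff_etaOf (x : ℝ → EllTwo) (n : ℕ) (t : ℝ) :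
    coeff (fun t => etaOf (x t)) (n + 1) t = -(1 / 2) * ((freq n)⁻¹ ^ 2 * x t n) := by
  have h : coeff (fun t => etaOf (x t)) (n + 1) t =
      ∫ θ, -(1 / (2 * Real.pi)) * (sineOf (x t) θ * Real.sin (freq n * θ)) ∂torusMeasure := by
    refine integral_congr_ae ?_
    filter_upwards [ae_sin_ne_zero] with θ hθ
    rw [(hasDerivAt_etaOf (x t) θ).deriv, (hasDerivAt_eTilde n θ).deriv, rho]
    have := Real.pi_ne_zero
    field_simp
    ring
  rw [h, integral_const_mul, integral_sineOf_mul_sin]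
  have := Real.pi_ne_zero
  field_simp

end Regularity

/-! ### Expansion of the initial datum in the modes. -/

section InitialData

theorem integral_wderiv_mul {ξ : Sobolev 1} {φ φ' : ℝ → ℝ}
    (hφ : ContDiff ℝ ((⊤ : ℕ∞) : WithTop ℕ∞) φ) (hp : Function.Periodic φ (2 * Real.pi))
    (hd : ∀ θ, HasDerivAt φ (φ' θ) θ) :
    ∫ θ, wderiv ξ 0 θ * φ' θ ∂torusMeasure = -∫ θ, wderiv ξ 1 θ * φ θ ∂torusMeasure := by
  have h := ξ.2 1 φ hφ hp
  simp only [Fin.val_one, iteratedDeriv_one, pow_one, neg_one_mul] at h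
  rw [show deriv φ = φ' from funext fun θ => (hd θ).deriv] at h
  exact h

/-- Test the weak derivative against the constant function one. -/
theorem integral_wderiv_one (ξ : Sobolev 1) : ∫ θ, wderiv ξ 1 θ ∂torusMeasure = 0 := by
  have h := integral_wderiv_mul (ξ := ξ) (φ := fun _ => 1) contDiff_const (fun _ => rfl)
    (fun θ => hasDerivAt_const θ 1)
  simp only [mul_zero, integral_zero, mul_one] at h
  linarith

theorem cos_periodic_intCast (j : ℤ) :
    Function.Periodic (fun θ => Real.cos (j * θ)) (2 * Real.pi) := by
  intro θ
  simp only [mul_add, Real.cos_add_int_mul_two_pi]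

theorem integral_odd_torus {f : ℝ → ℝ} (h : ∀ᵐ θ ∂torusMeasure, f (-θ) = -f θ) :
    ∫ θ, f θ ∂torusMeasure = 0 := by
  have e : ∫ θ, f (-θ) ∂torusMeasure = ∫ θ, f θ ∂torusMeasure := by
    rw [integral_torusMeasure, integral_torusMeasure, intervalIntegral.integral_comp_neg, neg_neg]
  have e2 : ∫ θ, f (-θ) ∂torusMeasure = -∫ θ, f θ ∂torusMeasure := by
    rw [integral_congr_ae h, integral_neg]
  linarith

/-- An odd element of `H¹` whose derivative has vanishing cosine coefficients is zero. -/
theorem wderiv_zero_ae_eq_zero {ξ : Sobolev 1}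
    (hodd : ∀ᵐ θ ∂torusMeasure, wderiv ξ 0 (-θ) = -wderiv ξ 0 θ)
    (hcos : ∀ j : ℤ, ∫ θ, wderiv ξ 1 θ * Real.cos (j * θ) ∂torusMeasure = 0) :
    (wderiv ξ 0 : ℝ → ℝ) =ᵐ[torusMeasure] 0 := by
  refine ae_eq_zero_of_integral_cos_sin (Lp.memLp _) (fun j => integral_odd_torus ?_) fun j => ?_
  · filter_upwards [hodd] with θ hθ
    rw [hθ, mul_neg, Real.cos_neg, neg_mul]
  · rcases eq_or_ne j 0 with rfl | hj
    · simp
    · have h := integral_wderiv_mul (ξ := ξ) (φ := fun θ => Real.cos (j * θ)) (by fun_prop)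
        (cos_periodic_intCast j) (hasDerivAt_cos_mul j)
      rw [hcos, neg_zero] at h
      have e : ∀ θ, wderiv ξ 0 θ * -(j * Real.sin (j * θ)) =
          -(j : ℝ) * (wderiv ξ 0 θ * Real.sin (j * θ)) := fun θ => by ring
      simp only [e] at h
      rw [integral_const_mul, mul_eq_zero] at h
      exact h.resolve_left (neg_ne_zero.2 (by exact_mod_cast hj))

theorem iteratedDeriv_sin_mul_add (a c : ℝ) (k : ℕ) :
    iteratedDeriv k (fun θ => Real.sin (a * θ + c)) =
      fun θ => a ^ k * Real.sin (a * θ + (c + k * (Real.pi / 2))) := by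
  induction k with
  | zero => simp
  | succ k ih =>
    rw [iteratedDeriv_succ, ih]
    funext θ
    have hd : HasDerivAt (fun θ => a ^ k * Real.sin (a * θ + (c + k * (Real.pi / 2))))
        (a ^ k * (a * Real.cos (a * θ + (c + k * (Real.pi / 2))))) θ := by
      have := ((((hasDerivAt_id θ).const_mul a).add_const (c + k * (Real.pi / 2))).sin).const_mul
        (a ^ k)
      simpa [mul_comm] using this
    rw [hd.deriv]
    push_cast
    rw [show a * θ + (c + ((k : ℝ) + 1) * (Real.pi / 2)) =
      a * θ + (c + k * (Real.pi / 2)) + Real.pi / 2 by ring, Real.sin_add_pi_div_two]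
    ring

/-- The sine coefficients of an element of `H^m` decay. -/
theorem summable_sq_sine_coeff {m : ℕ} (U : Sobolev m) :
    Summable fun n => (freq n ^ m *
      ∫ θ, wderiv U 0 θ * Real.sin (freq n * θ) ∂torusMeasure) ^ 2 := by
  have hpi := Real.pi_pos
  have hbessel := ((orthonormal_modeLp (-(m * (Real.pi / 2)))).inner_products_summable
    (x := wderiv U (Fin.last m))).mul_left Real.pi
  refine hbessel.congr fun n => ?_
  -- The phase `-mπ/2` is chosen so that the `m`-th derivative of the test function is exactly `freq
  -- n ^ m` times the unshifted sine; Bessel is applied to the shifted orthonormal family.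
  have h := U.2 (Fin.last m) (fun θ => Real.sin (freq n * θ + -(m * (Real.pi / 2))))
    (by fun_prop) (by
      intro θ
      have : freq n * (θ + 2 * Real.pi) + -(m * (Real.pi / 2)) =
          freq n * θ + -(m * (Real.pi / 2)) + (n + 2 : ℕ) * (2 * Real.pi) := by
        unfold freq; push_cast; ring
      simp only [this, Real.sin_add_nat_mul_two_pi])
  rw [iteratedDeriv_sin_mul_add] at h
  simp only [Fin.val_last, neg_add_cancel, add_zero] at h
  have h' : freq n ^ m * ∫ θ, wderiv U 0 θ * Real.sin (freq n * θ) ∂torusMeasure =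
      (-1) ^ m * inner ℝ (modeLp (-(m * (Real.pi / 2))) n) (wderiv U (Fin.last m)) := by
    rw [inner_modeLp, ← integral_const_mul]
    refine Eq.trans ?_ h
    refine integral_congr_ae (Eventually.of_forall fun θ => ?_)
    simp only [wderiv]
    ring
  rw [h', mul_pow, ← pow_mul, mul_comm m 2, pow_mul, neg_one_sq, one_pow, one_mul,
    inner_smul_left, norm_mul, mul_pow]
  simp only [conj_trivial, norm_inv, Real.norm_eq_abs, abs_of_nonneg (Real.sqrt_nonneg _), inv_pow,
    Real.sq_sqrt hpi.le, sq_abs]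
  rw [← mul_assoc, mul_inv_cancel₀ hpi.ne', one_mul]

theorem integral_mul_sin_intCast_eq_zero {h : ℝ → ℝ}
    (h1 : ∫ θ, h θ * Real.sin θ ∂torusMeasure = 0)
    (h2 : ∀ n : ℕ, ∫ θ, h θ * Real.sin (freq n * θ) ∂torusMeasure = 0) (j : ℤ) :
    ∫ θ, h θ * Real.sin (j * θ) ∂torusMeasure = 0 := by
  have hnat : ∀ k : ℕ, ∫ θ, h θ * Real.sin (k * θ) ∂torusMeasure = 0 := by
    intro k
    rcases k with _ | _ | n
    · simp
    · simpa using h1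
    · have := h2 n
      simp only [freq] at this
      push_cast
      rw [← this]
      refine integral_congr_ae (Eventually.of_forall fun θ => ?_)
      simp only [add_assoc]
      norm_num
  rcases Int.eq_nat_or_neg j with ⟨k, rfl | rfl⟩
  · exact_mod_cast hnat k
  · have := hnat k
    simp only [Int.cast_neg, Int.cast_natCast, neg_mul, Real.sin_neg, mul_neg, integral_neg, this,
      neg_zero]

/-- Only the sine coefficients of the weighted derivative are matched. Its cosine coefficients need
no separate treatment: an odd function is determined by the cosine coefficients of its derivative,
and `sin θ cos (jθ)` is a combination of sines. -/
theorem exists_represents_etaOf {m : ℕ} (hm : 2 ≤ m) {η₀ : Sobolev 1} (hη₀ : η₀ ∈ HDW)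
    (hreg : MemSobolev m fun θ => rhoHalf θ * wderiv η₀ 1 θ) :
    ∃ y : EllTwo, Represents η₀ (etaOf (lower (m - 2) y)) := by
  obtain ⟨U, hU⟩ := hreg
  have hpi := Real.pi_pos
  have hfreq := fun n => (freq_pos n).ne'
  set κ := 2 * Real.sqrt Real.pi with hκ
  have hκ0 : κ ≠ 0 := two_sqrt_pi_ne_zero
  -- `κ` undoes the constant in `ρ^{1/2}`, and `1/π` normalizes the sine coefficient.
  let y : EllTwo := ⟨fun n => κ / Real.pi * (freq n ^ m *
      ∫ θ, wderiv U 0 θ * Real.sin (freq n * θ) ∂torusMeasure),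
    memEllTwo_of_summable_sq (by
      simpa only [mul_pow] using ((summable_sq_sine_coeff U).mul_left ((κ / Real.pi) ^ 2)))⟩
  have hy : ∀ n, y n = κ / Real.pi * (freq n ^ m *
      ∫ θ, wderiv U 0 θ * Real.sin (freq n * θ) ∂torusMeasure) := fun n => rfl
  refine ⟨y, ?_⟩
  set x := lower (m - 2) y with hx
  have hUint : ∀ ψ : ℝ → ℝ, Continuous ψ →
      Integrable (fun θ => wderiv U 0 θ * ψ θ) torusMeasure :=
    fun ψ hψ => integrable_mul_of_continuous _ hψ
  have hSint : ∀ ψ : ℝ → ℝ, Continuous ψ →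
      Integrable (fun θ => sineOf x θ * ψ θ) torusMeasure :=
    fun ψ hψ => (memLp_of_continuous ((continuous_sineOf x).mul hψ)).integrable (by norm_num)
  have hdiff : wderiv (η₀ - etaSobolev x) 1 =ᵐ[torusMeasure]
      fun θ => Real.sin θ * (κ * wderiv U 0 θ - sineOf x θ) := by
    have e : wderiv (η₀ - etaSobolev x) 1 = wderiv η₀ 1 - wderiv (etaSobolev x) 1 := rfl
    rw [e]
    filter_upwards [Lp.coeFn_sub (wderiv η₀ 1) (wderiv (etaSobolev x) 1), hU,
      wderiv_etaSobolev_one x, ae_sin_ne_zero] with θ h1 h2 h3 h4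
    rw [h1, Pi.sub_apply, h2, h3, rhoHalf, ← hκ]
    field_simp
  have hsin : ∀ j : ℤ, ∫ θ, (κ * wderiv U 0 θ - sineOf x θ) * Real.sin (j * θ) ∂torusMeasure
      = 0 := by
    refine integral_mul_sin_intCast_eq_zero ?_ fun n => ?_
    -- The modes start at frequency two, so `sin θ` is not matched by the choice of `y`. Its
    -- coefficient is the mean of a weak derivative, hence zero.
    · rw [← integral_wderiv_one (η₀ - etaSobolev x)]
      refine integral_congr_ae ?_
      filter_upwards [hdiff] with θ hθ
      rw [hθ, mul_comm]
    · have e : ∀ θ, (κ * wderiv U 0 θ - sineOf x θ) * Real.sin (freq n * θ) =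
          κ * (wderiv U 0 θ * Real.sin (freq n * θ)) - sineOf x θ * Real.sin (freq n * θ) :=
        fun θ => by ring
      simp only [e]
      rw [integral_sub ((hUint _ (by fun_prop)).const_mul _) (hSint _ (by fun_prop)),
        integral_const_mul, integral_sineOf_mul_sin, hx, lower_apply, hy]
      have hp : (freq n)⁻¹ ^ 2 * ((freq n)⁻¹ ^ (m - 2) * freq n ^ m) = 1 := by
        rw [← mul_assoc, ← pow_add, show 2 + (m - 2) = m by omega, ← mul_pow,
          inv_mul_cancel₀ (hfreq n), one_pow]
      have hp2 : Real.pi * (κ / Real.pi) = κ := mul_div_cancel₀ _ hpi.ne'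
      generalize (∫ θ, wderiv U 0 θ * Real.sin (freq n * θ) ∂torusMeasure) = I
      linear_combination (-I * Real.pi * (κ / Real.pi)) * hp - I * hp2
  have hodd : ∀ᵐ θ ∂torusMeasure,
      wderiv (η₀ - etaSobolev x) 0 (-θ) = -wderiv (η₀ - etaSobolev x) 0 θ := by
    have e : wderiv (η₀ - etaSobolev x) 0 = wderiv η₀ 0 - wderiv (etaSobolev x) 0 := rfl
    have h := Lp.coeFn_sub (wderiv η₀ 0) (wderiv (etaSobolev x) 0)
    rw [e]
    filter_upwards [h, ae_comp_neg h, hη₀.1, (etaSobolev_mem_HDW x).1] with θ h1 h2 h3 h4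
    rw [h1, h2, Pi.sub_apply, Pi.sub_apply, h3, h4]
    ring
  have hzero := wderiv_zero_ae_eq_zero hodd fun j => by
    have e : ∫ θ, wderiv (η₀ - etaSobolev x) 1 θ * Real.cos (j * θ) ∂torusMeasure =
        ∫ θ, (1 / 2 * ((κ * wderiv U 0 θ - sineOf x θ) * Real.sin ((j + 1 : ℤ) * θ)) -
          1 / 2 * ((κ * wderiv U 0 θ - sineOf x θ) * Real.sin ((j - 1 : ℤ) * θ))) ∂torusMeasure := by
      refine integral_congr_ae ?_
      filter_upwards [hdiff] with θ hθ
      rw [hθ]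
      push_cast
      rw [add_mul (j : ℝ), sub_mul (j : ℝ), Real.sin_add, Real.sin_sub, one_mul]
      ring
    have hint : ∀ k : ℤ, Integrable
        (fun θ => (κ * wderiv U 0 θ - sineOf x θ) * Real.sin (k * θ)) torusMeasure := by
      intro k
      refine (((hUint (fun θ => Real.sin (k * θ)) (by fun_prop)).const_mul κ).sub
        (hSint (fun θ => Real.sin (k * θ)) (by fun_prop))).congr (Eventually.of_forall fun θ => ?_)
      simp only [Pi.sub_apply]
      ring
    rw [e, integral_sub ((hint _).const_mul _) ((hint _).const_mul _), integral_const_mul,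
      integral_const_mul, hsin, hsin]
    ring
  have e : wderiv (η₀ - etaSobolev x) 0 = wderiv η₀ 0 - wderiv (etaSobolev x) 0 := rfl
  rw [e] at hzero
  show (wderiv η₀ 0 : ℝ → ℝ) =ᵐ[torusMeasure] etaOf x
  filter_upwards [hzero, Lp.coeFn_sub (wderiv η₀ 0) (wderiv (etaSobolev x) 0),
    represents_etaSobolev x] with θ h1 h2 h3
  rw [h1, Pi.sub_apply, h3] at h2
  simp only [Pi.zero_apply] at h2
  linarith

end InitialData

/-! ### Energy argument for the system of plain sine coefficients. -/

section Hierarchy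

/-- Coefficient of the mode `i` in the equation of the mode `i + 2`. -/
def upCoeff (i : ℝ) : ℝ := (i - 2) ^ 2 / (4 * i)

/-- Coefficient of the mode `i` in the equation of the mode `i - 2`. -/
def downCoeff (i : ℝ) : ℝ := i / 4 - 1 / i

/-- The equations for the sine coefficients of an odd solution. -/
def hierarchyRHS (a : ℕ → ℝ) : ℕ → ℝ
  | 0 => 0
  | 1 => 3 / 4 * a 1 + downCoeff 3 * a 3
  | k + 2 => -(upCoeff k * a k) + downCoeff (k + 4) * a (k + 4)

/-- Each product of neighbours `a_i a_{i+2}` receives `downCoeff` from the lower equation and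
`-upCoeff` from the upper one. The two top products lack their upper equation, so their `upCoeff`
terms are added back as the boundary flux. -/
theorem sum_mul_hierarchyRHS {a : ℕ → ℝ} (h0 : a 0 = 0) (N : ℕ) :
    ∑ k ∈ Finset.range (N + 1), a (k + 1) * hierarchyRHS a (k + 1) =
      3 / 4 * a 1 ^ 2 + ∑ k ∈ Finset.range (N + 1),
        (downCoeff (k + 3) - upCoeff (k + 1)) * (a (k + 1) * a (k + 3)) +
      upCoeff (N + 1) * (a (N + 1) * a (N + 3)) + upCoeff N * (a N * a (N + 2)) := by
  induction N with
  | zero =>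
    simp [hierarchyRHS, h0]
    ring
  | succ N ih =>
    rw [Finset.sum_range_succ, ih, Finset.sum_range_succ _ (N + 1)]
    simp only [hierarchyRHS]
    push_cast
    rw [show (N : ℝ) + 1 + 3 = N + 4 by ring, show (N : ℝ) + 1 + 1 = N + 2 by ring]
    simp only [show N + 1 + 3 = N + 4 from rfl, show N + 1 + 2 = N + 3 from rfl,
      show N + 1 + 1 = N + 2 from rfl]
    ring

/-- Both coefficients grow like a quarter of the index, and the growth cancels in the difference
`3/2 - 1/(k+3) - 1/(k+1)`. -/
theorem abs_down_sub_up_le (k : ℕ) :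
    |downCoeff ((k : ℝ) + 3) - upCoeff ((k : ℝ) + 1)| ≤ 3 / 2 := by
  have hk := k.cast_nonneg (α := ℝ)
  have e : downCoeff ((k : ℝ) + 3) - upCoeff ((k : ℝ) + 1) =
      3 / 2 - 1 / ((k : ℝ) + 3) - 1 / ((k : ℝ) + 1) := by
    unfold downCoeff upCoeff
    field_simp
    ring
  have h1 : 1 / ((k : ℝ) + 1) ≤ 1 := by rw [div_le_one (by linarith)]; linarith
  have h3 : 1 / ((k : ℝ) + 3) ≤ 1 := by rw [div_le_one (by linarith)]; linarith
  have h1' : 0 ≤ 1 / ((k : ℝ) + 1) := by positivity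
  have h3' : 0 ≤ 1 / ((k : ℝ) + 3) := by positivity
  rw [e, abs_le]
  constructor <;> linarith

theorem abs_upCoeff_mul_le (i : ℕ) {x M : ℝ} (h : |(i : ℝ) * x| ≤ M) :
    |upCoeff i * x| ≤ M / 4 := by
  have hM : 0 ≤ M := (abs_nonneg _).trans h
  rcases Nat.eq_zero_or_pos i with rfl | hi
  · simp [upCoeff]; positivity
  · have hi' : (1 : ℝ) ≤ i := by exact_mod_cast hi
    have hu : |upCoeff i| ≤ i / 4 := by
      rw [upCoeff, abs_of_nonneg (by positivity), div_le_iff₀ (by linarith)]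
      nlinarith
    rw [abs_mul] at h ⊢
    rw [abs_of_pos (by linarith : (0 : ℝ) < i)] at h
    calc |upCoeff i| * |x| ≤ i / 4 * |x| := by gcongr
      _ = i * |x| / 4 := by ring
      _ ≤ M / 4 := by gcongr

/-- In each flux term the bound `M` on `k a_k` absorbs the growth of `upCoeff` in one factor and
makes the other factor at most `M / (N + 1)`. The interior terms are bounded by the truncated
energy, up to two modes beyond the truncation. -/
theorem two_mul_sum_mul_hierarchyRHS_le {a : ℕ → ℝ} (h0 : a 0 = 0) {M : ℝ}
    (hM : ∀ k : ℕ, |(k : ℝ) * a k| ≤ M) (N : ℕ) :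
    ∑ k ∈ Finset.range (N + 1), 2 * (a (k + 1) * hierarchyRHS a (k + 1)) ≤
      5 * ∑ k ∈ Finset.range (N + 1), a (k + 1) ^ 2 + 4 * M ^ 2 / (N + 1) := by
  have hM0 : 0 ≤ M := (abs_nonneg _).trans (hM 0)
  have hN : (0 : ℝ) < N + 1 := by positivity
  have hsmall : ∀ j : ℕ, |a (N + 1 + j)| ≤ M / (N + 1) := by
    intro j
    have h := hM (N + 1 + j)
    rw [abs_mul, abs_of_nonneg (Nat.cast_nonneg _)] at h
    rw [le_div_iff₀ hN]
    refine le_trans ?_ h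
    push_cast
    nlinarith [abs_nonneg (a (N + 1 + j)), j.cast_nonneg (α := ℝ)]
  have hsq : ∀ j : ℕ, a (N + 1 + j) ^ 2 ≤ M ^ 2 / (N + 1) := by
    intro j
    have h := hsmall j
    have h1 : M / (N + 1) * (M / (N + 1)) ≤ M ^ 2 / (N + 1) := by
      have h2 : M / (N + 1) ≤ M := div_le_self hM0 (by linarith [N.cast_nonneg (α := ℝ)])
      calc _ ≤ M / (N + 1) * M := by gcongr
        _ = _ := by ring
    rw [← sq_abs, sq]
    exact (mul_self_le_mul_self (abs_nonneg _) h).trans h1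
  set E := ∑ k ∈ Finset.range (N + 1), a (k + 1) ^ 2 with hE
  -- The same sum up to `N + 3` is split at the top and at the bottom; the two extra top modes are
  -- small.
  have hshift : ∑ k ∈ Finset.range (N + 1), a (k + 3) ^ 2 ≤ E + 2 * (M ^ 2 / (N + 1)) := by
    have h1 : ∑ k ∈ Finset.range (N + 3), a (k + 1) ^ 2 =
        E + a (N + 1 + 1) ^ 2 + a (N + 1 + 2) ^ 2 := by
      rw [Finset.sum_range_succ, Finset.sum_range_succ]
    have h2 : ∑ k ∈ Finset.range (N + 3), a (k + 1) ^ 2 =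
        ∑ k ∈ Finset.range (N + 1), a (k + 3) ^ 2 + a 2 ^ 2 + a 1 ^ 2 := by
      rw [Finset.sum_range_succ', Finset.sum_range_succ']
    linarith [hsq 1, hsq 2, sq_nonneg (a 1), sq_nonneg (a 2)]
  have h1 : a 1 ^ 2 ≤ E := by
    rw [hE, Finset.sum_range_succ']
    have := Finset.sum_nonneg fun k (_ : k ∈ Finset.range N) => sq_nonneg (a (k + 1 + 1))
    simpa using this
  have hmid : ∑ k ∈ Finset.range (N + 1),
      (downCoeff (k + 3) - upCoeff (k + 1)) * (a (k + 1) * a (k + 3)) ≤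
      3 / 4 * E + 3 / 4 * ∑ k ∈ Finset.range (N + 1), a (k + 3) ^ 2 := by
    rw [hE, Finset.mul_sum, Finset.mul_sum, ← Finset.sum_add_distrib]
    refine Finset.sum_le_sum fun k _ => ?_
    have hc := abs_down_sub_up_le k
    calc _ ≤ |(downCoeff ((k : ℝ) + 3) - upCoeff ((k : ℝ) + 1)) * (a (k + 1) * a (k + 3))| :=
          le_abs_self _
      _ ≤ 3 / 2 * |a (k + 1) * a (k + 3)| := by rw [abs_mul]; gcongr
      _ ≤ _ := by
        rw [abs_mul]
        nlinarith [sq_nonneg (|a (k + 1)| - |a (k + 3)|), sq_abs (a (k + 1)), sq_abs (a (k + 3))]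
  have hb1 : upCoeff (N + 1) * (a (N + 1) * a (N + 3)) ≤ M ^ 2 / (N + 1) / 4 := by
    have h2 := abs_upCoeff_mul_le (N + 1) (hM (N + 1))
    push_cast at h2
    calc _ ≤ |upCoeff (N + 1) * a (N + 1)| * |a (N + 1 + 2)| := by
          rw [← abs_mul, mul_assoc]; exact le_abs_self _
      _ ≤ M / 4 * (M / (N + 1)) := by gcongr; exact hsmall 2
      _ = _ := by ring
  have hb2 : upCoeff N * (a N * a (N + 2)) ≤ M ^ 2 / (N + 1) / 4 := by
    have h2 := abs_upCoeff_mul_le N (hM N)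
    calc _ ≤ |upCoeff N * a N| * |a (N + 1 + 1)| := by
          rw [← abs_mul, mul_assoc]; exact le_abs_self _
      _ ≤ M / 4 * (M / (N + 1)) := by gcongr; exact hsmall 1
      _ = _ := by ring
  rw [← Finset.mul_sum, sum_mul_hierarchyRHS h0]
  have hE0 : 0 ≤ E := Finset.sum_nonneg fun k _ => sq_nonneg _
  have e4 : 4 * M ^ 2 / ((N : ℝ) + 1) = 4 * (M ^ 2 / (N + 1)) := by ring
  rw [e4]
  linarith

/-- Uniqueness for the hierarchy of equations of the sine coefficients. -/
theorem hierarchy_eq_zero {T M : ℝ} {d : ℕ → ℝ → ℝ}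
    (hc : ∀ k, ContinuousOn (d k) (Icc 0 T)) (hinit : ∀ k, d k 0 = 0)
    (h0 : ∀ t ∈ Icc 0 T, d 0 t = 0)
    (hd : ∀ k, ∀ t ∈ Ioo 0 T, HasDerivAt (d k) (hierarchyRHS (fun j => d j t) k) t)
    (hM : ∀ k : ℕ, ∀ t ∈ Icc 0 T, |(k : ℝ) * d k t| ≤ M) (k : ℕ) {t : ℝ} (ht : t ∈ Icc 0 T) :
    d k t = 0 := by
  have key : ∀ N : ℕ, ∑ k ∈ Finset.range (N + 1), d (k + 1) t ^ 2 ≤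
      (Real.exp (5 * t) * (4 * M ^ 2 * t)) / (N + 1) := by
    intro N
    set E : ℝ → ℝ := fun s => ∑ k ∈ Finset.range (N + 1), d (k + 1) s ^ 2 with hE
    have hEc : ContinuousOn E (Icc 0 T) :=
      continuousOn_finsetSum _ fun k _ => (hc (k + 1)).pow 2
    have hEd : ∀ s ∈ Ioo 0 T, HasDerivAt E (∑ k ∈ Finset.range (N + 1),
        2 * (d (k + 1) s * hierarchyRHS (fun j => d j s) (k + 1))) s := by
      intro s hs
      refine HasDerivAt.fun_sum fun k _ => ?_
      refine ((hd (k + 1) s hs).pow 2).congr_deriv ?_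
      push_cast
      ring
    -- Gronwall for the truncated energy, with the flux as a source of size `O(1/N)`; the energy
    -- vanishes at time zero.
    have hG : AntitoneOn (fun s => Real.exp (-5 * s) * E s - 4 * M ^ 2 / (N + 1) * s)
        (Icc 0 T) := by
      have hder : ∀ s ∈ Ioo 0 T, HasDerivAt
          (fun s => Real.exp (-5 * s) * E s - 4 * M ^ 2 / (N + 1) * s)
          (Real.exp (-5 * s) * (-5) * E s + Real.exp (-5 * s) * (∑ k ∈ Finset.range (N + 1),
            2 * (d (k + 1) s * hierarchyRHS (fun j => d j s) (k + 1))) - 4 * M ^ 2 / (N + 1)) s := by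
        intro s hs
        have h1 : HasDerivAt (fun s : ℝ => Real.exp (-5 * s)) (Real.exp (-5 * s) * (-5)) s := by
          simpa using ((hasDerivAt_id s).const_mul (-5)).exp
        have h2 : HasDerivAt (fun s : ℝ => 4 * M ^ 2 / ((N : ℝ) + 1) * s)
            (4 * M ^ 2 / ((N : ℝ) + 1)) s := by
          simpa using (hasDerivAt_id s).const_mul (4 * M ^ 2 / ((N : ℝ) + 1))
        exact (h1.mul (hEd s hs)).sub h2
      refine antitoneOn_of_deriv_nonpos (convex_Icc 0 T) ?_ ?_ ?_
      · exact (ContinuousOn.mul (by fun_prop) hEc).sub (by fun_prop)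
      · rw [interior_Icc]
        exact fun s hs => (hder s hs).differentiableAt.differentiableWithinAt
      · rw [interior_Icc]
        intro s hs
        rw [(hder s hs).deriv]
        have hs' : s ∈ Icc 0 T := Ioo_subset_Icc_self hs
        have h := two_mul_sum_mul_hierarchyRHS_le (a := fun j => d j s) (h0 s hs')
          (fun k => hM k s hs') N
        have hexp : Real.exp (-5 * s) ≤ 1 := Real.exp_le_one_iff.2 (by linarith [hs.1])
        have hpos := Real.exp_pos (-5 * s)
        have hq : 0 ≤ 4 * M ^ 2 / ((N : ℝ) + 1) := by positivity
        have h' := mul_le_mul_of_nonneg_left h hpos.le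
        have h'' := mul_le_mul_of_nonneg_right hexp hq
        simp only [hE]
        linarith
    have h := hG ⟨le_rfl, ht.1.trans ht.2⟩ ht ht.1
    have hE0 : E 0 = 0 := by simp [hE, hinit]
    simp only [hE0, mul_zero, sub_zero] at h
    have hpos := Real.exp_pos (5 * t)
    have he : Real.exp (5 * t) * Real.exp (-5 * t) = 1 := by
      rw [← Real.exp_add]; simp
    calc E t = Real.exp (5 * t) * (Real.exp (-5 * t) * E t) := by rw [← mul_assoc, he, one_mul]
      _ ≤ Real.exp (5 * t) * (4 * M ^ 2 / (N + 1) * t) :=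
          mul_le_mul_of_nonneg_left (by linarith) hpos.le
      _ = _ := by ring
  rcases k with _ | k
  · exact h0 t ht
  · have hle : d (k + 1) t ^ 2 ≤ 0 := by
      refine ge_of_tendsto (tendsto_const_div_atTop_nhds_zero_nat
        (Real.exp (5 * t) * (4 * M ^ 2 * t)) |>.comp (tendsto_add_atTop_nat 1)) ?_
      filter_upwards [eventually_ge_atTop k] with N hN
      have h := key N
      simp only [Function.comp_apply, Nat.cast_add, Nat.cast_one]
      refine le_trans ?_ h
      exact Finset.single_le_sum (f := fun k => d (k + 1) t ^ 2) (fun i _ => sq_nonneg _)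
        (Finset.mem_range.2 (by omega))
    exact pow_eq_zero_iff two_ne_zero |>.1 (le_antisymm hle (sq_nonneg _))

end Hierarchy

/-! ### Sine coefficients of an arbitrary classical odd solution. -/

section Uniqueness

open scoped NNReal

/-- The sine coefficients of a function on the torus. -/
def sineCoeff (f : ℝ → ℝ) (j : ℤ) : ℝ := ∫ θ in -Real.pi..Real.pi, f θ * Real.sin (j * θ)

theorem sineCoeff_zero (f : ℝ → ℝ) : sineCoeff f 0 = 0 := by simp [sineCoeff]

theorem sineCoeff_neg (f : ℝ → ℝ) (j : ℤ) : sineCoeff f (-j) = -sineCoeff f j := by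
  simp [sineCoeff]

theorem exists_forall_abs_deriv_le {T : ℝ} {η : ℝ → ℝ → ℝ}
    (hη : ContDiffOn ℝ 1 (fun p : ℝ × ℝ => η p.1 p.2) (Icc 0 T ×ˢ univ))
    (hp : ∀ t ∈ Icc 0 T, Function.Periodic (η t) (2 * Real.pi)) :
    ∃ K : ℝ≥0, (∀ t ∈ Icc 0 T, ∀ θ, |deriv (η t) θ| ≤ K) ∧
      ∀ θ ∈ Ioc (-Real.pi) Real.pi, LipschitzOnWith K (fun t => η t θ) (Icc 0 T) := by
  -- The window exceeds one period by one on each side, so every point of a period is interior and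
  -- the two-sided `deriv` is controlled by the Lipschitz constant.
  obtain ⟨K, hK⟩ := (hη.mono (prod_mono_right (subset_univ
    (Icc (-Real.pi - 1) (Real.pi + 1))))).exists_lipschitzOnWith one_ne_zero
    ((convex_Icc 0 T).prod (convex_Icc _ _)) (isCompact_Icc.prod isCompact_Icc)
  refine ⟨K, fun t ht θ => ?_, fun θ hθ => ?_⟩
  · obtain ⟨θ', hθ', e⟩ := (periodic_deriv (hp t ht)).exists_mem_Ioc (by linarith [Real.pi_pos])
      θ (-Real.pi)
    have h1 : -Real.pi - 1 < θ' := by linarith [hθ'.1]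
    have h2 : θ' < Real.pi + 1 := by linarith [hθ'.2]
    rw [e, ← Real.norm_eq_abs]
    refine norm_deriv_le_of_lipschitzOn (f := η t) (s := Icc (-Real.pi - 1) (Real.pi + 1))
      (Icc_mem_nhds h1 h2) ?_
    intro x hx y hy
    have h := hK (show (t, x) ∈ Icc 0 T ×ˢ Icc (-Real.pi - 1) (Real.pi + 1) from ⟨ht, hx⟩)
      (show (t, y) ∈ Icc 0 T ×ˢ Icc (-Real.pi - 1) (Real.pi + 1) from ⟨ht, hy⟩)
    simpa [Prod.edist_eq] using h
  · intro s hs t ht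
    have hθ' : θ ∈ Icc (-Real.pi - 1) (Real.pi + 1) := ⟨by linarith [hθ.1], by linarith [hθ.2]⟩
    have h := hK (show (s, θ) ∈ Icc 0 T ×ˢ Icc (-Real.pi - 1) (Real.pi + 1) from ⟨hs, hθ'⟩)
      (show (t, θ) ∈ Icc 0 T ×ˢ Icc (-Real.pi - 1) (Real.pi + 1) from ⟨ht, hθ'⟩)
    simpa [Prod.edist_eq] using h

theorem contDiff_slice {T : ℝ} {η : ℝ → ℝ → ℝ}
    (hη : ContDiffOn ℝ 1 (fun p : ℝ × ℝ => η p.1 p.2) (Icc 0 T ×ˢ univ)) {t : ℝ}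
    (ht : t ∈ Icc 0 T) : ContDiff ℝ 1 (η t) := by
  rw [← contDiffOn_univ]
  exact hη.comp (contDiff_const.prodMk contDiff_id).contDiffOn fun θ _ => ⟨ht, mem_univ _⟩

theorem integral_deriv_mul_cos {f : ℝ → ℝ} (hf : ContDiff ℝ 1 f)
    (hp : Function.Periodic f (2 * Real.pi)) (j : ℤ) :
    ∫ θ in -Real.pi..Real.pi, deriv f θ * Real.cos (j * θ) = j * sineCoeff f j := by
  have h := integral_mul_deriv_periodic (fun θ => (hf.differentiable (by norm_num) θ).hasDerivAt)
    (hf.continuous_deriv le_rfl) hp (φ := fun θ => Real.cos (j * θ)) (by fun_prop)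
    (cos_periodic_intCast j)
  have e : deriv (fun θ => Real.cos (j * θ)) = fun θ => -(j * Real.sin (j * θ)) :=
    funext fun θ => (hasDerivAt_cos_mul j θ).deriv
  rw [e] at h
  rw [sineCoeff, ← intervalIntegral.integral_const_mul, ← neg_neg (∫ _ in _.._, _), ← h,
    ← intervalIntegral.integral_neg]
  refine intervalIntegral.integral_congr fun θ _ => ?_
  ring

theorem sineCoeff_of_hasDerivAt {v h : ℝ → ℝ} (hv : ∀ θ, HasDerivAt v (h θ) θ)
    (hh : IntervalIntegrable h volume (-Real.pi) Real.pi)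
    (hp : Function.Periodic v (2 * Real.pi)) (j : ℤ) :
    j * sineCoeff v j = ∫ θ in -Real.pi..Real.pi, h θ * Real.cos (j * θ) := by
  have e := intervalIntegral.integral_mul_deriv_eq_deriv_mul (a := -Real.pi) (b := Real.pi)
    (fun θ _ => hv θ) (fun θ _ => hasDerivAt_cos_mul j θ) hh
    (Continuous.intervalIntegrable (by fun_prop) _ _)
  have e1 : v Real.pi = v (-Real.pi) := by rw [← hp (-Real.pi)]; congr 1; ring
  have e2 : Real.cos (j * Real.pi) = Real.cos (j * -Real.pi) := by
    rw [mul_neg, Real.cos_neg]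
  rw [e1, e2, sub_self, zero_sub] at e
  rw [← neg_neg (∫ _ in _.._, h _ * _), ← e, sineCoeff, ← intervalIntegral.integral_const_mul,
    ← intervalIntegral.integral_neg]
  refine intervalIntegral.integral_congr fun θ _ => ?_
  ring

variable {T : ℝ} {η₀ : Sobolev 1} {η v : ℝ → ℝ → ℝ}

theorem lipschitzWith_of_contDiff_of_abs_deriv_le {f : ℝ → ℝ} {K : ℝ≥0} (hf : ContDiff ℝ 1 f)
    (hK : ∀ θ, |deriv f θ| ≤ K) : LipschitzWith K f :=
  lipschitzWith_of_abs_deriv_le (fun θ => (hf.differentiable (by norm_num) θ).hasDerivAt) hK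

theorem norm_hilbertIntegral_le {f : ℝ → ℝ} {K : ℝ≥0} (hf : LipschitzWith K f) (θ : ℝ) :
    |hilbertIntegral f θ| ≤ 2 * K := by
  have h := intervalIntegral.norm_integral_le_of_norm_le_const (a := 0) (b := Real.pi)
    (f := hilbertIntegrand f θ) (C := 4 * K) (fun s hs => norm_hilbertIntegrand_le hf θ
      (by rwa [uIoc_of_le Real.pi_pos.le] at hs))
  rw [sub_zero, abs_of_pos Real.pi_pos, Real.norm_eq_abs] at h
  rw [hilbertIntegral, smul_eq_mul, abs_mul, abs_of_pos (by have := Real.pi_pos; positivity)]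
  calc _ ≤ 1 / (2 * Real.pi) * (4 * K * Real.pi) := by
        have := Real.pi_pos
        gcongr
    _ = 2 * K := by have := Real.pi_ne_zero; field_simp; ring

/-- Product formulas turn `sin 2θ` and `cos 2θ` into shifts of the frequency by two. One integration
by parts removes the derivative of `f`, and the relation `w' = H f` gives the last clause, which
expresses the coefficients of `w` through those of `f` at nonzero frequencies. -/
theorem integral_linearizedOp_mul_sin {f w : ℝ → ℝ} (hf : ContDiff ℝ 1 f) {K : ℝ≥0}
    (hK : ∀ θ, |deriv f θ| ≤ K) (hp : Function.Periodic f (2 * Real.pi))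
    (hw : ∀ θ, HasDerivAt w (hilbert f θ) θ) (hwp : Function.Periodic w (2 * Real.pi)) (j : ℤ) :
    AEStronglyMeasurable (linearizedOp f w) ∧
    ∫ θ in -Real.pi..Real.pi, linearizedOp f w θ * Real.sin (j * θ) =
      1 / 4 * (((j - 2 : ℤ) : ℝ) * sineCoeff f (j - 2) - ((j + 2 : ℤ) : ℝ) * sineCoeff f (j + 2))
      - 1 / 2 * (sineCoeff f (j + 2) + sineCoeff f (j - 2))
      - 1 / 2 * (((j - 2).sign : ℝ) * sineCoeff f (j - 2) - ((j + 2).sign : ℝ) * sineCoeff f (j + 2))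
      - (sineCoeff w (j + 2) + sineCoeff w (j - 2)) ∧
    ∀ i : ℤ, i * sineCoeff w i = -(i.sign * sineCoeff f i) := by
  have hL := lipschitzWith_of_contDiff_of_abs_deriv_le hf hK
  have hH : hilbert f = hilbertIntegral f :=
    funext fun θ => hilbert_eq (hasHilbertTransformAt hL θ)
  -- The transform is a derivative, of `w`, and derivatives are measurable.
  have hHm : Measurable (hilbert f) := by
    rw [show hilbert f = deriv w from funext fun θ => (hw θ).deriv.symm]
    exact measurable_deriv w
  have hwc : Continuous w := continuous_iff_continuousAt.2 fun θ => (hw θ).continuousAt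
  have hfc := hf.continuous
  have hdc := hf.continuous_deriv le_rfl
  have hHi : IntervalIntegrable (hilbert f) volume (-Real.pi) Real.pi := by
    rw [intervalIntegrable_iff_integrableOn_Ioc_of_le neg_pi_lt_pi.le]
    refine Measure.integrableOn_of_bounded (M := 2 * K) (by simp) hHm.aestronglyMeasurable ?_
    refine Eventually.of_forall fun θ => ?_
    rw [hH]
    exact norm_hilbertIntegral_le hL θ
  have hHcos : ∀ i : ℤ, ∫ θ in -Real.pi..Real.pi, hilbert f θ * Real.cos (i * θ) =
      -(i.sign * sineCoeff f i) := by
    intro i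
    rw [hH]
    exact hilbertIntegral_mul_cos_integral hL hp i
  refine ⟨?_, ?_, fun i => by rw [sineCoeff_of_hasDerivAt hw hHi hwp, hHcos]⟩
  · refine Measurable.aestronglyMeasurable ?_
    unfold linearizedOp
    have := hdc.measurable
    have := hfc.measurable
    have := hwc.measurable
    fun_prop
  · have e : ∀ θ, linearizedOp f w θ * Real.sin (j * θ) =
        1 / 4 * (deriv f θ * Real.cos ((j - 2 : ℤ) * θ) - deriv f θ * Real.cos ((j + 2 : ℤ) * θ))
        - 1 / 2 * (f θ * Real.sin ((j + 2 : ℤ) * θ) + f θ * Real.sin ((j - 2 : ℤ) * θ))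
        + 1 / 2 * (hilbert f θ * Real.cos ((j - 2 : ℤ) * θ)
          - hilbert f θ * Real.cos ((j + 2 : ℤ) * θ))
        - (w θ * Real.sin ((j + 2 : ℤ) * θ) + w θ * Real.sin ((j - 2 : ℤ) * θ)) := by
      intro θ
      unfold linearizedOp
      push_cast
      simp only [add_mul (j : ℝ), sub_mul (j : ℝ), Real.sin_add (j * θ), Real.sin_sub (j * θ),
        Real.cos_add (j * θ), Real.cos_sub (j * θ)]
      ring
    have i1 : ∀ i : ℤ, IntervalIntegrable (fun θ => deriv f θ * Real.cos (i * θ)) volume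
        (-Real.pi) Real.pi := fun i => Continuous.intervalIntegrable (by fun_prop) _ _
    have i2 : ∀ i : ℤ, IntervalIntegrable (fun θ => f θ * Real.sin (i * θ)) volume
        (-Real.pi) Real.pi := fun i => Continuous.intervalIntegrable (by fun_prop) _ _
    have i3 : ∀ i : ℤ, IntervalIntegrable (fun θ => hilbert f θ * Real.cos (i * θ)) volume
        (-Real.pi) Real.pi := fun i => hHi.mul_continuousOn (by fun_prop)
    have i4 : ∀ i : ℤ, IntervalIntegrable (fun θ => w θ * Real.sin (i * θ)) volume
        (-Real.pi) Real.pi := fun i => Continuous.intervalIntegrable (by fun_prop) _ _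
    simp only [e]
    rw [intervalIntegral.integral_sub
        (((((i1 _).sub (i1 _)).const_mul _).sub (((i2 _).add (i2 _)).const_mul _)).add
          (((i3 _).sub (i3 _)).const_mul _)) ((i4 _).add (i4 _)),
      intervalIntegral.integral_add
        ((((i1 _).sub (i1 _)).const_mul _).sub (((i2 _).add (i2 _)).const_mul _))
          (((i3 _).sub (i3 _)).const_mul _),
      intervalIntegral.integral_sub (((i1 _).sub (i1 _)).const_mul _)
        (((i2 _).add (i2 _)).const_mul _),
      intervalIntegral.integral_const_mul, intervalIntegral.integral_const_mul,
      intervalIntegral.integral_const_mul,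
      intervalIntegral.integral_sub (i1 _) (i1 _), intervalIntegral.integral_add (i2 _) (i2 _),
      intervalIntegral.integral_sub (i3 _) (i3 _), intervalIntegral.integral_add (i4 _) (i4 _),
      integral_deriv_mul_cos hf hp, integral_deriv_mul_cos hf hp, hHcos, hHcos]
    simp only [sineCoeff]
    ring

theorem integral_neg_linearizedOp_mul_sin {f w : ℝ → ℝ} (hf : ContDiff ℝ 1 f) {K : ℝ≥0}
    (hK : ∀ θ, |deriv f θ| ≤ K) (hp : Function.Periodic f (2 * Real.pi))
    (hw : ∀ θ, HasDerivAt w (hilbert f θ) θ) (hwp : Function.Periodic w (2 * Real.pi)) (k : ℕ) :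
    ∫ θ in -Real.pi..Real.pi, -linearizedOp f w θ * Real.sin ((k : ℤ) * θ) =
      hierarchyRHS (fun i => sineCoeff f i) k := by
  obtain ⟨-, h, hV⟩ := integral_linearizedOp_mul_sin hf hK hp hw hwp k
  simp only [neg_mul, intervalIntegral.integral_neg]
  rw [h]
  rcases k with _ | _ | k
  · simp only [Nat.cast_zero, zero_add, zero_sub, sineCoeff_neg, hierarchyRHS, Int.sign_neg]
    push_cast
    ring
  -- Frequency `-1` is reflected onto `1` by oddness of the sine coefficients; this is the source of
  -- the exceptional diagonal term `3/4`.
  · have h1 := hV 1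
    have h3 := hV 3
    simp only [Int.sign_one, Int.cast_one, one_mul] at h1
    rw [Int.sign_eq_one_of_pos (by norm_num)] at h3
    push_cast at h3
    norm_num [hierarchyRHS, downCoeff, sineCoeff_neg] at h1 h3 ⊢
    rw [Int.sign_eq_one_of_pos (by norm_num)]
    push_cast
    linear_combination 1 / 3 * h3 - h1
  · have h0 := hV k
    have h4 := hV ((k : ℤ) + 4)
    have e4 : (k : ℤ) + 1 + 1 + 2 = k + 4 := by ring
    have e0 : (k : ℤ) + 1 + 1 - 2 = k := by ring
    rw [Int.sign_eq_one_of_pos (by omega)] at h4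
    push_cast at h4 ⊢
    rw [e4, e0, Int.sign_eq_one_of_pos (by omega : (0 : ℤ) < k + 4)]
    simp only [hierarchyRHS, downCoeff, upCoeff]
    push_cast
    have hk4 : (k : ℝ) + 4 ≠ 0 := by positivity
    have hw4 : sineCoeff w (k + 4) = -(sineCoeff f (k + 4) / (k + 4)) := by
      field_simp
      linear_combination h4
    rw [hw4]
    rcases Nat.eq_zero_or_pos k with rfl | hk
    · simp [sineCoeff_zero]
      ring
    · have hk' : (k : ℝ) ≠ 0 := by positivity
      rw [Int.sign_eq_one_of_pos (by omega)] at h0 ⊢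
      push_cast at h0 ⊢
      have hw0 : sineCoeff w k = -(sineCoeff f k / k) := by
        field_simp
        linear_combination h0
      rw [hw0]
      field_simp
      ring

/-- Differentiation under the integral, dominated by the uniform Lipschitz constant in time.
Interior times suffice, since continuity on the closed interval is proved separately. -/
theorem IsClassicalOddSolution.hasDerivAt_sineCoeff (h : IsClassicalOddSolution T η₀ η v) (k : ℕ)
    {t : ℝ} (ht : t ∈ Ioo 0 T) :
    HasDerivAt (fun s => sineCoeff (η s) k)
      (hierarchyRHS (fun i => sineCoeff (η t) i) k) t := by
  obtain ⟨K, hK, hLip⟩ := exists_forall_abs_deriv_le h.contDiffOn fun t ht => (h.periodic t ht).1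
  have ht' := Ioo_subset_Icc_self ht
  have hcd := fun s hs => contDiff_slice (t := s) h.contDiffOn hs
  rw [← integral_neg_linearizedOp_mul_sin (hcd t ht') (hK t ht') (h.periodic t ht').1
    (h.velocity t ht') (h.periodic t ht').2]
  have hmeas := (integral_linearizedOp_mul_sin (hcd t ht') (hK t ht') (h.periodic t ht').1
    (h.velocity t ht') (h.periodic t ht').2 k).1
  refine (intervalIntegral.hasDerivAt_integral_of_dominated_loc_of_lip (s := Ioo 0 T)
    (F := fun s θ => η s θ * Real.sin ((k : ℤ) * θ)) (bound := fun _ => (K : ℝ))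
    (Ioo_mem_nhds ht.1 ht.2) ?_ ?_ ?_ ?_ (by simp) ?_).2
  · filter_upwards [Ioo_mem_nhds ht.1 ht.2] with s hs
    have := (hcd s (Ioo_subset_Icc_self hs)).continuous
    exact Continuous.aestronglyMeasurable (by fun_prop)
  · have := (hcd t ht').continuous
    exact Continuous.intervalIntegrable (by fun_prop) _ _
  · exact hmeas.restrict.neg.mul (Continuous.aestronglyMeasurable (by fun_prop))
  · refine Eventually.of_forall fun θ hθ => ?_
    rw [uIoc_of_le neg_pi_lt_pi.le] at hθ
    refine LipschitzOnWith.of_dist_le_mul fun s hs s' hs' => ?_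
    have h1 := (hLip θ hθ).dist_le_mul s (Ioo_subset_Icc_self hs) s' (Ioo_subset_Icc_self hs')
    rw [Real.dist_eq, ← sub_mul, abs_mul]
    simp only [Real.nnabs_coe]
    exact (mul_le_of_le_one_right (abs_nonneg _) (Real.abs_sin_le_one _)).trans h1
  · refine Eventually.of_forall fun θ _ => ?_
    exact ((h.evolution t ht' θ).hasDerivAt (Icc_mem_nhds ht.1 ht.2)).mul_const _

theorem IsClassicalOddSolution.continuousOn_sineCoeff (h : IsClassicalOddSolution T η₀ η v)
    (k : ℕ) : ContinuousOn (fun s => sineCoeff (η s) k) (Icc 0 T) := by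
  obtain ⟨K, hK, hLip⟩ := exists_forall_abs_deriv_le h.contDiffOn fun t ht => (h.periodic t ht).1
  have hcont : ∀ s ∈ Icc 0 T, Continuous fun θ => η s θ * Real.sin ((k : ℤ) * θ) := fun s hs => by
    have := (contDiff_slice h.contDiffOn hs).continuous
    fun_prop
  refine LipschitzOnWith.continuousOn (K := K * (2 * Real.pi.toNNReal)) ?_
  refine LipschitzOnWith.of_dist_le_mul fun s hs s' hs' => ?_
  rw [Real.dist_eq, sineCoeff, sineCoeff, ← intervalIntegral.integral_sub
    ((hcont s hs).intervalIntegrable _ _) ((hcont s' hs').intervalIntegrable _ _)]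
  have hb := intervalIntegral.norm_integral_le_of_norm_le_const (a := -Real.pi) (b := Real.pi)
    (f := fun θ => η s θ * Real.sin ((k : ℤ) * θ) - η s' θ * Real.sin ((k : ℤ) * θ))
    (C := K * dist s s') fun θ hθ => by
      rw [uIoc_of_le neg_pi_lt_pi.le] at hθ
      rw [← sub_mul, norm_mul]
      exact (mul_le_of_le_one_right (norm_nonneg _) (Real.abs_sin_le_one _)).trans
        ((hLip θ hθ).dist_le_mul s hs s' hs')
  refine hb.trans (le_of_eq ?_)
  rw [abs_of_pos (by linarith [Real.pi_pos])]
  simp only [NNReal.coe_mul, NNReal.coe_ofNat, Real.coe_toNNReal _ Real.pi_pos.le]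
  ring

/-- One integration by parts against the uniformly bounded derivative; this decay is what kills the
flux in the energy argument. -/
theorem IsClassicalOddSolution.exists_abs_mul_sineCoeff_le (h : IsClassicalOddSolution T η₀ η v) :
    ∃ M : ℝ, ∀ k : ℕ, ∀ t ∈ Icc 0 T, |(k : ℝ) * sineCoeff (η t) k| ≤ M := by
  obtain ⟨K, hK, -⟩ := exists_forall_abs_deriv_le h.contDiffOn fun t ht => (h.periodic t ht).1
  refine ⟨K * |Real.pi - -Real.pi|, fun k t ht => ?_⟩
  have e := integral_deriv_mul_cos (contDiff_slice h.contDiffOn ht) (h.periodic t ht).1 k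
  rw [Int.cast_natCast] at e
  rw [← e, ← Real.norm_eq_abs]
  refine intervalIntegral.norm_integral_le_of_norm_le_const fun θ _ => ?_
  rw [norm_mul]
  exact (mul_le_of_le_one_right (norm_nonneg _) (Real.abs_cos_le_one _)).trans (hK t ht θ)

theorem hierarchyRHS_sub (a b : ℕ → ℝ) (k : ℕ) :
    hierarchyRHS (fun j => a j - b j) k = hierarchyRHS a k - hierarchyRHS b k := by
  rcases k with _ | _ | k <;> simp only [hierarchyRHS] <;> ring

/-- A continuous odd periodic function with vanishing sine coefficients is zero. -/
theorem eq_zero_of_sineCoeff_eq_zero {f : ℝ → ℝ} (hf : Continuous f)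
    (hp : Function.Periodic f (2 * Real.pi)) (hodd : ∀ θ, f (-θ) = -f θ)
    (h : ∀ k : ℕ, sineCoeff f k = 0) (θ : ℝ) : f θ = 0 := by
  have hae : f =ᵐ[torusMeasure] fun _ => 0 := by
    refine ae_eq_zero_of_integral_cos_sin (memLp_of_continuous hf) (fun j => ?_) fun j => ?_
    · refine integral_odd_torus (Eventually.of_forall fun θ => ?_)
      rw [hodd, mul_neg, Real.cos_neg, neg_mul]
    · rw [integral_torusMeasure]
      change sineCoeff f j = 0
      rcases Int.eq_nat_or_neg j with ⟨k, rfl | rfl⟩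
      · exact h k
      · rw [sineCoeff_neg, h, neg_zero]
  obtain ⟨θ', hθ', e⟩ := hp.exists_mem_Ioc (by linarith [Real.pi_pos]) θ (-Real.pi)
  rw [e]
  rw [show -Real.pi + 2 * Real.pi = Real.pi by ring] at hθ'
  exact Measure.eqOn_Ioc_of_ae_eq volume hae hf.continuousOn continuousOn_const hθ'

/-- Uniqueness of classical odd solutions. -/
theorem IsClassicalOddSolution.unique {η' v' : ℝ → ℝ → ℝ} (h : IsClassicalOddSolution T η₀ η v)
    (h' : IsClassicalOddSolution T η₀ η' v') {t : ℝ} (ht : t ∈ Icc 0 T) (θ : ℝ) :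
    η' t θ = η t θ ∧ v' t θ = v t θ := by
  have hc : ∀ s ∈ Icc 0 T, Continuous (η s) := fun s hs =>
    (contDiff_slice h.contDiffOn hs).continuous
  have hc' : ∀ s ∈ Icc 0 T, Continuous (η' s) := fun s hs =>
    (contDiff_slice h'.contDiffOn hs).continuous
  obtain ⟨M, hM⟩ := h.exists_abs_mul_sineCoeff_le
  obtain ⟨M', hM'⟩ := h'.exists_abs_mul_sineCoeff_le
  have hzero : ∀ k : ℕ, sineCoeff (η' t) k - sineCoeff (η t) k = 0 := by
    intro k
    refine hierarchy_eq_zero (T := T) (M := M' + M)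
      (d := fun k t => sineCoeff (η' t) k - sineCoeff (η t) k)
      (fun k => (h'.continuousOn_sineCoeff k).sub (h.continuousOn_sineCoeff k)) (fun k => ?_)
      (fun s _ => ?_) (fun k s hs => ?_) (fun k s hs => ?_) k ht
    · have hae : η' 0 =ᵐ[torusMeasure] η 0 := h'.initial.symm.trans h.initial
      rw [sub_eq_zero, sineCoeff, sineCoeff, ← integral_torusMeasure, ← integral_torusMeasure]
      refine integral_congr_ae ?_
      filter_upwards [hae] with θ hθ
      rw [hθ]
    · simp [sineCoeff]
    · rw [hierarchyRHS_sub]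
      exact (h'.hasDerivAt_sineCoeff k hs).sub (h.hasDerivAt_sineCoeff k hs)
    · rw [mul_sub]
      exact (abs_sub _ _).trans (add_le_add (hM' k s hs) (hM k s hs))
  have hη : ∀ φ, η' t φ = η t φ := by
    intro φ
    refine sub_eq_zero.1 (eq_zero_of_sineCoeff_eq_zero (f := fun φ => η' t φ - η t φ)
      ((hc' t ht).sub (hc t ht)) (fun φ => ?_) (fun φ => ?_) (fun k => ?_) φ)
    · simp only [(h'.periodic t ht).1 φ, (h.periodic t ht).1 φ]
    · rw [h'.odd t ht, h.odd t ht]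
      ring
    · rw [← hzero k]
      have i : ∀ g : ℝ → ℝ, Continuous g → IntervalIntegrable
          (fun θ => g θ * Real.sin ((k : ℤ) * θ)) volume (-Real.pi) Real.pi := fun g hg =>
        Continuous.intervalIntegrable (by fun_prop) _ _
      rw [sineCoeff, sineCoeff, sineCoeff, ← intervalIntegral.integral_sub (i _ (hc' t ht))
        (i _ (hc t ht))]
      simp only [sub_mul]
  refine ⟨hη θ, ?_⟩
  have hηt : η' t = η t := funext hη
  -- Equal profiles have equal transforms, so the velocities differ by a constant, which the gauge
  -- makes zero.
  have hd : ∀ φ, HasDerivAt (fun φ => v' t φ - v t φ) 0 φ := by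
    intro φ
    have h1 := (h'.velocity t ht φ).sub (h.velocity t ht φ)
    rwa [hηt, sub_self] at h1
  have hconst := is_const_of_deriv_eq_zero (fun φ => (hd φ).differentiableAt)
    (fun φ => (hd φ).deriv) θ 0
  simp only [h'.gauge t ht, h.gauge t ht, sub_self] at hconst
  exact sub_eq_zero.1 hconst

end Uniqueness

/-! ### Time regularity and decay of the coefficients. -/

section Regularity

theorem lower_generator_add (j s : ℕ) (x : EllTwo) :
    lower j (generator (s + j) x) = generator s (lower j x) := by
  induction j generalizing s with
  | zero =>
    have h : ∀ x, lower 0 x = x := fun x => by ext n; simp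
    rw [h, h, add_zero]
  | succ j ih =>
    rw [add_comm j 1, ← add_assoc, ← lower_lower, ← lower_lower, ih, lower_generator]

theorem lower_comm (i j : ℕ) (x : EllTwo) : lower i (lower j x) = lower j (lower i x) := by
  rw [lower_lower, lower_lower, add_comm]

variable {s : ℕ} {y : ℝ → EllTwo}

/-- Each further time derivative of a solution costs one weight. -/
theorem hasDerivAt_lower_two
    (hd : ∀ t, HasDerivAt (fun t => lower 1 (y t)) (generator (s + 1) (y t)) t)
    (t : ℝ) : HasDerivAt (fun t => lower 2 (y t)) (generator s (lower 1 (y t))) t := by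
  have h := (lower 1).hasFDerivAt.comp_hasDerivAt t (hd t)
  simp only [lower_generator, Function.comp_def, lower_lower] at h
  exact h

theorem hasDerivAt_generator_lower
    (hd : ∀ t, HasDerivAt (fun t => lower 1 (y t)) (generator (s + 1) (y t)) t) (t : ℝ) :
    HasDerivAt (fun t => generator s (lower 1 (y t))) (generator s (generator (s + 1) (y t))) t :=
  (generator s).hasFDerivAt.comp_hasDerivAt t (hd t)

theorem contDiff_two_lower_two (hy : Continuous y)
    (hd : ∀ t, HasDerivAt (fun t => lower 1 (y t)) (generator (s + 1) (y t)) t) :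
    ContDiff ℝ 2 fun t => lower 2 (y t) := by
  have e1 : deriv (fun t => lower 2 (y t)) = fun t => generator s (lower 1 (y t)) :=
    funext fun t => (hasDerivAt_lower_two hd t).deriv
  have e2 : deriv (fun t => generator s (lower 1 (y t))) =
      fun t => generator s (generator (s + 1) (y t)) :=
    funext fun t => (hasDerivAt_generator_lower hd t).deriv
  rw [show (2 : WithTop ℕ∞) = 1 + 1 by norm_num, contDiff_succ_iff_deriv]
  refine ⟨fun t => (hasDerivAt_lower_two hd t).differentiableAt, by simp, ?_⟩
  rw [e1, contDiff_one_iff_deriv, e2]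
  exact ⟨fun t => (hasDerivAt_generator_lower hd t).differentiableAt, by fun_prop⟩

theorem iteratedDerivWithin_one_two {f f' f'' : ℝ → ℝ} {T : ℝ} (hT : 0 < T)
    (h1 : ∀ t, HasDerivAt f (f' t) t) (h2 : ∀ t, HasDerivAt f' (f'' t) t) {t : ℝ}
    (ht : t ∈ Icc 0 T) :
    iteratedDerivWithin 1 f (Icc 0 T) t = f' t ∧ iteratedDerivWithin 2 f (Icc 0 T) t = f'' t := by
  have hu := uniqueDiffOn_Icc hT
  have e1 : ∀ s ∈ Icc 0 T, iteratedDerivWithin 1 f (Icc 0 T) s = f' s := fun s hs => by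
    rw [iteratedDerivWithin_one]
    exact (h1 s).hasDerivWithinAt.derivWithin (hu s hs)
  refine ⟨e1 t ht, ?_⟩
  rw [iteratedDerivWithin_succ, derivWithin_congr e1 (e1 t ht)]
  exact (h2 t).hasDerivWithinAt.derivWithin (hu t ht)

theorem exists_norm_le_on_Icc {z : ℝ → EllTwo} (hz : Continuous z) (T : ℝ) :
    ∃ B, ∀ t ∈ Icc 0 T, ‖z t‖ ≤ B :=
  (isCompact_Icc).exists_bound_of_continuousOn hz.continuousOn

theorem coeff_etaOf_lower (m n : ℕ) (y : ℝ → EllTwo) (t : ℝ) :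
    coeff (fun t => etaOf (lower (m + 2) (y t))) (n + 1) t =
      -(1 / 2) * ((freq n)⁻¹ ^ (m + 2) * lower 2 (y t) n) := by
  rw [coeff_etaOf, lower_apply, lower_apply]
  ring

/-- The frequency `n + 2` dominates the index `k = n + 1` used for `ẽ_k`. -/
theorem abs_mode_le {n j q : ℕ} {c B : ℝ} (hc : |c| ≤ B) (hjq : q ≤ j) :
    |-(1 / 2) * ((freq n)⁻¹ ^ j * c)| ≤ B / ((n + 1 : ℕ) : ℝ) ^ q := by
  have hf := freq_pos n
  have hB := (abs_nonneg c).trans hc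
  have h1 : (freq n)⁻¹ ^ j ≤ (((n + 1 : ℕ) : ℝ) ^ q)⁻¹ := by
    calc (freq n)⁻¹ ^ j ≤ (freq n)⁻¹ ^ q :=
          pow_le_pow_of_le_one (inv_nonneg.2 hf.le)
            (inv_le_one_of_one_le₀ (by linarith [two_le_freq n])) hjq
      _ = (freq n ^ q)⁻¹ := inv_pow _ _
      _ ≤ _ := by
          refine inv_anti₀ (by positivity) (pow_le_pow_left₀ (by positivity) ?_ _)
          simp only [freq]
          push_cast
          linarith
  have h2 := mul_le_mul h1 hc (abs_nonneg _) (by positivity)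
  rw [abs_mul, abs_mul, abs_of_nonneg (pow_nonneg (inv_nonneg.2 hf.le) j)]
  exact (mul_le_of_le_one_left (by positivity) (by norm_num)).trans
    (h2.trans_eq (inv_mul_eq_div _ _))

end Regularity

end DeGregorio

end

/-! ### Assembly of the theorem. -/

theorem theorem1p1 (m : ℕ) (hm : 3 < m) (η₀ : Sobolev 1) (hη₀ : η₀ ∈ HDW)
    (hreg : MemSobolev m (fun θ => rhoHalf θ * wderiv η₀ 1 θ)) (T : ℝ) (hT : 0 < T) :
    ∃ η v : ℝ → ℝ → ℝ,
      -- existence of a classical odd solution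
      IsClassicalOddSolution T η₀ η v ∧
      -- uniqueness among all classical odd solutions
      (∀ η' v' : ℝ → ℝ → ℝ, IsClassicalOddSolution T η₀ η' v' →
        ∀ t ∈ Set.Icc 0 T, ∀ θ, η' t θ = η t θ ∧ v' t θ = v t θ) ∧
      -- regularity
      ContinuousInHDW T η ∧
      ContDiffInSobolev 0 m T (fun t θ => rhoHalf θ * deriv (η t) θ) ∧
      ContDiffInSobolev 2 (m - 2) T (fun t θ => rhoHalf θ * deriv (η t) θ) ∧
      -- decay in `k` of the coefficients and of their first two time derivatives
      (∀ k : ℕ, 1 ≤ k → ContDiffOn ℝ 2 (coeff η k) (Set.Icc 0 T)) ∧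
      ∃ C : ℝ, ∀ j : ℕ, j ≤ 2 → ∀ k : ℕ, 1 ≤ k → ∀ t ∈ Set.Icc 0 T,
        |iteratedDerivWithin j (coeff η k) (Set.Icc 0 T) t| ≤ C / (k : ℝ) ^ (m - j) := by
  obtain ⟨y₀, hy₀⟩ := exists_represents_etaOf (by omega) hη₀ hreg
  -- The hypothesis `m > 3` leaves two weights in `H^{m-2}` after two time derivatives, enough for
  -- the pointwise summable profiles.
  obtain ⟨p, rfl⟩ : ∃ p, m = p + 4 := ⟨m - 4, by omega⟩
  obtain ⟨y, hyc, rfl, hyd⟩ := exists_evolution (p + 4) y₀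
  have hx : ∀ t, lower 1 (lower (p + 1) (y t)) = lower (p + 2) (y t) := fun t => by
    rw [lower_lower, show 1 + (p + 1) = p + 2 by ring]
  -- The evolution is solved once, in weight `m = p + 4`, and lowered to weight `3`, where it is the
  -- differential equation.
  have hd : ∀ t, HasDerivAt (fun t => lower 1 (lower (p + 1) (y t)))
      (generator 3 (lower (p + 1) (y t))) t := fun t => by
    have h := (lower (p + 1)).hasFDerivAt.comp_hasDerivAt t (hyd t)
    rw [show p + 4 = 3 + (p + 1) by ring, lower_generator_add] at h
    simp only [lower_comm 1]
    exact h
  have hsol := isClassicalOddSolution_etaOf (T := T) (by fun_prop) hd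
    (by rw [hx]; exact hy₀)
  simp only [hx] at hsol
  have hcoeff : ∀ n, coeff (fun t => etaOf (lower (p + 2) (y t))) (n + 1) =
      fun t => -(1 / 2) * ((freq n)⁻¹ ^ (p + 2) * lower 2 (y t) n) := fun n =>
    funext (coeff_etaOf_lower p n y)
  refine ⟨_, _, hsol, fun η' v' h' t ht θ => hsol.unique h' ht θ,
    continuousInHDW_etaOf (by fun_prop), ⟨fun t => (2 * Real.sqrt Real.pi)⁻¹ •
      sobolevSeries (p + 4) (y t), fun t _ => represents_sobolevSeries (by omega) _, ?_⟩,
    ⟨fun t => (2 * Real.sqrt Real.pi)⁻¹ • sobolevSeries (p + 2) (lower 2 (y t)), fun t _ => ?_, ?_⟩,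
    fun k hk => ?_, ?_⟩
  · exact contDiffOn_zero.2 (Continuous.continuousOn (by fun_prop))
  · have h := represents_sobolevSeries (m := p + 2) (by omega) (lower 2 (y t))
    rw [lower_lower, show p + 2 - 2 + 2 = p + 2 by omega] at h
    exact h
  · exact (((sobolevSeries (p + 2)).contDiff.comp
      (contDiff_two_lower_two hyc hyd)).const_smul _).contDiffOn
  · obtain ⟨n, rfl⟩ := Nat.exists_eq_add_of_le' hk
    rw [hcoeff]
    exact (contDiff_const.mul (contDiff_const.mul
      ((evalL n).contDiff.comp (contDiff_two_lower_two hyc hyd)))).contDiffOn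
  · obtain ⟨B₀, h0⟩ := exists_norm_le_on_Icc hyc T
    obtain ⟨B₁, h1⟩ := exists_norm_le_on_Icc (z := fun t => generator (p + 4) (y t))
      (by fun_prop) T
    obtain ⟨B₂, h2⟩ := exists_norm_le_on_Icc
      (z := fun t => generator (p + 3) (generator (p + 4) (y t))) (by fun_prop) T
    -- The three bounds control the `ℓ²` norms of `y` and of one and two applications of the
    -- generator. Each application uses up one factor `(freq n)⁻¹`, leaving exponent `m - j`.
    refine ⟨max B₀ (max B₁ B₂), fun j hj k hk t ht => ?_⟩
    obtain ⟨n, rfl⟩ := Nat.exists_eq_add_of_le' hk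
    have hd1 : ∀ t, HasDerivAt (coeff (fun t => etaOf (lower (p + 2) (y t))) (n + 1))
        (-(1 / 2) * ((freq n)⁻¹ ^ (p + 2) * generator (p + 3) (lower 1 (y t)) n)) t := fun t => by
      rw [hcoeff]
      exact (((evalL n).hasFDerivAt.comp_hasDerivAt t
        (hasDerivAt_lower_two hyd t)).const_mul _).const_mul _
    have hd2 : ∀ t, HasDerivAt
        (fun t => -(1 / 2) * ((freq n)⁻¹ ^ (p + 2) * generator (p + 3) (lower 1 (y t)) n))
        (-(1 / 2) * ((freq n)⁻¹ ^ (p + 2) * generator (p + 3) (generator (p + 4) (y t)) n)) t :=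
      fun t => (((evalL n).hasFDerivAt.comp_hasDerivAt t
        (hasDerivAt_generator_lower hyd t)).const_mul _).const_mul _
    obtain ⟨e1, e2⟩ := iteratedDerivWithin_one_two hT hd1 hd2 ht
    interval_cases j
    · rw [iteratedDerivWithin_zero, hcoeff]
      simp only [lower_apply, ← mul_assoc ((freq n)⁻¹ ^ (p + 2)), ← pow_add]
      exact abs_mode_le (((y t).abs_apply_le n).trans ((h0 t ht).trans (le_max_left _ _))) le_rfl
    · rw [e1, ← lower_generator, lower_apply, ← mul_assoc ((freq n)⁻¹ ^ (p + 2)), ← pow_add]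
      exact abs_mode_le ((EllTwo.abs_apply_le _ n).trans ((h1 t ht).trans
        ((le_max_left _ _).trans (le_max_right _ _)))) le_rfl
    · rw [e2]
      exact abs_mode_le ((EllTwo.abs_apply_le _ n).trans ((h2 t ht).trans
        ((le_max_right _ _).trans (le_max_right _ _)))) le_rfl
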